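/- **Setting.** Let $n\ge 1$ and consider on the half-line the Sturm–Liouville system $$-(P(x)\phi')'+V(x)\phi=\lambda Q(x)\phi,\quad x\in(0,\infty),\qquad \alpha_1\phi(0)+\alpha_2P(0)\phi'(0)=0,\qquad \phi(x)\in\mathbb C^n,$$ under the following assumptions. * **(A1)** $P(x),V(x),Q(x)\in\mathbb C^{n\times n}$ are self-adjoint for a.e. $x\in[0,\infty)$, $P\in AC_{\rm loc}([0,\infty))$, $V,Q\in L^1_{\rm loc}([0,\infty))$, and there are constants $\theta_P,\theta_Q>0$, $C_V\ge0$ with $(P(x)v,v)\ge\theta_P|v|^2$, $(Q(x)v,v)\ge\theta_Q|v|^2$, $|(V(x)v,v)|\le C_V|v|^2$ for a.e. $x>0$ and all $v\in\mathbb C^n$. * **(A2)** There are self-adjoint matrices $P_+,V_+,Q_+$, with $P_+,Q_+$ positive definite, and constants $C$ and $\eta>0$ such that $|P(x)-P_+|$, $|V(x)-V_+|$, $|Q(x)-Q_+|$ and $|P'(x)|$ are all at most $Ce^{-\eta x}$ for a.e. $x>0$. * **(A3)** $\alpha_1,\alpha_2\in\mathbb C^{n\times n}$, and $\alpha=(\alpha_1\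 \alpha_2)$ satisfies $\operatorname{rank}\alpha=n$ and $\alpha J\alpha^*=0$, where $J=\begin{pmatrix}0&-I_n\\ I_n&0\end{pmatrix}$. Let $\mathcal L\phi=Q^{-1}\{-(P\phi')'+V\phi\}$ with domain the set of $\phi\in L^2((0,\infty),\mathbb C^n)$ such that $\phi,\phi'\in AC_{\rm loc}([0,\infty))$, $\mathcal L\phi\in L^2$ and $\alpha_1\phi(0)+\alpha_2P(0)\phi'(0)=0$. Let $\operatorname{Mor}(\mathcal L;\lambda_0)$ be the number of eigenvalues of $\mathcal L$ in $(-\infty,\lambda_0)$, counted with multiplicity. Put $$\kappa=\inf_{r\in\mathbb C^n\setminus\{0\}}\frac{(V_+r,r)}{(Q_+r,r)},\qquad \mathbb B(x;\lambda)=\begin{pmatrix}\lambda Q(x)-V(x)&0\\0&P(x)^{-1}\end{pmatrix}.$$ **The spaces.** A subspace $\ell\subset\mathbb C^{2n}$ is Lagrangian if $\dim\ell=n$ and $(Ju,v)=0$ for all $u,v\in\ell$; limits and continuity of subspaces refer to the metric $d(\ell,\ell')=\|\mathcal P_\ell-\mathcal P_{\ell'}\|$ given by orthogonal projections. Let $\ell_1(0;\lambda)$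 be the column space of $J\alpha^*$ (it does not depend on $\lambda$); let $\ell_2(x;\lambda)$ be the space of values $y(x)$ of the solutions $y\in L^2((0,\infty),\mathbb C^{2n})$ of $Jy'=\mathbb B(x;\lambda)y$; and let $\ell_2^+(\lambda)=\lim_{x\to\infty}\ell_2(x;\lambda)$. A number $\lambda_\infty$ is called boundary inconjugate if $\ell_1(0;-\lambda_\infty)\cap\ell_2^+(-\lambda_\infty)=\{0\}$. **The Maslov index.** For continuous paths $\ell_1,\ell_2$ of Lagrangian subspaces over $[a,b]$, with frames $\binom{X_j}{Y_j}$, the matrices $$\tilde W(t)=-(X_1+iY_1)(X_1-iY_1)^{-1}(X_2-iY_2)(X_2+iY_2)^{-1}$$ are unitary and independent of the frames, and $\operatorname{Mas}(\ell_1,\ell_2;[a,b])$ is the spectral flow of $\tilde W$ through $-1$ in the counterclockwise direction: for any partition $a=t_0\le\dots\le t_N=b$ and any $\varepsilon_j\in(0,\pi)$ such that $e^{i(\pi+\varepsilon_j)}$ is not an eigenvalue of $\tilde W(t)$ for $t\in[t_j,t_{j+1}]$, it equals $\sum_{j<N}\big(k_j(t_{j+1})-k_j(t_j)\big)$, where $k_j(t)$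 is the number of eigenvalues of $\tilde W(t)$, with multiplicity, on the arc $\{e^{i(\pi+\theta)}:0\le\theta<\varepsilon_j\}$. For paths over $[0,\infty)$ that converge as $x\to\infty$, $\operatorname{Mas}(\ell_1,\ell_2;[0,\infty))$ is the index over the compactified interval $[0,\infty]$, the paths being extended by their limits. **Theorem.** Assume (A1)–(A3). Then $\ell_1(0;\lambda)$ is Lagrangian. For all $\lambda<\kappa$, the spaces $\ell_2(x;\lambda)$, $x\ge0$, are Lagrangian and depend continuously on $x$, and the limit $\ell_2^+(\lambda)$ exists and is Lagrangian. The map $\lambda\mapsto\ell_2^+(\lambda)$ is continuous on $(-\infty,\kappa)$. Moreover, for every $\lambda_0<\kappa$ there is $\Lambda_\infty\in\mathbb R$ such that for every boundary inconjugate $\lambda_\infty>\Lambda_\infty$ the Morse index is finite and $$\operatorname{Mor}(\mathcal L;\lambda_0)=\operatorname{Mas}\big(\ell_1(0;\lambda_0),\ell_2(\cdot;\lambda_0);[0,\infty)\big)-\operatorname{Mas}\big(\ell_1(0;\cdot),\ell_2^+(\cdot);[-\lambda_\infty,\lambda_0]\big).$$ -/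

import Mathlib

open MeasureTheory Set Filter Topology
open scoped Matrix Matrix.Norms.L2Operator ComplexOrder

namespace SturmLiouville

/-- `ℂⁿ` with its standard inner product. -/
abbrev Cn (n : ℕ) : Type := EuclideanSpace ℂ (Fin n)

/-- `ℂ²ⁿ = ℂⁿ ⊕ ℂⁿ` with its standard inner product. -/
abbrev C2n (n : ℕ) : Type := EuclideanSpace ℂ (Fin n ⊕ Fin n)

/-- The action of a matrix on column vectors. -/
noncomputable abbrev act {m k : Type*} [Fintype m] [Fintype k] [DecidableEq k]
    (A : Matrix m k ℂ) (v : EuclideanSpace ℂ k) : EuclideanSpace ℂ m :=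
  Matrix.toEuclideanLin A v

/-- `f ∈ AC_loc([0, ∞))`. -/
def ACLoc {X : Type*} [PseudoMetricSpace X] (f : ℝ → X) : Prop :=
  ∀ R : ℝ, 0 ≤ R → AbsolutelyContinuousOnInterval f 0 R

/-! ### Standing assumptions -/

/-- Regularity, self-adjointness and uniform bounds of the coefficients. -/
structure AssumptionA1 {n : ℕ} (P V Q : ℝ → Matrix (Fin n) (Fin n) ℂ) : Prop where
  selfAdjoint : ∀ᵐ x ∂(volume.restrict (Ici (0 : ℝ))),
    (P x).IsHermitian ∧ (V x).IsHermitian ∧ (Q x).IsHermitian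
  acP : ACLoc P
  locIntV : LocallyIntegrableOn V (Ici (0 : ℝ))
  locIntQ : LocallyIntegrableOn Q (Ici (0 : ℝ))
  bounds : ∃ θP θQ CV : ℝ, 0 < θP ∧ 0 < θQ ∧ 0 ≤ CV ∧
    ∀ᵐ x ∂(volume.restrict (Ioi (0 : ℝ))), ∀ v : Cn n,
      θP * ‖v‖ ^ 2 ≤ (inner ℂ v (act (P x) v)).re ∧
      θQ * ‖v‖ ^ 2 ≤ (inner ℂ v (act (Q x) v)).re ∧
      ‖inner ℂ v (act (V x) v)‖ ≤ CV * ‖v‖ ^ 2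

/-- Exponential convergence of the coefficients to the endstates `P₊, V₊, Q₊`, and exponential
decay of `P'`. -/
structure AssumptionA2 {n : ℕ} (P V Q : ℝ → Matrix (Fin n) (Fin n) ℂ)
    (Pplus Vplus Qplus : Matrix (Fin n) (Fin n) ℂ) : Prop where
  posDefP : Pplus.PosDef
  selfAdjointV : Vplus.IsHermitian
  posDefQ : Qplus.PosDef
  decay : ∃ C η : ℝ, 0 < η ∧ ∀ᵐ x ∂(volume.restrict (Ioi (0 : ℝ))),
      ‖P x - Pplus‖ ≤ C * Real.exp (-η * x) ∧
      ‖V x - Vplus‖ ≤ C * Real.exp (-η * x) ∧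
      ‖Q x - Qplus‖ ≤ C * Real.exp (-η * x) ∧
      ‖deriv P x‖ ≤ C * Real.exp (-η * x)

/-- The `n × 2n` matrix `α = (α₁ α₂)`. -/
def bcMatrix {n : ℕ} (α₁ α₂ : Matrix (Fin n) (Fin n) ℂ) : Matrix (Fin n) (Fin n ⊕ Fin n) ℂ :=
  Matrix.fromCols α₁ α₂

/-- `rank α = n` and `α J α* = 0`, where `Matrix.J` is `[[0, -I], [I, 0]]`. -/
structure AssumptionA3 {n : ℕ} (α₁ α₂ : Matrix (Fin n) (Fin n) ℂ) : Prop where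
  rank_eq : (bcMatrix α₁ α₂).rank = n
  selfAdjoint : bcMatrix α₁ α₂ * Matrix.J (Fin n) ℂ * (bcMatrix α₁ α₂)ᴴ = 0

/-- `κ = inf_{r ≠ 0} (V₊ r, r) / (Q₊ r, r)`. -/
noncomputable def kappa {n : ℕ} (Vplus Qplus : Matrix (Fin n) (Fin n) ℂ) : ℝ :=
  ⨅ r : {r : Cn n // r ≠ 0},
    (inner ℂ r.1 (act Vplus r.1)).re / (inner ℂ r.1 (act Qplus r.1)).re

/-! ### The operator and its Morse index -/

section Operator

variable {n : ℕ}

/-- `φ'` on `[0, ∞)` (one-sided at `0`). -/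
noncomputable def D {E : Type*} [NormedAddCommGroup E] [NormedSpace ℝ E] (φ : ℝ → E) : ℝ → E :=
  derivWithin φ (Ici (0 : ℝ))

/-- `𝓛 φ = Q⁻¹ (-(P φ')' + V φ)`. -/
noncomputable def sturmOp (P V Q : ℝ → Matrix (Fin n) (Fin n) ℂ) (φ : ℝ → Cn n) : ℝ → Cn n :=
  fun x => act (Q x)⁻¹ (-(D (fun s => act (P s) (D φ s)) x) + act (V x) (φ x))

/-- `φ` belongs to the domain `𝓓(𝓛)`. -/
structure InDomain (P V Q : ℝ → Matrix (Fin n) (Fin n) ℂ) (α₁ α₂ : Matrix (Fin n) (Fin n) ℂ)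
    (φ : ℝ → Cn n) : Prop where
  memLp : MemLp φ 2 (volume.restrict (Ioi (0 : ℝ)))
  differentiableOn : DifferentiableOn ℝ φ (Ici (0 : ℝ))
  ac : ACLoc φ
  ac_deriv : ACLoc (D φ)
  memLp_op : MemLp (sturmOp P V Q φ) 2 (volume.restrict (Ioi (0 : ℝ)))
  bc : act α₁ (φ 0) + act α₂ (act (P 0) (D φ 0)) = 0

/-- The eigenspace `{φ ∈ 𝓓(𝓛) : 𝓛 φ = lam φ}`, as a subspace of `L²((0, ∞), ℂⁿ)`. (The set whose
span is taken is already a linear subspace.) -/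
noncomputable def eigenspace (P V Q : ℝ → Matrix (Fin n) (Fin n) ℂ)
    (α₁ α₂ : Matrix (Fin n) (Fin n) ℂ) (lam : ℝ) :
    Submodule ℂ (Lp (Cn n) 2 (volume.restrict (Ioi (0 : ℝ)))) :=
  Submodule.span ℂ {f | ∃ φ : ℝ → Cn n, InDomain P V Q α₁ α₂ φ ∧
    (∀ᵐ x ∂(volume.restrict (Ioi (0 : ℝ))), f x = φ x) ∧
    ∀ᵐ x ∂(volume.restrict (Ioi (0 : ℝ))), sturmOp P V Q φ x = (lam : ℂ) • φ x}

/-- `Mor(𝓛; lam₀)`: the number of eigenvalues of `𝓛` in `(-∞, lam₀)`, counted with multiplicity;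
a priori possibly infinite. -/
noncomputable def morse (P V Q : ℝ → Matrix (Fin n) (Fin n) ℂ)
    (α₁ α₂ : Matrix (Fin n) (Fin n) ℂ) (lam₀ : ℝ) : ℕ∞ :=
  ∑' lam : Iio lam₀, Cardinal.toENat (Module.rank ℂ (eigenspace P V Q α₁ α₂ lam))

end Operator

/-! ### Lagrangian subspaces -/

section Lagrangian

variable {n : ℕ}

/-- `ℓ` is a Lagrangian subspace of `ℂ²ⁿ`. -/
def IsLagrangian (ℓ : Submodule ℂ (C2n n)) : Prop :=
  Module.finrank ℂ ℓ = n ∧ ∀ u ∈ ℓ, ∀ v ∈ ℓ, inner ℂ v (act (Matrix.J (Fin n) ℂ) u) = 0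

/-- The orthogonal projection onto `ℓ`. The metric on subspaces is
`d(ℓ, ℓ') = ‖proj ℓ - proj ℓ'‖`, so convergence and continuity of paths of subspaces are
convergence and continuity of their projections. -/
noncomputable def proj (ℓ : Submodule ℂ (C2n n)) : C2n n →L[ℂ] C2n n := ℓ.starProjection

/-- A path of subspaces is continuous on `I` with respect to the metric `d`. -/
def PathContinuousOn (ℓ : ℝ → Submodule ℂ (C2n n)) (I : Set ℝ) : Prop :=
  ContinuousOn (fun t => proj (ℓ t)) I

/-- `ℓ(x) → L` as `x → ∞`, with respect to the metric `d`. -/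
def PathTendsto (ℓ : ℝ → Submodule ℂ (C2n n)) (L : Submodule ℂ (C2n n)) : Prop :=
  Tendsto (fun x => proj (ℓ x)) atTop (𝓝 (proj L))

open Classical in
/-- `lim_{x → ∞} ℓ(x)` (and `⊥` when there is no limit; limits are unique because a subspace is
determined by its projection). -/
noncomputable def limSpace (ℓ : ℝ → Submodule ℂ (C2n n)) : Submodule ℂ (C2n n) :=
  if h : ∃ L, PathTendsto ℓ L then h.choose else ⊥

/-- The columns of the `2n × n` matrix `X` are a basis of `ℓ`. -/
def IsFrame (X : Matrix (Fin n ⊕ Fin n) (Fin n) ℂ) (ℓ : Submodule ℂ (C2n n)) : Prop :=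
  X.rank = n ∧ LinearMap.range (Matrix.toEuclideanLin X) = ℓ

open Classical in
/-- A frame of `ℓ`, whenever there is one. -/
noncomputable def frame (ℓ : Submodule ℂ (C2n n)) : Matrix (Fin n ⊕ Fin n) (Fin n) ℂ :=
  if h : ∃ X, IsFrame X ℓ then h.choose else 0

/-- `X + iY`, where `(X ; Y)` is a frame of `ℓ`. -/
noncomputable def framePlus (ℓ : Submodule ℂ (C2n n)) : Matrix (Fin n) (Fin n) ℂ :=
  (frame ℓ).toRows₁ + Complex.I • (frame ℓ).toRows₂

/-- `X - iY`, where `(X ; Y)` is a frame of `ℓ`. -/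
noncomputable def frameMinus (ℓ : Submodule ℂ (C2n n)) : Matrix (Fin n) (Fin n) ℂ :=
  (frame ℓ).toRows₁ - Complex.I • (frame ℓ).toRows₂

/-- `W̃ = -(X₁ + iY₁)(X₁ - iY₁)⁻¹(X₂ - iY₂)(X₂ + iY₂)⁻¹`, where `(Xⱼ ; Yⱼ)` is a frame of `ℓⱼ`.
For Lagrangian subspaces it does not depend on the frames. -/
noncomputable def Wtilde (ℓ₁ ℓ₂ : Submodule ℂ (C2n n)) : Matrix (Fin n) (Fin n) ℂ :=
  -(framePlus ℓ₁ * (frameMinus ℓ₁)⁻¹ * frameMinus ℓ₂ * (framePlus ℓ₂)⁻¹)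

end Lagrangian

/-! ### The Maslov index as a spectral flow through `-1` -/

section Maslov

variable {n : ℕ}

/-- The point `e^{i(π + θ)}`, at angle `θ` counterclockwise from `-1`. -/
noncomputable def arcPoint (θ : ℝ) : ℂ := Complex.exp (((Real.pi + θ : ℝ) : ℂ) * Complex.I)

/-- The number of eigenvalues of `W`, with multiplicity, on the half-open arc
`{e^{i(π + θ)} : 0 ≤ θ < ε}` that starts at `-1` (included) and runs counterclockwise. -/
noncomputable def arcCount (W : Matrix (Fin n) (Fin n) ℂ) (ε : ℝ) : ℕ :=
  ∑ᶠ (θ : ℝ) (_ : θ ∈ Ico (0 : ℝ) ε),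
    Module.finrank ℂ (Module.End.eigenspace (Matrix.toLin' W) (arcPoint θ))

/-- `m` is the spectral flow (Phillips) of the path `W` of unitary matrices through `-1` in the
counterclockwise direction over `[a, b]`: there are a partition `a = t₀ ≤ … ≤ t_N = b` and angles
`0 < εⱼ < π` such that `e^{i(π + εⱼ)}` is not an eigenvalue of `W(s)` for `s ∈ [tⱼ, tⱼ₊₁]`, and
`m` is the sum of the changes of the number of eigenvalues on the arc from `-1` to
`e^{i(π + εⱼ)}`. An eigenvalue arriving at `-1` counterclockwise counts `+1` and one leaving `-1`
clockwise counts `-1`, also at the endpoints. -/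
def IsSpectralFlow (W : ℝ → Matrix (Fin n) (Fin n) ℂ) (a b : ℝ) (m : ℤ) : Prop :=
  ∃ (N : ℕ) (t ε : ℕ → ℝ), Monotone t ∧ t 0 = a ∧ t N = b ∧
    (∀ j < N, ε j ∈ Ioo 0 Real.pi ∧ ∀ s ∈ Icc (t j) (t (j + 1)),
      ¬ Module.End.HasEigenvalue (Matrix.toLin' (W s)) (arcPoint (ε j))) ∧
    m = ∑ j ∈ Finset.range N,
      ((arcCount (W (t (j + 1))) (ε j) : ℤ) - (arcCount (W (t j)) (ε j) : ℤ))

open Classical in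
/-- `Mas(ℓ₁, ℓ₂; [a, b])`. For continuous paths of Lagrangian subspaces the spectral flow exists
and does not depend on the partition and the angles. -/
noncomputable def maslov (ℓ₁ ℓ₂ : ℝ → Submodule ℂ (C2n n)) (a b : ℝ) : ℤ :=
  if h : ∃ m : ℤ, IsSpectralFlow (fun t => Wtilde (ℓ₁ t) (ℓ₂ t)) a b m then h.choose else 0

/-- A path on `[0, ∞)`, completed by its limit at `∞` and reparametrized by
`x = t / (1 - t)`, `t ∈ [0, 1]`. -/
noncomputable def compactify (ℓ : ℝ → Submodule ℂ (C2n n)) : ℝ → Submodule ℂ (C2n n) :=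
  fun t => if t < 1 then ℓ (t / (1 - t)) else limSpace ℓ

/-- `Mas(ℓ₁, ℓ₂; [0, ∞))` for paths that converge as `x → ∞`: the half-line is compactified by
the endpoint `∞`. -/
noncomputable def maslovHalfLine (ℓ₁ ℓ₂ : ℝ → Submodule ℂ (C2n n)) : ℤ :=
  maslov (compactify ℓ₁) (compactify ℓ₂) 0 1

end Maslov

/-! ### The Lagrangian subspaces of the problem -/

section Spaces

variable {n : ℕ}

/-- `𝔹(x; lam) = diag(lam Q(x) - V(x), P(x)⁻¹)`. -/
noncomputable def bMatrix (P V Q : ℝ → Matrix (Fin n) (Fin n) ℂ) (x lam : ℝ) :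
    Matrix (Fin n ⊕ Fin n) (Fin n ⊕ Fin n) ℂ :=
  Matrix.fromBlocks ((lam : ℂ) • Q x - V x) 0 0 (P x)⁻¹

/-- `y` solves `J y' = 𝔹(x; lam) y` on `[0, ∞)`. -/
def IsSolution (P V Q : ℝ → Matrix (Fin n) (Fin n) ℂ) (lam : ℝ) (y : ℝ → C2n n) : Prop :=
  ACLoc y ∧ ∀ᵐ x ∂(volume.restrict (Ioi (0 : ℝ))),
    act (Matrix.J (Fin n) ℂ) (deriv y x) = act (bMatrix P V Q x lam) (y x)

/-- The boundary space `ℓ₁(0; lam)`, with frame `J α*`; it does not depend on `lam`. -/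
noncomputable def ellOne (α₁ α₂ : Matrix (Fin n) (Fin n) ℂ) : Submodule ℂ (C2n n) :=
  LinearMap.range (Matrix.toEuclideanLin (Matrix.J (Fin n) ℂ * (bcMatrix α₁ α₂)ᴴ))

/-- `ℓ₂(x; lam)`: the values at `x` of the solutions of `J y' = 𝔹(x; lam) y` in
`L²((0, ∞), ℂ²ⁿ)`. (The set whose span is taken is already a linear subspace.) -/
noncomputable def ellTwo (P V Q : ℝ → Matrix (Fin n) (Fin n) ℂ) (x lam : ℝ) :
    Submodule ℂ (C2n n) :=
  Submodule.span ℂ {v | ∃ y : ℝ → C2n n, IsSolution P V Q lam y ∧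
    MemLp y 2 (volume.restrict (Ioi (0 : ℝ))) ∧ y x = v}

/-- The asymptotic space `ℓ₂⁺(lam) = lim_{x → ∞} ℓ₂(x; lam)`. -/
noncomputable def ellTwoPlus (P V Q : ℝ → Matrix (Fin n) (Fin n) ℂ) (lam : ℝ) :
    Submodule ℂ (C2n n) :=
  limSpace (fun x => ellTwo P V Q x lam)

/-- `lamInf` is boundary inconjugate: `ℓ₁(0; -lamInf) ∩ ℓ₂⁺(-lamInf) = {0}`. -/
def BoundaryInconjugate (P V Q : ℝ → Matrix (Fin n) (Fin n) ℂ)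
    (α₁ α₂ : Matrix (Fin n) (Fin n) ℂ) (lamInf : ℝ) : Prop :=
  ellOne α₁ α₂ ⊓ ellTwoPlus P V Q (-lamInf) = ⊥

end Spaces

end SturmLiouville

namespace SturmLiouville

/-! ### Absolutely continuous functions -/

section AC

/-! The formula is homotopy invariance around the rectangle `[0, ∞] × [-λ∞, λ₀]` in `(x, λ)`. In the
variables `(φ, Pφ')` the equation becomes a first-order system, and `λ < κ` is an eigenvalue exactly
when the space `stab P V Q 0 λ` of initial values of square integrable solutions meets `ℓ₁`; the
dimension of the intersection is the multiplicity (`rank_eigenspace`). By `crossingDim_Wtilde` it is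
also the multiplicity of `-1` as an eigenvalue of `W̃`. On the side `x = 0` all eigenvalues cross
`-1` clockwise as `λ` grows (`Regular.clockwiseAt`), so the flow along this side counts, with a
sign, the eigenvalues of the operator in `[-λ∞, λ₀)`. On the side `λ = -λ∞` there are no crossings
once `λ∞` is large (`exists_inf_compStab_eq_bot`), and there are no eigenvalues further below. The
other two sides are the two Maslov indices, and the four contributions cancel
(`exists_finset_crossings`).

The analysis rests on one device, `Dichotomy`: a Hermitian form `K|φ|² + 2 Re⟪φ, ψ⟫` that increases
strictly along solutions. For `λ < κ` this holds with `K = 0` far out, since `V - λQ` is eventually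
positive; for very negative `λ` it holds from `x = 0` on with any given `K ≥ 0`. Square integrable
solutions are then exactly those whose form stays nonpositive (`isL2_of_form_nonpos`,
`IsL2.form_nonpos`). This condition is closed, so the spaces have closed graph; they have dimension
`n` (`finrank_stableSpace`), and compactness of the Grassmannian makes them jointly continuous in
`(x, λ)` up to `x = ∞` (`continuousOn_compStab`).

Spectral flow is handled without perturbation theory. A continuous logarithm of `det W̃` minus the
sum of the eigenvalue angles, divided by `2π`, is a winding number whose change along a path is the
spectral flow (`IsSpectralFlow.eq_winding`). One logarithm exists on the whole rectangle
(`exists_log_det`), so the sum over the boundary telescopes at the corners. -/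

lemma AbsolutelyContinuousOnInterval.of_dist_le {X Y Z : Type*} [PseudoMetricSpace X]
    [PseudoMetricSpace Y] [PseudoMetricSpace Z] {f : ℝ → X} {g : ℝ → Y} {h : ℝ → Z} {a b C : ℝ}
    (hf : AbsolutelyContinuousOnInterval f a b) (hg : AbsolutelyContinuousOnInterval g a b)
    (hC : ∀ x ∈ uIcc a b, ∀ y ∈ uIcc a b,
      dist (h x) (h y) ≤ C * (dist (f x) (f y) + dist (g x) (g y))) :
    AbsolutelyContinuousOnInterval h a b := by
  unfold AbsolutelyContinuousOnInterval at hf hg ⊢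
  have h0 := (hf.add hg).const_mul C
  simp only [add_zero, mul_zero] at h0
  refine squeeze_zero' (Eventually.of_forall fun E => Finset.sum_nonneg fun i _ => dist_nonneg)
    ?_ h0
  have : ∀ᶠ E in AbsolutelyContinuousOnInterval.totalLengthFilter ⊓
      𝓟 (AbsolutelyContinuousOnInterval.disjWithin a b),
      E ∈ AbsolutelyContinuousOnInterval.disjWithin a b :=
    mem_inf_of_right (mem_principal_self _)
  filter_upwards [this] with E hE
  rw [← Finset.sum_add_distrib, Finset.mul_sum]
  exact Finset.sum_le_sum fun i hi => hC _ (hE.1 i hi).1 _ (hE.1 i hi).2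

variable {F : Type*} [NormedAddCommGroup F] [NormedSpace ℝ F]

lemma lipschitzOnWith_integral {g : ℝ → F} {a b K : ℝ} (hK : 0 ≤ K)
    (hg : IntervalIntegrable g volume a b) (hgK : ∀ x ∈ uIcc a b, ‖g x‖ ≤ K) :
    LipschitzOnWith (Real.toNNReal K) (fun x => ∫ s in a..x, g s) (uIcc a b) := by
  refine LipschitzOnWith.of_dist_le_mul fun x hx y hy => ?_
  have hax : IntervalIntegrable g volume a x := hg.mono_set (uIcc_subset_uIcc left_mem_uIcc hx)
  have hay : IntervalIntegrable g volume a y := hg.mono_set (uIcc_subset_uIcc left_mem_uIcc hy)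
  rw [dist_eq_norm, intervalIntegral.integral_interval_sub_left hax hay, Real.coe_toNNReal _ hK,
    Real.dist_eq]
  refine intervalIntegral.norm_integral_le_of_norm_le_const fun s hs => hgK s ?_
  exact uIcc_subset_uIcc hy hx (uIoc_subset_uIcc hs)

/-- The difference of `f` and the primitive of `g` is absolutely continuous with derivative zero
almost everywhere, hence constant. The bound on `g` serves to make the primitive Lipschitz. -/
lemma integral_eq_sub_of_ac [CompleteSpace F] {f g : ℝ → F} {a b K : ℝ} (hab : a ≤ b)
    (hf : AbsolutelyContinuousOnInterval f a b) (hg : IntervalIntegrable g volume a b)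
    (hgK : ∀ x ∈ Icc a b, ‖g x‖ ≤ K)
    (hd : ∀ᵐ x, x ∈ Ioo a b → HasDerivAt f (g x) x) :
    ∫ x in a..b, g x = f b - f a := by
  have hK : 0 ≤ K := (norm_nonneg _).trans (hgK a (left_mem_Icc.2 hab))
  rw [← uIcc_of_le hab] at hgK
  have hG := (lipschitzOnWith_integral hK hg hgK).absolutelyContinuousOnInterval
  have hF := hf.sub hG
  have h₁ : ∀ᵐ x : ℝ, x ≠ a := by simp [ae_iff, measure_singleton]
  have h₂ : ∀ᵐ x : ℝ, x ≠ b := by simp [ae_iff, measure_singleton]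
  have hF0 : ∀ᵐ x, x ∈ uIcc a b → HasDerivAt (f - fun x => ∫ s in a..x, g s) 0 x := by
    filter_upwards [hg.ae_hasDerivAt_integral, hd, h₁, h₂] with x hx hx' hxa hxb hxI
    have hxI' := hxI
    rw [uIcc_of_le hab] at hxI'
    have h3 := (hx' ⟨lt_of_le_of_ne hxI'.1 hxa.symm, lt_of_le_of_ne hxI'.2 hxb⟩).sub
      (hx hxI a left_mem_uIcc)
    rwa [sub_self] at h3
  obtain ⟨C, hC⟩ := hF.const_of_ae_hasDerivAt_zero hF0
  have h1 := hC a left_mem_uIcc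
  have h2 := hC b right_mem_uIcc
  simp only [Pi.sub_apply, intervalIntegral.integral_same, sub_zero] at h1 h2
  rw [h1, ← h2, sub_sub_cancel]

omit [NormedSpace ℝ F] in
lemma ACLoc.continuousOn {f : ℝ → F} (hf : ACLoc f) :
    ContinuousOn f (Ici 0) := by
  intro x hx
  have hx0 : 0 ≤ x := hx
  have hx1 : 0 ≤ x + 1 := by linarith
  have h : ContinuousOn f (uIcc 0 (x + 1)) := AbsolutelyContinuousOnInterval.continuousOn (hf _ hx1)
  rw [uIcc_of_le hx1] at h
  have hm : Icc 0 (x + 1) ∈ 𝓝[Ici 0] x := by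
    rw [← Ici_inter_Iic]
    exact inter_mem_nhdsWithin _ (Iic_mem_nhds (lt_add_one x))
  exact (h x ⟨hx0, (lt_add_one x).le⟩).mono_of_mem_nhdsWithin hm

lemma ACLoc.ae_differentiableAt [FiniteDimensional ℝ F] {f : ℝ → F} (hf : ACLoc f) :
    ∀ᵐ x : ℝ, 0 < x → DifferentiableAt ℝ f x := by
  have : ∀ N : ℕ, ∀ᵐ x : ℝ, x ∈ uIcc (0 : ℝ) N → DifferentiableAt ℝ f x := fun N =>
    (hf N N.cast_nonneg).boundedVariationOn.ae_differentiableAt_of_mem_uIcc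
  filter_upwards [ae_all_iff.2 this] with x hx h0
  obtain ⟨N, hN⟩ := exists_nat_ge x
  exact hx N (by rw [uIcc_of_le N.cast_nonneg]; exact ⟨h0.le, hN⟩)

end AC

/-! ### Linear systems on the half-line -/

section Systems

variable {E : Type*} [NormedAddCommGroup E] [InnerProductSpace ℂ E]

/-- The coefficient is measurable and bounded by `M`. -/
structure BddCoef (A : ℝ → E →L[ℂ] E) (M : ℝ) : Prop where
  meas : AEStronglyMeasurable A volume
  bound : ∀ x, ‖A x‖ ≤ M

/-- `y` solves `y' = A(x) y` on `[0, ∞)` (in integrated form). -/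
structure IsSol (A : ℝ → E →L[ℂ] E) (y : ℝ → E) : Prop where
  cont : ContinuousOn y (Ici 0)
  eq : ∀ x, 0 ≤ x → y x = y 0 + ∫ s in (0 : ℝ)..x, A s (y s)

variable {A B : ℝ → E →L[ℂ] E} {M M' : ℝ} {y z : ℝ → E}

lemma BddCoef.nonneg (hA : BddCoef A M) : 0 ≤ M := (norm_nonneg _).trans (hA.bound 0)

lemma BddCoef.mono (hA : BddCoef A M) (h : M ≤ M') : BddCoef A M' :=
  ⟨hA.meas, fun _ => (hA.bound _).trans h⟩

lemma BddCoef.shift (hA : BddCoef A M) (x₀ : ℝ) : BddCoef (fun x => A (x₀ + x)) M :=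
  ⟨hA.meas.comp_quasiMeasurePreserving (measurePreserving_add_left volume x₀).quasiMeasurePreserving,
    fun _ => hA.bound _⟩

lemma uIcc_subset_Ici {a b : ℝ} (ha : 0 ≤ a) (hb : 0 ≤ b) : uIcc a b ⊆ Ici 0 := fun _ hx =>
  (le_min ha hb).trans hx.1

lemma BddCoef.intervalIntegrable_apply (hA : BddCoef A M) (hy : ContinuousOn y (Ici 0)) {a b : ℝ}
    (ha : 0 ≤ a) (hb : 0 ≤ b) : IntervalIntegrable (fun s => A s (y s)) volume a b := by
  have hy' : IntervalIntegrable y volume a b :=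
    (hy.mono (uIcc_subset_Ici ha hb)).intervalIntegrable
  refine (hy'.norm.const_mul M).mono_fun ?_ (Eventually.of_forall fun s => ?_)
  · exact isBoundedBilinearMap_apply.continuous.comp_aestronglyMeasurable
      (hA.meas.restrict.prodMk (intervalIntegrable_iff.1 hy').aestronglyMeasurable)
  · simp only [norm_mul, norm_norm]
    refine ((A s).le_opNorm _).trans ?_
    gcongr
    exact (hA.bound s).trans (le_abs_self M)

variable (hA : BddCoef A M) (hB : BddCoef B M')
include hA

lemma IsSol.eq_add (hy : IsSol A y) {a b : ℝ} (ha : 0 ≤ a) (hb : 0 ≤ b) :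
    y b = y a + ∫ s in a..b, A s (y s) := by
  rw [hy.eq b hb, hy.eq a ha, add_assoc, intervalIntegral.integral_add_adjacent_intervals
    (hA.intervalIntegrable_apply hy.cont le_rfl ha) (hA.intervalIntegrable_apply hy.cont ha hb)]

lemma IsSol.exists_lipschitz (hy : IsSol A y) {R : ℝ} (hR : 0 ≤ R) :
    ∃ K, LipschitzOnWith K y (uIcc 0 R) := by
  obtain ⟨C, hC⟩ := isCompact_uIcc.exists_bound_of_continuousOn
    (hy.cont.mono (uIcc_subset_Ici le_rfl hR))
  have hC0 : 0 ≤ C := (norm_nonneg _).trans (hC 0 left_mem_uIcc)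
  have := lipschitzOnWith_integral (K := M * C) (mul_nonneg hA.nonneg hC0)
    (hA.intervalIntegrable_apply hy.cont le_rfl hR)
    (fun x hx => ((A x).le_opNorm _).trans
      (mul_le_mul (hA.bound x) (hC x hx) (norm_nonneg _) hA.nonneg))
  refine ⟨Real.toNNReal (M * C), LipschitzOnWith.of_dist_le_mul fun x hx z hz => ?_⟩
  rw [hy.eq x (uIcc_subset_Ici le_rfl hR hx), hy.eq z (uIcc_subset_Ici le_rfl hR hz),
    dist_add_left]
  exact this.dist_le_mul x hx z hz

lemma IsSol.acLoc (hy : IsSol A y) : ACLoc y := fun _ hR =>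
  (hy.exists_lipschitz hA hR).choose_spec.absolutelyContinuousOnInterval

lemma IsSol.ae_hasDerivAt [CompleteSpace E] (hy : IsSol A y) :
    ∀ᵐ x : ℝ, 0 < x → HasDerivAt y (A x (y x)) x := by
  have : ∀ N : ℕ, ∀ᵐ x : ℝ, x ∈ uIcc (0 : ℝ) N → ∀ c ∈ uIcc (0 : ℝ) N,
      HasDerivAt (fun x => ∫ s in c..x, A s (y s)) (A x (y x)) x := fun N =>
    (hA.intervalIntegrable_apply hy.cont le_rfl N.cast_nonneg).ae_hasDerivAt_integral
  filter_upwards [ae_all_iff.2 this] with x hx h0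
  obtain ⟨N, hN⟩ := exists_nat_ge x
  have h := (hx N (by rw [uIcc_of_le N.cast_nonneg]; exact ⟨h0.le, hN⟩) 0 left_mem_uIcc).const_add
    (y 0)
  refine h.congr_of_eventuallyEq ?_
  filter_upwards [Ioi_mem_nhds h0] with s hs using hy.eq s (le_of_lt hs)

/-- Together with `IsSol.ae_hasDerivAt` and `IsSol.acLoc` this identifies the integrated form of the
equation with the almost everywhere form. -/
lemma IsSol.of_ac [CompleteSpace E] (hy : ACLoc y)
    (h : ∀ᵐ x : ℝ, 0 < x → HasDerivAt y (A x (y x)) x) : IsSol A y := by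
  refine ⟨hy.continuousOn, fun x hx => ?_⟩
  obtain ⟨C, hC⟩ := isCompact_Icc.exists_bound_of_continuousOn
    (hy.continuousOn.mono (Icc_subset_Ici_self : Icc 0 x ⊆ Ici 0))
  rw [integral_eq_sub_of_ac (K := M * C) hx (hy x hx)
    (hA.intervalIntegrable_apply hy.continuousOn le_rfl hx)
    (fun s hs => ((A s).le_opNorm _).trans
      (mul_le_mul (hA.bound s) (hC s hs) (norm_nonneg _) hA.nonneg))
    (by filter_upwards [h] with s hs hs' using hs hs'.1)]
  abel

include hB in
/-- Integrated product rule for the pairing `⟪y, T z⟫` of two solutions. -/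
lemma IsSol.integral_inner [CompleteSpace E] (hy : IsSol A y) (hz : IsSol B z) (T : E →L[ℂ] E)
    {a b : ℝ} (ha : 0 ≤ a) (hab : a ≤ b) :
    IntervalIntegrable
      (fun s => inner ℂ (A s (y s)) (T (z s)) + inner ℂ (y s) (T (B s (z s)))) volume a b ∧
    ∫ s in a..b, (inner ℂ (A s (y s)) (T (z s)) + inner ℂ (y s) (T (B s (z s)))) =
      inner ℂ (y b) (T (z b)) - inner ℂ (y a) (T (z a)) := by
  have hb := ha.trans hab
  have hsub := uIcc_subset_Ici ha hb
  obtain ⟨C, hC⟩ := isCompact_uIcc.exists_bound_of_continuousOn (hy.cont.mono hsub)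
  obtain ⟨D, hD⟩ := isCompact_uIcc.exists_bound_of_continuousOn (hz.cont.mono hsub)
  have hC0 : 0 ≤ C := (norm_nonneg _).trans (hC a left_mem_uIcc)
  have hD0 : 0 ≤ D := (norm_nonneg _).trans (hD a left_mem_uIcc)
  have hAy := hA.intervalIntegrable_apply hy.cont ha hb
  have hBz := hB.intervalIntegrable_apply hz.cont ha hb
  have hyI : IntervalIntegrable y volume a b := (hy.cont.mono hsub).intervalIntegrable
  have hzI : IntervalIntegrable z volume a b := (hz.cont.mono hsub).intervalIntegrable
  have bd : ∀ s ∈ uIcc a b, ‖inner ℂ (A s (y s)) (T (z s)) + inner ℂ (y s) (T (B s (z s)))‖ ≤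
      M * C * (‖T‖ * D) + C * (‖T‖ * (M' * D)) := by
    intro s hs
    have h1 : ‖A s (y s)‖ ≤ M * C := ((A s).le_opNorm _).trans
      (mul_le_mul (hA.bound s) (hC s hs) (norm_nonneg _) hA.nonneg)
    have h2 : ‖B s (z s)‖ ≤ M' * D := ((B s).le_opNorm _).trans
      (mul_le_mul (hB.bound s) (hD s hs) (norm_nonneg _) hB.nonneg)
    refine (norm_add_le _ _).trans (add_le_add ?_ ?_)
    · refine (norm_inner_le_norm _ _).trans (mul_le_mul h1 ((T.le_opNorm _).trans ?_)
        (norm_nonneg _) (mul_nonneg hA.nonneg hC0))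
      exact mul_le_mul_of_nonneg_left (hD s hs) (norm_nonneg _)
    · refine (norm_inner_le_norm _ _).trans (mul_le_mul (hC s hs) ((T.le_opNorm _).trans ?_)
        (norm_nonneg _) hC0)
      exact mul_le_mul_of_nonneg_left h2 (norm_nonneg _)
  have hint : IntervalIntegrable
      (fun s => inner ℂ (A s (y s)) (T (z s)) + inner ℂ (y s) (T (B s (z s)))) volume a b := by
    refine (intervalIntegrable_const (c := M * C * (‖T‖ * D) + C * (‖T‖ * (M' * D)))).mono_fun' ?_ ?_
    · exact ((intervalIntegrable_iff.1 hAy).aestronglyMeasurable.inner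
        (T.continuous.comp_aestronglyMeasurable (intervalIntegrable_iff.1 hzI).aestronglyMeasurable)).add
        ((intervalIntegrable_iff.1 hyI).aestronglyMeasurable.inner
          (T.continuous.comp_aestronglyMeasurable (intervalIntegrable_iff.1 hBz).aestronglyMeasurable))
    · exact (ae_restrict_iff' measurableSet_uIoc).2
        (Eventually.of_forall fun s hs => bd s (uIoc_subset_uIcc hs))
  refine ⟨hint, ?_⟩
  refine integral_eq_sub_of_ac (f := fun s => inner ℂ (y s) (T (z s))) hab ?_ hint
    (fun s hs => bd s (by rwa [uIcc_of_le hab])) ?_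
  · have hm : uIcc a b ⊆ uIcc 0 b :=
      uIcc_subset_uIcc (by rw [uIcc_of_le hb]; exact ⟨ha, hab⟩) right_mem_uIcc
    refine AbsolutelyContinuousOnInterval.of_dist_le ((hy.acLoc hA b hb).mono hm)
      ((hz.acLoc hB b hb).mono hm) (C := ‖T‖ * D + C * ‖T‖) fun s hs t ht => ?_
    -- A pairing of two bounded absolutely continuous functions is controlled by the increments of
    -- both factors.
    rw [dist_eq_norm, show inner ℂ (y s) (T (z s)) - inner ℂ (y t) (T (z t)) =
      inner ℂ (y s - y t) (T (z s)) + inner ℂ (y t) (T (z s - z t)) by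
        simp only [inner_sub_left, map_sub, inner_sub_right]; ring]
    have e1 : ‖inner ℂ (y s - y t) (T (z s))‖ ≤ dist (y s) (y t) * (‖T‖ * D) := by
      rw [dist_eq_norm]
      refine (norm_inner_le_norm _ _).trans (mul_le_mul_of_nonneg_left ?_ (norm_nonneg _))
      exact (T.le_opNorm _).trans (mul_le_mul_of_nonneg_left (hD s hs) (norm_nonneg _))
    have e2 : ‖inner ℂ (y t) (T (z s - z t))‖ ≤ C * (‖T‖ * dist (z s) (z t)) := by
      rw [dist_eq_norm]
      exact (norm_inner_le_norm _ _).trans (mul_le_mul (hC t ht) (T.le_opNorm _) (norm_nonneg _) hC0)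
    refine (norm_add_le _ _).trans ((add_le_add e1 e2).trans ?_)
    have p1 : 0 ≤ ‖T‖ * D := by positivity
    have p2 : 0 ≤ C * ‖T‖ := by positivity
    nlinarith [mul_nonneg p1 (dist_nonneg (x := z s) (y := z t)),
      mul_nonneg p2 (dist_nonneg (x := y s) (y := y t))]
  · filter_upwards [hy.ae_hasDerivAt hA, hz.ae_hasDerivAt hB] with s h1 h2 hs
    have hs0 : 0 < s := lt_of_le_of_lt ha hs.1
    have := (h1 hs0).inner ℂ ((T.restrictScalars ℝ).hasFDerivAt.comp_hasDerivAt s (h2 hs0))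
    exact this.congr_deriv (add_comm (inner ℂ (y s) (T (B s (z s)))) _)

end Systems

/-- Grönwall's inequality: the right-hand side of the hypothesis, multiplied by `exp (-M (x - a))`,
has nonpositive derivative. -/
lemma le_exp_of_le_integral {u : ℝ → ℝ} (hu : Continuous u) {a b C M : ℝ} (hM : 0 ≤ M)
    (h : ∀ x ∈ Icc a b, u x ≤ C + M * ∫ s in a..x, u s) {x : ℝ} (hx : x ∈ Icc a b) :
    u x ≤ C * Real.exp (M * (x - a)) := by
  have hd : ∀ x, HasDerivAt (fun x => Real.exp (-(M * (x - a))) * (C + M * ∫ s in a..x, u s))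
      (Real.exp (-(M * (x - a))) * M * (u x - (C + M * ∫ s in a..x, u s))) x := by
    intro x
    have h1 : HasDerivAt (fun x => ∫ s in a..x, u s) (u x) x :=
      intervalIntegral.integral_hasDerivAt_right (hu.intervalIntegrable _ _)
        (hu.stronglyMeasurableAtFilter _ _) hu.continuousAt
    have h2 : HasDerivAt (fun x => Real.exp (-(M * (x - a)))) (Real.exp (-(M * (x - a))) * -M) x := by
      have := (((hasDerivAt_id x).sub_const a).const_mul M).neg.exp
      simpa using this
    refine (h2.mul ((h1.const_mul M).const_add C)).congr_deriv ?_
    ring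
  have hanti : AntitoneOn (fun x => Real.exp (-(M * (x - a))) * (C + M * ∫ s in a..x, u s))
      (Icc a b) := by
    refine antitoneOn_of_deriv_nonpos (convex_Icc a b)
      (fun x _ => (hd x).continuousAt.continuousWithinAt)
      (fun x _ => (hd x).differentiableAt.differentiableWithinAt) fun x hx => ?_
    rw [(hd x).deriv]
    rw [interior_Icc] at hx
    exact mul_nonpos_of_nonneg_of_nonpos (by positivity)
      (sub_nonpos.2 (h x ⟨hx.1.le, hx.2.le⟩))
  have h3 := hanti (left_mem_Icc.2 (hx.1.trans hx.2)) hx hx.1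
  simp only [sub_self, mul_zero, neg_zero, Real.exp_zero, one_mul, intervalIntegral.integral_same,
    add_zero] at h3
  refine (h x hx).trans ?_
  have h4 := mul_le_mul_of_nonneg_right h3 (Real.exp_pos (M * (x - a))).le
  rwa [mul_assoc, mul_comm _ (Real.exp (M * (x - a))), ← mul_assoc, ← Real.exp_add,
    neg_add_cancel, Real.exp_zero, one_mul] at h4

/-! ### Growth, uniqueness, existence and continuous dependence for linear systems -/

section Systems

variable {E : Type*} [NormedAddCommGroup E] [InnerProductSpace ℂ E]
variable {A B : ℝ → E →L[ℂ] E} {M M' : ℝ} {y z : ℝ → E}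

lemma IsSol.continuous_max (hy : IsSol A y) : Continuous fun x => y (max x 0) :=
  hy.cont.comp_continuous (by fun_prop) fun x => mem_Ici.2 (le_max_right x 0)

lemma IsSol.zero : IsSol A (0 : ℝ → E) := ⟨continuousOn_const, fun x _ => by simp⟩

lemma IsSol.smul (hy : IsSol A y) (c : ℂ) : IsSol A (c • y) := by
  refine ⟨hy.cont.const_smul c, fun x hx => ?_⟩
  simp only [Pi.smul_apply, map_smul, intervalIntegral.integral_smul]
  rw [hy.eq x hx, smul_add]

lemma IsSol.add (hA : BddCoef A M) (hy : IsSol A y) (hz : IsSol A z) : IsSol A (y + z) := by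
  refine ⟨hy.cont.add hz.cont, fun x hx => ?_⟩
  simp only [Pi.add_apply, map_add]
  rw [hy.eq x hx, hz.eq x hx, intervalIntegral.integral_add
    (hA.intervalIntegrable_apply hy.cont le_rfl hx) (hA.intervalIntegrable_apply hz.cont le_rfl hx)]
  abel

lemma IsSol.sub (hA : BddCoef A M) (hy : IsSol A y) (hz : IsSol A z) : IsSol A (y - z) := by
  simpa [sub_eq_add_neg] using hy.add hA (hz.smul (-1))

lemma IsSol.shift (hA : BddCoef A M) (hy : IsSol A y) {x₀ : ℝ} (hx₀ : 0 ≤ x₀) :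
    IsSol (fun x => A (x₀ + x)) (fun x => y (x₀ + x)) := by
  refine ⟨hy.cont.comp (by fun_prop) fun x hx => add_nonneg hx₀ hx, fun x hx => ?_⟩
  simp only [add_zero]
  rw [intervalIntegral.integral_comp_add_left (fun s => A s (y s)), add_zero]
  exact hy.eq_add hA hx₀ (add_nonneg hx₀ hx)

lemma IsSol.congr (hy : IsSol A y) (h : ∀ x, 0 ≤ x → z x = y x) : IsSol A z := by
  refine ⟨hy.cont.congr fun x hx => h x hx, fun x hx => ?_⟩
  rw [h x hx, h 0 le_rfl, hy.eq x hx]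
  congr 1
  refine intervalIntegral.integral_congr fun s hs => ?_
  rw [uIcc_of_le hx] at hs
  simp only [h s hs.1]

/-- Growth and decay of solutions are at most exponential. -/
lemma IsSol.norm_le (hA : BddCoef A M) (hy : IsSol A y) {a b : ℝ} (ha : 0 ≤ a) (hb : 0 ≤ b) :
    ‖y b‖ ≤ ‖y a‖ * Real.exp (M * |b - a|) := by
  rcases le_total a b with hab | hab
  · have key : ∀ x ∈ Icc a b, ‖y (max x 0)‖ ≤ ‖y a‖ + M * ∫ s in a..x, ‖y (max s 0)‖ := by
      intro x hx
      have hx0 := ha.trans hx.1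
      rw [max_eq_left hx0, hy.eq_add hA ha hx0]
      refine (norm_add_le _ _).trans (add_le_add le_rfl ?_)
      rw [← intervalIntegral.integral_const_mul]
      refine intervalIntegral.norm_integral_le_of_norm_le hx.1 (Eventually.of_forall fun s hs => ?_)
        ((hy.continuous_max.norm.const_mul M |>.intervalIntegrable _ _))
      rw [max_eq_left (ha.trans hs.1.le)]
      exact ((A s).le_opNorm _).trans (mul_le_mul_of_nonneg_right (hA.bound s) (norm_nonneg _))
    have := le_exp_of_le_integral hy.continuous_max.norm hA.nonneg key (right_mem_Icc.2 hab)
    rwa [max_eq_left hb, ← abs_of_nonneg (sub_nonneg.2 hab)] at this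
  -- Backward in time, Grönwall is applied to the reflected function `s ↦ y (a - s)`.
  · have hc : Continuous fun s => ‖y (max (a - s) 0)‖ :=
      (hy.continuous_max.comp (by fun_prop : Continuous fun s : ℝ => a - s)).norm
    have key : ∀ x ∈ Icc 0 (a - b), ‖y (max (a - x) 0)‖ ≤
        ‖y a‖ + M * ∫ s in (0 : ℝ)..x, ‖y (max (a - s) 0)‖ := by
      intro x hx
      have hx0 : 0 ≤ a - x := by linarith [hx.2]
      rw [max_eq_left hx0]
      have h1 := hy.eq_add hA ha hx0
      rw [intervalIntegral.integral_symm] at h1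
      rw [h1]
      refine (norm_add_le _ _).trans (add_le_add le_rfl ?_)
      rw [norm_neg, ← intervalIntegral.integral_const_mul,
        intervalIntegral.integral_comp_sub_left (fun s => M * ‖y (max s 0)‖), sub_zero]
      refine intervalIntegral.norm_integral_le_of_norm_le (by linarith [hx.1])
        (Eventually.of_forall fun s hs => ?_)
        ((hy.continuous_max.norm.const_mul M |>.intervalIntegrable _ _))
      rw [max_eq_left (hx0.trans hs.1.le)]
      exact ((A s).le_opNorm _).trans (mul_le_mul_of_nonneg_right (hA.bound s) (norm_nonneg _))
    have := le_exp_of_le_integral hc hA.nonneg key (right_mem_Icc.2 (sub_nonneg.2 hab))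
    rw [abs_sub_comm, abs_of_nonneg (sub_nonneg.2 hab)]
    simpa [max_eq_left hb] using this

/-- Uniqueness holds in both time directions because the exponential bound does; the backward
direction makes the evolution operators injective. -/
lemma IsSol.eq_of_eq (hA : BddCoef A M) (hy : IsSol A y) (hz : IsSol A z) {a b : ℝ} (ha : 0 ≤ a)
    (hb : 0 ≤ b) (h : y a = z a) : y b = z b := by
  have := (hy.sub hA hz).norm_le hA ha hb
  simp only [Pi.sub_apply, h, sub_self, norm_zero, zero_mul] at this
  exact sub_eq_zero.1 (norm_le_zero_iff.1 this)

/-- Continuous dependence of solutions on the coefficient and the initial value. -/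
lemma IsSol.norm_sub_le (hA : BddCoef A M) (hB : BddCoef B M') (hy : IsSol A y) (hz : IsSol B z)
    {X δ : ℝ} (hX : 0 ≤ X) (hδ : ∀ s ∈ Icc 0 X, ‖A s - B s‖ ≤ δ) :
    ‖y X - z X‖ ≤ (‖y 0 - z 0‖ + δ * ∫ s in (0 : ℝ)..X, ‖z s‖) * Real.exp (M * X) := by
  have hδ0 : 0 ≤ δ := (norm_nonneg _).trans (hδ 0 ⟨le_rfl, hX⟩)
  have hc : Continuous fun x => ‖y (max x 0) - z (max x 0)‖ :=
    (hy.continuous_max.sub hz.continuous_max).norm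
  have zI : ∀ x, 0 ≤ x → IntervalIntegrable (fun s => ‖z s‖) volume 0 x := fun x hx =>
    ((hz.cont.mono (uIcc_subset_Ici le_rfl hx)).norm).intervalIntegrable
  have key : ∀ x ∈ Icc 0 X, ‖y (max x 0) - z (max x 0)‖ ≤
      (‖y 0 - z 0‖ + δ * ∫ s in (0 : ℝ)..X, ‖z s‖) +
        M * ∫ s in (0 : ℝ)..x, ‖y (max s 0) - z (max s 0)‖ := by
    intro x hx
    have hAy := hA.intervalIntegrable_apply hy.cont le_rfl hx.1
    have hAz := hA.intervalIntegrable_apply hz.cont le_rfl hx.1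
    have hBz := hB.intervalIntegrable_apply hz.cont le_rfl hx.1
    have e : y x - z x = (y 0 - z 0) + ∫ s in (0 : ℝ)..x,
        (A s (y s - z s) + (A s - B s) (z s)) := by
      rw [hy.eq x hx.1, hz.eq x hx.1]
      rw [show (fun s => A s (y s - z s) + (A s - B s) (z s)) =
        fun s => A s (y s) - B s (z s) by ext s; simp, intervalIntegral.integral_sub hAy hBz]
      abel
    rw [max_eq_left hx.1, e, add_assoc]
    refine (norm_add_le _ _).trans (add_le_add le_rfl ?_)
    have h1 : ∫ s in (0 : ℝ)..x, (M * ‖y (max s 0) - z (max s 0)‖ + δ * ‖z s‖) ≤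
        δ * (∫ s in (0 : ℝ)..X, ‖z s‖) + M * ∫ s in (0 : ℝ)..x, ‖y (max s 0) - z (max s 0)‖ := by
      rw [intervalIntegral.integral_add (hc.const_mul M |>.intervalIntegrable _ _)
        ((zI x hx.1).const_mul δ), intervalIntegral.integral_const_mul,
        intervalIntegral.integral_const_mul, add_comm]
      refine add_le_add (mul_le_mul_of_nonneg_left ?_ hδ0) le_rfl
      exact intervalIntegral.integral_mono_interval le_rfl hx.1 hx.2
        (Eventually.of_forall fun s => norm_nonneg _) (zI X hX)
    refine le_trans ?_ h1
    refine intervalIntegral.norm_integral_le_of_norm_le hx.1 (Eventually.of_forall fun s hs => ?_)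
      ((hc.const_mul M |>.intervalIntegrable _ _).add ((zI x hx.1).const_mul δ))
    rw [max_eq_left hs.1.le]
    refine (norm_add_le _ _).trans (add_le_add ?_ ?_)
    · exact ((A s).le_opNorm _).trans (mul_le_mul_of_nonneg_right (hA.bound s) (norm_nonneg _))
    · exact ((A s - B s).le_opNorm _).trans
        (mul_le_mul_of_nonneg_right (hδ s ⟨hs.1.le, hs.2.trans hx.2⟩) (norm_nonneg _))
  have := le_exp_of_le_integral hc hA.nonneg key (right_mem_Icc.2 hX)
  rwa [max_eq_left hX, sub_zero] at this

-- Picard iteration for `z = exp (-2Kx) y` in the space of bounded continuous functions: the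
-- exponential weight makes the iteration a contraction with factor `1/2` on the whole half-line at
-- once.
open BoundedContinuousFunction in
lemma exists_isSol [CompleteSpace E] (hA : BddCoef A M) (v : E) : ∃ y, IsSol A y ∧ y 0 = v := by
  -- The bound is enlarged to be strictly positive because the weight integral is divided by `2K`.
  obtain ⟨K, hK0, hAK⟩ : ∃ K, 0 < K ∧ BddCoef A K :=
    ⟨M + 1, by linarith [hA.nonneg], hA.mono (by linarith)⟩
  have hcz : ∀ z : ℝ →ᵇ E, ContinuousOn (fun s => Real.exp (2 * K * s) • z s) (Ici 0) := fun z =>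
    (by fun_prop : Continuous fun s => Real.exp (2 * K * s) • z s).continuousOn
  have hint : ∀ (z : ℝ →ᵇ E) {a b : ℝ}, 0 ≤ a → 0 ≤ b →
      IntervalIntegrable (fun s => A s (Real.exp (2 * K * s) • z s)) volume a b :=
    fun z a b ha hb => hAK.intervalIntegrable_apply (hcz z) ha hb
  have hexp : ∀ x, ∫ s in (0 : ℝ)..x, Real.exp (2 * K * s) = (Real.exp (2 * K * x) - 1) / (2 * K) := by
    intro x
    rw [intervalIntegral.integral_comp_mul_left (fun s => Real.exp s) (by positivity), integral_exp]
    simp; field_simp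
  have hbd : ∀ (z : ℝ →ᵇ E) (x : ℝ), 0 ≤ x →
      ‖∫ s in (0 : ℝ)..x, A s (Real.exp (2 * K * s) • z s)‖ ≤ Real.exp (2 * K * x) * (‖z‖ / 2) := by
    intro z x hx
    have : ‖∫ s in (0 : ℝ)..x, A s (Real.exp (2 * K * s) • z s)‖ ≤
        ∫ s in (0 : ℝ)..x, K * ‖z‖ * Real.exp (2 * K * s) := by
      refine intervalIntegral.norm_integral_le_of_norm_le hx (Eventually.of_forall fun s hs => ?_)
        ((by fun_prop : Continuous fun s => K * ‖z‖ * Real.exp (2 * K * s)).intervalIntegrable _ _)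
      refine ((A s).le_opNorm _).trans ?_
      rw [norm_smul, Real.norm_of_nonneg (Real.exp_pos _).le, mul_assoc K, mul_comm ‖z‖]
      exact mul_le_mul (hAK.bound s) (mul_le_mul_of_nonneg_left (z.norm_coe_le_norm s)
        (Real.exp_pos _).le) (by positivity) hK0.le
    refine this.trans ?_
    rw [intervalIntegral.integral_const_mul, hexp]
    have : 0 ≤ ‖z‖ := norm_nonneg _
    rw [show K * ‖z‖ * ((Real.exp (2 * K * x) - 1) / (2 * K)) = (Real.exp (2 * K * x) - 1) * (‖z‖ / 2)
      by field_simp]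
    exact mul_le_mul_of_nonneg_right (by linarith) (by positivity)
  have hcont : ∀ z : ℝ →ᵇ E, Continuous fun x : ℝ => Real.exp (-(2 * K * max x 0)) •
      (v + ∫ s in (0 : ℝ)..(max x 0), A s (Real.exp (2 * K * s) • z s)) := by
    intro z
    have h0 : Continuous fun x : ℝ => ∫ s in (0 : ℝ)..(max x 0), A s (Real.exp (2 * K * s) • z s) := by
      have h1 : ContinuousOn (fun x => ∫ s in (0 : ℝ)..x, A s (Real.exp (2 * K * s) • z s)) (Ici 0) := by
        intro x hx
        have hx0 : 0 ≤ x := hx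
        have := intervalIntegral.continuousOn_primitive_interval (a := 0) (b := x + 1)
          ((intervalIntegrable_iff' (by simp)).1 (hint z le_rfl (by linarith)))
        rw [uIcc_of_le (by linarith)] at this
        have hm : Icc 0 (x + 1) ∈ 𝓝[Ici 0] x := by
          rw [← Ici_inter_Iic]
          exact inter_mem_nhdsWithin _ (Iic_mem_nhds (lt_add_one x))
        exact (this x ⟨hx0, (lt_add_one x).le⟩).mono_of_mem_nhdsWithin hm
      exact h1.comp_continuous (by fun_prop) fun x => mem_Ici.2 (le_max_right x 0)
    fun_prop
  -- The argument is truncated to `max x 0` so that the functions live on all of `ℝ`; only `x ≥ 0`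
  -- matters.
  let T : (ℝ →ᵇ E) → (ℝ →ᵇ E) := fun z => BoundedContinuousFunction.ofNormedAddCommGroup
    (fun x : ℝ => Real.exp (-(2 * K * max x 0)) •
      (v + ∫ s in (0 : ℝ)..(max x 0), A s (Real.exp (2 * K * s) • z s))) (hcont z) (‖v‖ + ‖z‖ / 2) (by
    intro x
    have hx : 0 ≤ max x 0 := le_max_right _ _
    rw [norm_smul, Real.norm_of_nonneg (Real.exp_pos _).le]
    refine (mul_le_mul_of_nonneg_left ((norm_add_le _ _).trans (add_le_add le_rfl (hbd z _ hx)))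
      (Real.exp_pos _).le).trans ?_
    rw [mul_add, ← mul_assoc, ← Real.exp_add, neg_add_cancel, Real.exp_zero, one_mul]
    refine add_le_add (mul_le_of_le_one_left (norm_nonneg _) ?_) le_rfl
    exact Real.exp_le_one_iff.2 (by have : 0 ≤ 2 * K * max x 0 := by positivity
                                    linarith))
  have hT : ∀ z x, T z x = Real.exp (-(2 * K * max x 0)) •
      (v + ∫ s in (0 : ℝ)..(max x 0), A s (Real.exp (2 * K * s) • z s)) := fun z x => rfl
  have hcontr : ContractingWith (1 / 2) T := by
    refine ⟨by rw [← NNReal.coe_lt_coe]; norm_num, LipschitzWith.of_dist_le_mul fun z w => ?_⟩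
    rw [BoundedContinuousFunction.dist_le (by positivity)]
    intro x
    have hx : 0 ≤ max x 0 := le_max_right _ _
    rw [dist_eq_norm, hT, hT, ← smul_sub, add_sub_add_left_eq_sub,
      ← intervalIntegral.integral_sub (hint z le_rfl hx) (hint w le_rfl hx), norm_smul,
      Real.norm_of_nonneg (Real.exp_pos _).le]
    have := hbd (z - w) _ hx
    simp only [BoundedContinuousFunction.coe_sub, Pi.sub_apply, smul_sub, map_sub] at this
    refine (mul_le_mul_of_nonneg_left this (Real.exp_pos _).le).trans ?_
    rw [← mul_assoc, ← Real.exp_add, neg_add_cancel, Real.exp_zero, one_mul, dist_eq_norm]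
    apply le_of_eq
    push_cast
    ring
  have : Nonempty (ℝ →ᵇ E) := ⟨0⟩
  let z := ContractingWith.fixedPoint T hcontr
  have hz : T z = z := hcontr.fixedPoint_isFixedPt
  have hzx : ∀ x, 0 ≤ x → Real.exp (2 * K * x) • z x =
      v + ∫ s in (0 : ℝ)..x, A s (Real.exp (2 * K * s) • z s) := by
    intro x hx
    have : z x = T z x := by rw [hz]
    rw [this, hT, max_eq_left hx, smul_smul, ← Real.exp_add, add_neg_cancel, Real.exp_zero, one_smul]
  refine ⟨fun x => Real.exp (2 * K * x) • z x, ⟨hcz z, fun x hx => ?_⟩, ?_⟩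
  · have h0 := hzx 0 le_rfl
    rw [intervalIntegral.integral_same, add_zero] at h0
    rw [hzx x hx, h0]
  · simpa using hzx 0 le_rfl

/-- The evolution operators of a linear system on the half-line. -/
lemma exists_flow [FiniteDimensional ℂ E] (hA : BddCoef A M) :
    ∃ Φ : ℝ → E ≃L[ℂ] E, (∀ v, IsSol A (fun x => Φ x v)) ∧ ∀ v, Φ 0 v = v := by
  have : CompleteSpace E := FiniteDimensional.complete ℂ E
  choose S hS hS0 using fun v => exists_isSol hA v
  have hadd : ∀ x, 0 ≤ x → ∀ v w, S (v + w) x = S v x + S w x := fun x hx v w =>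
    (hS (v + w)).eq_of_eq hA ((hS v).add hA (hS w)) le_rfl hx (by simp [hS0])
  have hsmul : ∀ x, 0 ≤ x → ∀ (c : ℂ) v, S (c • v) x = c • S v x := fun x hx c v =>
    (hS (c • v)).eq_of_eq hA ((hS v).smul c) le_rfl hx (by simp [hS0])
  let L : ℝ → E →ₗ[ℂ] E := fun x =>
    { toFun := fun v => S v (max x 0)
      map_add' := hadd _ (le_max_right _ _)
      map_smul' := hsmul _ (le_max_right _ _) }
  have hL : ∀ x, Function.Injective (L x) := fun x v w h => by
    have := (hS v).eq_of_eq hA (hS w) (le_max_right x 0) le_rfl h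
    rwa [hS0, hS0] at this
  refine ⟨fun x => (LinearEquiv.ofInjectiveEndo (L x) (hL x)).toContinuousLinearEquiv,
    fun v => (hS v).congr fun x hx => ?_, fun v => ?_⟩
  · change S v (max x 0) = S v x
    rw [max_eq_left hx]
  · change S v (max 0 0) = v
    rw [max_self, hS0]

end Systems

/-! ### Limits of subspaces -/

section Limits

variable {E : Type*} [NormedAddCommGroup E] [InnerProductSpace ℂ E] [FiniteDimensional ℂ E]

/-- The trace is continuous in the projection, so it carries the dimension to the limit in
`exists_tendsto_starProjection`. -/
lemma trace_starProjection (L : Submodule ℂ E) :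
    LinearMap.trace ℂ E (L.starProjection : E →ₗ[ℂ] E) = Module.finrank ℂ L := by
  refine LinearMap.IsProj.trace ⟨fun x => L.starProjection_apply_mem x, fun x hx => ?_⟩
  exact Submodule.starProjection_eq_self_iff.2 hx

/-- The Grassmannian is compact. -/
lemma exists_tendsto_starProjection {ι : Type*} (U : Ultrafilter ι) {L : ι → Submodule ℂ E} {n : ℕ}
    (hd : ∀ᶠ i in U, Module.finrank ℂ (L i) = n) :
    ∃ L' : Submodule ℂ E, Module.finrank ℂ L' = n ∧
      Tendsto (fun i => (L i).starProjection) U (𝓝 L'.starProjection) := by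
  have : CompleteSpace E := FiniteDimensional.complete ℂ E
  have : ProperSpace (E →L[ℂ] E) := FiniteDimensional.proper ℂ _
  have hmem : ∀ᶠ i in U, (L i).starProjection ∈ Metric.closedBall (0 : E →L[ℂ] E) 1 :=
    Eventually.of_forall fun i => by
      rw [mem_closedBall_zero_iff]; exact (L i).starProjection_norm_le
  obtain ⟨T, -, hT⟩ := (isCompact_closedBall (0 : E →L[ℂ] E) 1).ultrafilter_le_nhds
    (U.map fun i => (L i).starProjection) (le_principal_iff.2 hmem)
  have hT : Tendsto (fun i => (L i).starProjection) U (𝓝 T) := hT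
  -- Being idempotent and self-adjoint are closed conditions, so the limit is again an orthogonal
  -- projection.
  have hidem : IsIdempotentElem T := by
    refine tendsto_nhds_unique (hT.mul hT) (hT.congr fun i => ?_)
    exact ((L i).isIdempotentElem_starProjection).symm
  have hsa : IsSelfAdjoint T := by
    refine tendsto_nhds_unique ((continuous_star.tendsto T).comp hT) (hT.congr fun i => ?_)
    exact (isSelfAdjoint_starProjection (L i)).star_eq.symm
  have hrange := isStarProjection_iff_eq_starProjection.1 ⟨hidem, hsa⟩
  obtain ⟨L', hL', rfl⟩ := hrange
  refine ⟨L', ?_, hT⟩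
  have hc : Continuous fun T : E →L[ℂ] E => LinearMap.trace ℂ E (T : E →ₗ[ℂ] E) :=
    ((LinearMap.trace ℂ E).comp
      (ContinuousLinearMap.coeLM ℂ : (E →L[ℂ] E) →ₗ[ℂ] (E →ₗ[ℂ] E))).continuous_of_finiteDimensional
  have h1 := (hc.tendsto _).comp hT
  have h2 : Tendsto (fun i => LinearMap.trace ℂ E ((L i).starProjection : E →ₗ[ℂ] E)) U
      (𝓝 (n : ℂ)) :=
    tendsto_const_nhds.congr' (by
      filter_upwards [hd] with i hi
      rw [trace_starProjection, hi])
  have h3 := tendsto_nhds_unique h1 h2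
  rw [trace_starProjection] at h3
  exact_mod_cast h3

/-- A path of subspaces of constant dimension with closed graph is continuous. -/
lemma tendsto_starProjection {ι : Type*} {l : Filter ι} {L : ι → Submodule ℂ E}
    {L' : Submodule ℂ E} (hd : ∀ᶠ i in l, Module.finrank ℂ (L i) = Module.finrank ℂ L')
    (h : ∀ U : Ultrafilter ι, ↑U ≤ l → ∀ (x : ι → E) (w : E), (∀ i, x i ∈ L i) →
      Tendsto x U (𝓝 w) → w ∈ L') :
    Tendsto (fun i => (L i).starProjection) l (𝓝 L'.starProjection) := by
  rw [tendsto_iff_ultrafilter]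
  intro U hU
  obtain ⟨L'', hL'', hT⟩ := exists_tendsto_starProjection U (hU hd)
  -- A vector of the limit `L''` is the limit of its own projections, so the closed graph hypothesis
  -- puts it in `L'`; equal dimensions then force equality.
  have hle : L'' ≤ L' := fun w hw => by
    have h1 : Tendsto (fun i => (L i).starProjection w) U (𝓝 (L''.starProjection w)) :=
      ((ContinuousLinearMap.apply ℂ E w).continuous.tendsto _).comp hT
    rw [Submodule.starProjection_eq_self_iff.2 hw] at h1
    exact h U hU _ w (fun i => (L i).starProjection_apply_mem w) h1
  rwa [Submodule.eq_of_le_of_finrank_eq hle hL''] at hT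

end Limits

/-! ### Dichotomies -/

section Dichotomy

variable {E : Type*} [NormedAddCommGroup E] [InnerProductSpace ℂ E]
variable {A B : ℝ → E →L[ℂ] E} {M M' c x₀ : ℝ} {S : E →L[ℂ] E} {y z : ℝ → E}

/-- The Hermitian form `⟪v, S v⟫` increases strictly along the solutions beyond `x₀`. -/
structure Dichotomy (A : ℝ → E →L[ℂ] E) (S : E →L[ℂ] E) (c x₀ : ℝ) : Prop where
  symm : ∀ u v, inner ℂ u (S v) = inner ℂ (S u) v
  pos : 0 < c
  nonneg : 0 ≤ x₀
  le : ∀ x, x₀ ≤ x → ∀ v, c * ‖v‖ ^ 2 ≤ 2 * (inner ℂ (S v) (A x v)).re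

/-- Square integrability on the half-line. -/
abbrev IsL2 (y : ℝ → E) : Prop := MemLp y 2 (volume.restrict (Ioi (0 : ℝ)))

omit [InnerProductSpace ℂ E] in
lemma isL2_iff (hy : ContinuousOn y (Ici 0)) :
    IsL2 y ↔ IntegrableOn (fun x => ‖y x‖ ^ 2) (Ioi 0) :=
  memLp_two_iff_integrable_sq_norm
    ((hy.mono Ioi_subset_Ici_self).aestronglyMeasurable measurableSet_Ioi)

/-- The derivative of the form along a solution is `2 Re⟪S y, A y⟫`, which dominates `c‖y‖²`; the
inequality is its integral. -/
lemma Dichotomy.integral_le [CompleteSpace E] (hD : Dichotomy A S c x₀) (hA : BddCoef A M)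
    (hy : IsSol A y) {a b : ℝ} (ha : x₀ ≤ a) (hab : a ≤ b) :
    c * ∫ s in a..b, ‖y s‖ ^ 2 ≤ (inner ℂ (y b) (S (y b))).re - (inner ℂ (y a) (S (y a))).re := by
  have ha0 := hD.nonneg.trans ha
  obtain ⟨hi, he⟩ := hy.integral_inner hA hA hy S ha0 hab
  have hre := Complex.reCLM.intervalIntegral_comp_comm hi
  rw [he] at hre
  simp only [Complex.reCLM_apply, Complex.sub_re] at hre
  rw [← hre, ← intervalIntegral.integral_const_mul]
  have hyc := hy.cont.mono (uIcc_subset_Ici ha0 (ha0.trans hab))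
  refine intervalIntegral.integral_mono_on hab
    ((hyc.norm.pow 2).intervalIntegrable.const_mul c) ?_ fun x hx => ?_
  · exact ⟨Complex.reCLM.integrable_comp hi.1, Complex.reCLM.integrable_comp hi.2⟩
  · refine (hD.le x (ha.trans hx.1) (y x)).trans (le_of_eq ?_)
    rw [hD.symm (y x) (A x (y x)), ← inner_conj_symm (A x (y x))]
    simp only [Complex.add_re, Complex.conj_re]
    ring

/-- An upper bound on the form leaves no room for it to increase, so the integrals of `‖y‖²` over
`[a, b]` stay bounded as `b → ∞`. -/
lemma IsL2.setIntegral_le [CompleteSpace E] (hD : Dichotomy A S c x₀) (hA : BddCoef A M)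
    (hy : IsSol A y) {C a : ℝ} (ha : x₀ ≤ a)
    (h : ∀ᶠ b in atTop, (inner ℂ (y b) (S (y b))).re ≤ C) :
    IntegrableOn (fun x => ‖y x‖ ^ 2) (Ioi a) ∧
      c * ∫ s in Ioi a, ‖y s‖ ^ 2 ≤ C - (inner ℂ (y a) (S (y a))).re := by
  have ha0 := hD.nonneg.trans ha
  have hb : ∀ᶠ b in atTop, ∫ s in a..b, ‖‖y s‖ ^ 2‖ ≤ (C - (inner ℂ (y a) (S (y a))).re) / c := by
    filter_upwards [h, eventually_ge_atTop a] with b hb hab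
    simp only [norm_pow, norm_norm]
    rw [le_div_iff₀' hD.pos]
    exact (hD.integral_le hA hy ha hab).trans (sub_le_sub_right hb _)
  have hint : IntegrableOn (fun x => ‖y x‖ ^ 2) (Ioi a) := by
    refine integrableOn_Ioi_of_intervalIntegral_norm_bounded (l := atTop) (b := id) _ a (fun b => ?_)
      tendsto_id hb
    rcases le_or_gt a b with hab | hab
    · exact (((hy.cont.mono (uIcc_subset_Ici ha0 (ha0.trans hab))).norm.pow 2).intervalIntegrable).1
    · simp [Ioc_eq_empty_of_le hab.le]
  refine ⟨hint, ?_⟩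
  have h1 := intervalIntegral_tendsto_integral_Ioi a hint tendsto_id
  rw [← le_div_iff₀' hD.pos]
  refine le_of_tendsto h1 ?_
  filter_upwards [hb] with b hb
  simpa using hb

/-- On `[x, x + 1]` the solution is at least `exp (-M) ‖y x‖`, by the backward growth estimate;
averaging over this unit interval bounds the value by the tail integral. -/
lemma IsSol.norm_sq_le (hA : BddCoef A M) (hy : IsSol A y) {x : ℝ} (hx : 0 ≤ x)
    (hi : IntegrableOn (fun x => ‖y x‖ ^ 2) (Ioi x)) :
    ‖y x‖ ^ 2 ≤ Real.exp (2 * M) * ∫ s in Ioi x, ‖y s‖ ^ 2 := by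
  have h1 : ∫ s in Ioc x (x + 1), ‖y x‖ ^ 2 ≤ ∫ s in Ioc x (x + 1),
      Real.exp (2 * M) * ‖y s‖ ^ 2 := by
    refine setIntegral_mono_on (by simp) ((hi.mono_set Ioc_subset_Ioi_self).const_mul _)
      measurableSet_Ioc fun s hs => ?_
    have h2 := hy.norm_le hA (hx.trans hs.1.le) hx
    have h3 : ‖y x‖ ≤ ‖y s‖ * Real.exp M := h2.trans (mul_le_mul_of_nonneg_left
      (Real.exp_le_exp.2 (mul_le_of_le_one_right hA.nonneg
        (by rw [abs_le]; constructor <;> linarith [hs.1, hs.2]))) (norm_nonneg _))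
    calc ‖y x‖ ^ 2 ≤ (‖y s‖ * Real.exp M) ^ 2 := by gcongr
      _ = Real.exp (2 * M) * ‖y s‖ ^ 2 := by
        rw [mul_pow, ← Real.exp_nat_mul]; push_cast; ring
  simp only [integral_const, MeasurableSet.univ, measureReal_restrict_apply, univ_inter,
    Real.volume_real_Ioc, add_sub_cancel_left, smul_eq_mul] at h1
  rw [max_eq_left zero_le_one, one_mul, integral_const_mul] at h1
  refine h1.trans (mul_le_mul_of_nonneg_left ?_ (Real.exp_pos _).le)
  exact setIntegral_mono_set hi (Eventually.of_forall fun s => by positivity)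
    Ioc_subset_Ioi_self.eventuallyLE

lemma setIntegral_Ioi_eq_sub {g : ℝ → ℝ} (hi : IntegrableOn g (Ioi 0)) {x : ℝ} (hx : 0 ≤ x) :
    ∫ s in Ioi x, g s = (∫ s in Ioi (0 : ℝ), g s) - ∫ s in (0 : ℝ)..x, g s := by
  rw [intervalIntegral.integral_of_le hx, ← Ioc_union_Ioi_eq_Ioi hx,
    setIntegral_union (Ioc_disjoint_Ioi le_rfl) measurableSet_Ioi
      (hi.mono_set Ioc_subset_Ioi_self) (hi.mono_set (Ioi_subset_Ioi hx))]
  ring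

lemma IsL2.tendsto_zero (hA : BddCoef A M) (hy : IsSol A y) (h : IsL2 y) :
    Tendsto y atTop (𝓝 0) := by
  have hi := (isL2_iff hy.cont).1 h
  have h1 := (tendsto_const_nhds (x := ∫ s in Ioi (0 : ℝ), ‖y s‖ ^ 2)).sub
    (intervalIntegral_tendsto_integral_Ioi 0 hi tendsto_id)
  rw [sub_self] at h1
  have h2 := h1.const_mul (Real.exp (2 * M))
  rw [mul_zero] at h2
  have h3 : Tendsto (fun x => ‖y x‖ ^ 2) atTop (𝓝 0) := by
    refine squeeze_zero' (Eventually.of_forall fun x => by positivity) ?_ h2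
    filter_upwards [eventually_ge_atTop 0] with x hx
    refine (hy.norm_sq_le hA hx (hi.mono_set (Ioi_subset_Ioi hx))).trans (le_of_eq ?_)
    rw [setIntegral_Ioi_eq_sub hi hx]
    rfl
  rw [tendsto_zero_iff_norm_tendsto_zero]
  have := h3.sqrt
  simpa using this

/-- A square integrable solution tends to zero, and so does the form; every positive `C` is
eventually an upper bound in `IsL2.setIntegral_le`. -/
lemma IsL2.form_le [CompleteSpace E] (hD : Dichotomy A S c x₀) (hA : BddCoef A M)
    (hy : IsSol A y) (h : IsL2 y) {a : ℝ} (ha : x₀ ≤ a) :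
    c * ∫ s in Ioi a, ‖y s‖ ^ 2 ≤ -(inner ℂ (y a) (S (y a))).re := by
  have h0 := h.tendsto_zero hA hy
  have h1 : Tendsto (fun x => (inner ℂ (y x) (S (y x))).re) atTop (𝓝 0) := by
    have : Continuous fun v : E => (inner ℂ v (S v)).re := by fun_prop
    have h2 := (this.tendsto 0).comp h0
    rwa [map_zero, inner_zero_left, Complex.zero_re] at h2
  refine le_of_forall_pos_le_add fun ε hε => ?_
  have := (IsL2.setIntegral_le hD hA hy ha
    ((h1.eventually (gt_mem_nhds hε)).mono fun b hb => hb.le)).2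
  linarith

lemma Dichotomy.form_mono [CompleteSpace E] (hD : Dichotomy A S c x₀) (hA : BddCoef A M)
    (hy : IsSol A y) {a b : ℝ} (ha : x₀ ≤ a) (hab : a ≤ b) :
    (inner ℂ (y a) (S (y a))).re ≤ (inner ℂ (y b) (S (y b))).re := by
  have := hD.integral_le hA hy ha hab
  have h2 : 0 ≤ c * ∫ s in a..b, ‖y s‖ ^ 2 :=
    mul_nonneg hD.pos.le (intervalIntegral.integral_nonneg hab fun s _ => by positivity)
  linarith

/-- Converse of `IsL2.form_nonpos`. The two replace square integrability by pointwise inequalities,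
which survive limits of solutions. -/
lemma isL2_of_form_nonpos [CompleteSpace E] (hD : Dichotomy A S c x₀) (hA : BddCoef A M)
    (hy : IsSol A y) (h : ∀ x, x₀ ≤ x → (inner ℂ (y x) (S (y x))).re ≤ 0) : IsL2 y := by
  rw [isL2_iff hy.cont]
  have h1 := (IsL2.setIntegral_le hD hA hy le_rfl
    ((eventually_ge_atTop x₀).mono fun b hb => h b hb)).1
  rw [← Ioc_union_Ioi_eq_Ioi hD.nonneg]
  refine IntegrableOn.union ?_ h1
  exact (((hy.cont.mono (uIcc_subset_Ici le_rfl hD.nonneg)).norm.pow 2).intervalIntegrable).1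

lemma IsL2.form_nonpos [CompleteSpace E] (hD : Dichotomy A S c x₀) (hA : BddCoef A M)
    (hy : IsSol A y) (h : IsL2 y) {a : ℝ} (ha : x₀ ≤ a) : (inner ℂ (y a) (S (y a))).re ≤ 0 := by
  have := h.form_le hD hA hy ha
  have h2 : 0 ≤ c * ∫ s in Ioi a, ‖y s‖ ^ 2 :=
    mul_nonneg hD.pos.le (setIntegral_nonneg measurableSet_Ioi fun s _ => by positivity)
  linarith

lemma IsL2.form_neg [CompleteSpace E] (hD : Dichotomy A S c x₀) (hA : BddCoef A M)
    (hy : IsSol A y) (h : IsL2 y) {a : ℝ} (ha : x₀ ≤ a) (hne : y a ≠ 0) :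
    (inner ℂ (y a) (S (y a))).re < 0 := by
  have h1 := h.form_le hD hA hy ha
  have ha0 := hD.nonneg.trans ha
  have h2 := hy.norm_sq_le hA ha0 (((isL2_iff hy.cont).1 h).mono_set (Ioi_subset_Ioi ha0))
  have h3 : 0 < ∫ s in Ioi a, ‖y s‖ ^ 2 := by
    by_contra hcon
    have : 0 < ‖y a‖ ^ 2 := by positivity
    nlinarith [Real.exp_pos (2 * M)]
  nlinarith [mul_pos hD.pos h3]

/-- Uniform exponential decay of the square integrable solutions. -/
lemma Dichotomy.exists_decay [CompleteSpace E] (M : ℝ) (S : E →L[ℂ] E) (c x₀ : ℝ) :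
    ∃ K γ : ℝ, 0 ≤ K ∧ 0 < γ ∧ ∀ A, BddCoef A M → Dichotomy A S c x₀ → ∀ y, IsSol A y → IsL2 y →
      ∀ x, 0 ≤ x → ‖y x‖ ^ 2 ≤ K * ‖y 0‖ ^ 2 * Real.exp (-γ * x) := by
  by_cases hc : 0 < c
  swap
  · exact ⟨0, 1, le_rfl, one_pos, fun A _ hD => absurd hD.pos hc⟩
  set σ := ‖S‖ + 1 with hσ
  have hσ0 : 0 < σ := by positivity
  -- The form is at least `-σ‖y‖²`, so `IsL2.form_le` says that the tail integral `g` satisfies `c g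
  -- ≤ σ‖y‖² = -σ g'`, that is `g' ≤ -γ g`.
  set γ := c / σ with hγ
  have hγ0 : 0 < γ := by positivity
  -- The first summand serves `x ≥ x₀`, where the tail integral decays; the second serves `x ≤ x₀`,
  -- where only the growth bound is available.
  refine ⟨Real.exp (2 * M) * (σ / c) * Real.exp (2 * M * x₀) * Real.exp (γ * x₀) +
    Real.exp (2 * M * x₀) * Real.exp (γ * x₀), γ, by positivity, hγ0,
    fun A hA hD y hy h x hx => ?_⟩
  have hi := (isL2_iff hy.cont).1 h
  have hstart : ∀ x, 0 ≤ x → x ≤ x₀ → ‖y x‖ ^ 2 ≤ Real.exp (2 * M * x₀) * ‖y 0‖ ^ 2 := by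
    intro x hx hxx
    have h1 := hy.norm_le hA le_rfl hx
    rw [sub_zero, abs_of_nonneg hx] at h1
    calc ‖y x‖ ^ 2 ≤ (‖y 0‖ * Real.exp (M * x)) ^ 2 := by gcongr
      _ ≤ (‖y 0‖ * Real.exp (M * x₀)) ^ 2 := by
        have := hA.nonneg
        gcongr
      _ = _ := by rw [mul_pow, ← Real.exp_nat_mul]; push_cast; ring_nf
  rcases le_total x x₀ with hxx | hxx
  · refine (hstart x hx hxx).trans ?_
    have e1 : 1 ≤ Real.exp (γ * x₀) * Real.exp (-γ * x) := by
      rw [← Real.exp_add]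
      exact Real.one_le_exp (by nlinarith)
    have e2 : 0 ≤ Real.exp (2 * M) * (σ / c) * Real.exp (2 * M * x₀) * Real.exp (γ * x₀) *
      ‖y 0‖ ^ 2 * Real.exp (-γ * x) := by positivity
    have e3 : 0 ≤ Real.exp (2 * M * x₀) * ‖y 0‖ ^ 2 := by positivity
    nlinarith [mul_le_mul_of_nonneg_left e1 e3]
  · set I := ∫ s in Ioi (0 : ℝ), ‖y s‖ ^ 2
    have hyc : Continuous fun s => ‖y (max s 0)‖ ^ 2 := hy.continuous_max.norm.pow 2
    have hg : ∀ x, 0 ≤ x → ∫ s in Ioi x, ‖y s‖ ^ 2 = I - ∫ s in (0 : ℝ)..x, ‖y (max s 0)‖ ^ 2 := by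
      intro x hx
      rw [setIntegral_Ioi_eq_sub hi hx]
      congr 1
      refine intervalIntegral.integral_congr fun s hs => ?_
      rw [uIcc_of_le hx] at hs
      simp only [max_eq_left hs.1]
    have hd : ∀ x, HasDerivAt (fun x => Real.exp (γ * x) * (I - ∫ s in (0 : ℝ)..x, ‖y (max s 0)‖ ^ 2))
        (Real.exp (γ * x) * (γ * (I - ∫ s in (0 : ℝ)..x, ‖y (max s 0)‖ ^ 2) -
          ‖y (max x 0)‖ ^ 2)) x := by
      intro x
      have h1 := (intervalIntegral.integral_hasDerivAt_right (hyc.intervalIntegrable 0 x)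
        (hyc.stronglyMeasurableAtFilter _ _) hyc.continuousAt).const_sub I
      have h2 : HasDerivAt (fun x => Real.exp (γ * x)) (Real.exp (γ * x) * γ) x := by
        have := ((hasDerivAt_id x).const_mul γ).exp
        simpa using this
      refine (h2.mul h1).congr_deriv ?_
      ring
    have hanti : AntitoneOn
        (fun x => Real.exp (γ * x) * (I - ∫ s in (0 : ℝ)..x, ‖y (max s 0)‖ ^ 2)) (Ici x₀) := by
      refine antitoneOn_of_deriv_nonpos (convex_Ici _)
        (fun x _ => (hd x).continuousAt.continuousWithinAt)
        (fun x _ => (hd x).differentiableAt.differentiableWithinAt) fun x hx => ?_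
      rw [interior_Ici] at hx
      have hx' : x₀ ≤ x := le_of_lt hx
      have hx0 := hD.nonneg.trans hx'
      rw [(hd x).deriv, ← hg x hx0, max_eq_left hx0]
      refine mul_nonpos_of_nonneg_of_nonpos (Real.exp_pos _).le ?_
      have h1 := h.form_le hD hA hy hx'
      have h2 : -(inner ℂ (y x) (S (y x))).re ≤ σ * ‖y x‖ ^ 2 := by
        refine (neg_le_abs _).trans ((Complex.abs_re_le_norm _).trans
          ((norm_inner_le_norm _ _).trans ?_))
        have := S.le_opNorm (y x)
        have h0 := norm_nonneg (y x)
        nlinarith [mul_le_mul_of_nonneg_left this h0]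
      rw [sub_nonpos, hγ, div_mul_eq_mul_div, div_le_iff₀' hσ0]
      exact h1.trans h2
    have h1 := hanti self_mem_Ici hxx hxx
    simp only at h1
    rw [← hg x hx, ← hg x₀ hD.nonneg] at h1
    have h2 := hy.norm_sq_le hA hx (hi.mono_set (Ioi_subset_Ioi hx))
    have h3 : ∫ s in Ioi x₀, ‖y s‖ ^ 2 ≤ (σ / c) * ‖y x₀‖ ^ 2 := by
      have h4 := h.form_le hD hA hy le_rfl
      have h2 : -(inner ℂ (y x₀) (S (y x₀))).re ≤ σ * ‖y x₀‖ ^ 2 := by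
        refine (neg_le_abs _).trans ((Complex.abs_re_le_norm _).trans
          ((norm_inner_le_norm _ _).trans ?_))
        have := S.le_opNorm (y x₀)
        have h0 := norm_nonneg (y x₀)
        nlinarith [mul_le_mul_of_nonneg_left this h0]
      rw [div_mul_eq_mul_div, le_div_iff₀' hc]
      exact h4.trans h2
    have h5 := hstart x₀ hD.nonneg le_rfl
    have h6 : ∫ s in Ioi x, ‖y s‖ ^ 2 ≤ Real.exp (-γ * x) *
        (Real.exp (γ * x₀) * ((σ / c) * (Real.exp (2 * M * x₀) * ‖y 0‖ ^ 2))) := by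
      have : ∫ s in Ioi x, ‖y s‖ ^ 2 =
          Real.exp (-γ * x) * (Real.exp (γ * x) * ∫ s in Ioi x, ‖y s‖ ^ 2) := by
        rw [← mul_assoc, ← Real.exp_add]; simp
      rw [this]
      refine mul_le_mul_of_nonneg_left (h1.trans ?_) (Real.exp_pos _).le
      refine mul_le_mul_of_nonneg_left (h3.trans ?_) (Real.exp_pos _).le
      exact mul_le_mul_of_nonneg_left h5 (by positivity)
    calc ‖y x‖ ^ 2 ≤ _ := h2
      _ ≤ Real.exp (2 * M) * (Real.exp (-γ * x) *
        (Real.exp (γ * x₀) * ((σ / c) * (Real.exp (2 * M * x₀) * ‖y 0‖ ^ 2)))) := by gcongr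
      _ ≤ _ := by
        have : 0 ≤ Real.exp (2 * M * x₀) * Real.exp (γ * x₀) * ‖y 0‖ ^ 2 * Real.exp (-γ * x) := by
          positivity
        nlinarith

end Dichotomy

/-! ### The space of initial values of square integrable solutions -/

section Dichotomy

variable {E : Type*} [NormedAddCommGroup E] [InnerProductSpace ℂ E]
variable {A B : ℝ → E →L[ℂ] E} {M M' c x₀ : ℝ} {S : E →L[ℂ] E} {y z : ℝ → E}

/-- The initial values of the square integrable solutions. -/
noncomputable def stableSpace (A : ℝ → E →L[ℂ] E) : Submodule ℂ E :=
  Submodule.span ℂ {v | ∃ y, IsSol A y ∧ IsL2 y ∧ y 0 = v}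

lemma mem_stableSpace (hA : BddCoef A M) {v : E} :
    v ∈ stableSpace A ↔ ∃ y, IsSol A y ∧ IsL2 y ∧ y 0 = v := by
  refine ⟨fun h => ?_, fun h => Submodule.subset_span h⟩
  induction h using Submodule.span_induction with
  | mem v hv => exact hv
  | zero => exact ⟨0, IsSol.zero, MemLp.zero, rfl⟩
  | add v w _ _ hv hw =>
    obtain ⟨y, hy, hy2, rfl⟩ := hv
    obtain ⟨z, hz, hz2, rfl⟩ := hw
    exact ⟨y + z, hy.add hA hz, hy2.add hz2, rfl⟩
  | smul a v _ hv =>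
    obtain ⟨y, hy, hy2, rfl⟩ := hv
    exact ⟨a • y, hy.smul a, hy2.const_smul a, rfl⟩

lemma Dichotomy.shift (hD : Dichotomy A S c x₀) {x : ℝ} (hx : 0 ≤ x) :
    Dichotomy (fun s => A (x + s)) S c x₀ :=
  ⟨hD.symm, hD.pos, hD.nonneg, fun s hs v => hD.le (x + s) (by linarith) v⟩

lemma isL2_shift_iff (hy : ContinuousOn y (Ici 0)) {x : ℝ} (hx : 0 ≤ x) :
    IsL2 (fun s => y (x + s)) ↔ IsL2 y := by
  have hc : ContinuousOn (fun s => y (x + s)) (Ici 0) :=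
    hy.comp (by fun_prop) fun s hs => add_nonneg hx hs
  rw [isL2_iff hy, isL2_iff hc]
  have h1 : IntegrableOn (fun s => ‖y (x + s)‖ ^ 2) (Ioi 0) ↔
      IntegrableOn (fun s => ‖y s‖ ^ 2) (Ioi x) := by
    have := (measurePreserving_add_left volume x).integrableOn_comp_preimage
      (measurableEmbedding_addLeft x) (f := fun s => ‖y s‖ ^ 2) (s := Ioi x)
    simpa [Function.comp_def] using this
  rw [h1]
  refine ⟨fun h => ?_, fun h => h.mono_set (Ioi_subset_Ioi hx)⟩
  rw [← Ioc_union_Ioi_eq_Ioi hx]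
  refine IntegrableOn.union ?_ h
  exact (((hy.mono (uIcc_subset_Ici le_rfl hx)).norm.pow 2).intervalIntegrable).1

variable [FiniteDimensional ℂ E]

lemma exists_isSol_at (hA : BddCoef A M) (x : ℝ) (v : E) :
    ∃ y, IsSol A y ∧ y x = v := by
  obtain ⟨Φ, hΦ, -⟩ := exists_flow hA
  exact ⟨_, hΦ ((Φ x).symm v), by simp⟩

lemma mem_stableSpace_shift (hA : BddCoef A M) {x : ℝ} (hx : 0 ≤ x) {v : E} :
    v ∈ stableSpace (fun s => A (x + s)) ↔ ∃ y, IsSol A y ∧ IsL2 y ∧ y x = v := by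
  rw [mem_stableSpace (hA.shift x)]
  constructor
  · rintro ⟨z, hz, hz2, rfl⟩
    obtain ⟨y, hy, hyx⟩ := exists_isSol_at hA _ (z 0)
    refine ⟨y, hy, ?_, hyx⟩
    rw [← isL2_shift_iff hy.cont hx]
    refine (memLp_congr_ae ?_).1 hz2
    filter_upwards [ae_restrict_mem measurableSet_Ioi] with s hs
    exact hz.eq_of_eq (hA.shift x) (hy.shift hA hx) le_rfl (le_of_lt hs) (by simp [hyx])
  · rintro ⟨y, hy, hy2, rfl⟩
    exact ⟨_, hy.shift hA hx, (isL2_shift_iff hy.cont hx).2 hy2, by simp⟩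

/-- The dimension of the space of square integrable solutions is the index of the form. -/
lemma finrank_stableSpace (hA : BddCoef A M) (hD : Dichotomy A S c x₀) {Nm Np : Submodule ℂ E}
    (hm : ∀ v ∈ Nm, (inner ℂ v (S v)).re ≤ 0) (hp : ∀ v ∈ Np, 0 ≤ (inner ℂ v (S v)).re)
    (hdim : Module.finrank ℂ Nm + Module.finrank ℂ Np = Module.finrank ℂ E) :
    Module.finrank ℂ (stableSpace A) = Module.finrank ℂ Nm := by
  have : CompleteSpace E := FiniteDimensional.complete ℂ E
  obtain ⟨Φ, hΦ, hΦ0⟩ := exists_flow hA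
  refine le_antisymm ?_ ?_
  -- Upper bound: at `x₀` the form is strictly negative on nonzero values of square integrable
  -- solutions and nonnegative on `Np`, so the two spaces are disjoint.
  · have hdisj : Disjoint ((stableSpace A).map (Φ x₀).toLinearEquiv.toLinearMap) Np := by
      rw [Submodule.disjoint_def]
      rintro _ ⟨v, hv, rfl⟩ hN
      obtain ⟨y, hy, hy2, rfl⟩ := (mem_stableSpace hA).1 hv
      by_contra hne
      have e : Φ x₀ (y 0) = y x₀ :=
        (hΦ (y 0)).eq_of_eq hA hy le_rfl hD.nonneg (hΦ0 _)
      have h1 := hp _ hN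
      have h2 : (inner ℂ (y x₀) (S (y x₀))).re < 0 :=
        hy2.form_neg hD hA hy le_rfl (e ▸ hne)
      rw [← e] at h2
      exact absurd h1 (not_le.2 h2)
    have h1 := Submodule.finrank_add_finrank_le_of_disjoint hdisj
    rw [LinearEquiv.finrank_map_eq] at h1
    omega
  -- Lower bound: `Nm` is imposed at time `R` and transported back to time `0`. By monotonicity
  -- these solutions have nonpositive form on all of `[x₀, R]`, and this persists for the limit
  -- space as `R → ∞` along an ultrafilter.
  · set U := Ultrafilter.of (atTop : Filter ℝ)
    have hU : (U : Filter ℝ) ≤ atTop := Ultrafilter.of_le _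
    obtain ⟨L', hL', hT⟩ := exists_tendsto_starProjection U
      (L := fun R => Nm.map (Φ R).symm.toLinearEquiv.toLinearMap) (n := Module.finrank ℂ Nm)
      (Eventually.of_forall fun R => LinearEquiv.finrank_map_eq _ _)
    rw [← hL']
    refine Submodule.finrank_mono fun w hw => ?_
    have h1 : Tendsto (fun R => (Nm.map (Φ R).symm.toLinearEquiv.toLinearMap).starProjection w) U
        (𝓝 w) := by
      have := ((ContinuousLinearMap.apply ℂ E w).continuous.tendsto _).comp hT
      simp only [ContinuousLinearMap.apply_apply] at this
      rwa [Submodule.starProjection_eq_self_iff.2 hw] at this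
    have hy := hΦ w
    refine (mem_stableSpace hA).2 ⟨_, hy, isL2_of_form_nonpos hD hA hy fun x hx => ?_, hΦ0 w⟩
    have hc : Continuous fun v : E => (inner ℂ (Φ x v) (S (Φ x v))).re := by fun_prop
    refine le_of_tendsto ((hc.tendsto w).comp h1) (hU ?_)
    filter_upwards [eventually_ge_atTop x] with R hR
    set v := (Nm.map (Φ R).symm.toLinearEquiv.toLinearMap).starProjection w
    have hv : v ∈ Nm.map (Φ R).symm.toLinearEquiv.toLinearMap := Submodule.starProjection_apply_mem _ _
    obtain ⟨u, hu, huv⟩ := hv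
    have e : Φ R v = u := by rw [← huv]; simp
    refine (hD.form_mono hA (hΦ v) hx hR).trans ?_
    simp only [e]
    exact hm u hu

/-- Locally uniform convergence of coefficients. -/
def CoefTendsto {ι : Type*} (A' : ι → ℝ → E →L[ℂ] E) (l : Filter ι) (A : ℝ → E →L[ℂ] E) : Prop :=
  ∀ X δ : ℝ, 0 < δ → ∀ᶠ i in l, ∀ s ∈ Icc 0 X, ‖A' i s - A s‖ ≤ δ

variable {ι : Type*} {l : Filter ι} {A' : ι → ℝ → E →L[ℂ] E} {y' : ι → ℝ → E}

omit [FiniteDimensional ℂ E] in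
lemma CoefTendsto.tendsto_sol (h : CoefTendsto A' l A) (hA' : ∀ᶠ i in l, BddCoef (A' i) M)
    (hA : BddCoef A M) (hy' : ∀ᶠ i in l, IsSol (A' i) (y' i)) (hy : IsSol A y)
    (h0 : Tendsto (fun i => y' i 0) l (𝓝 (y 0))) {X : ℝ} (hX : 0 ≤ X) :
    Tendsto (fun i => y' i X) l (𝓝 (y X)) := by
  rw [tendsto_iff_norm_sub_tendsto_zero] at h0 ⊢
  set I := ∫ s in (0 : ℝ)..X, ‖y s‖
  have hI : 0 ≤ I := intervalIntegral.integral_nonneg hX fun s _ => norm_nonneg _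
  have key : ∀ δ > 0, ∀ᶠ i in l, ‖y' i X - y X‖ ≤ (δ + δ * I) * Real.exp (M * X) := by
    intro δ hδ
    filter_upwards [h X δ hδ, hA', hy', h0.eventually (gt_mem_nhds hδ)] with i h1 h2 h3 h4
    refine (h3.norm_sub_le h2 hA hy hX h1).trans ?_
    gcongr
  rw [Metric.tendsto_nhds]
  intro ε hε
  have hK : 0 < (1 + I) * Real.exp (M * X) := by positivity
  filter_upwards [key (ε / 2 / ((1 + I) * Real.exp (M * X))) (by positivity)] with i hi
  rw [dist_zero_right, norm_norm]
  refine hi.trans_lt ?_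
  have : (ε / 2 / ((1 + I) * Real.exp (M * X)) + ε / 2 / ((1 + I) * Real.exp (M * X)) * I) *
    Real.exp (M * X) = ε / 2 := by field_simp
  rw [this]
  linarith

/-- Closed graph property. Solutions converge pointwise, so nonpositivity of the form passes to the
limit; the constants `c`, `x₀` and `M` must therefore be common to the whole family. -/
lemma CoefTendsto.mem_stableSpace [l.NeBot] (h : CoefTendsto A' l A)
    (hA' : ∀ᶠ i in l, BddCoef (A' i) M) (hD' : ∀ᶠ i in l, Dichotomy (A' i) S c x₀)
    (hA : BddCoef A M) (hD : Dichotomy A S c x₀)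
    {v : ι → E} {w : E} (hv : ∀ᶠ i in l, v i ∈ stableSpace (A' i)) (hvw : Tendsto v l (𝓝 w)) :
    w ∈ stableSpace A := by
  have : CompleteSpace E := FiniteDimensional.complete ℂ E
  obtain ⟨y, hy, rfl⟩ := exists_isSol hA w
  have hex : ∀ i, ∃ z : ℝ → E, (BddCoef (A' i) M ∧ v i ∈ stableSpace (A' i)) →
      IsSol (A' i) z ∧ IsL2 z ∧ z 0 = v i := by
    intro i
    by_cases hi : BddCoef (A' i) M ∧ v i ∈ stableSpace (A' i)
    · obtain ⟨z, hz⟩ := (SturmLiouville.mem_stableSpace hi.1).1 hi.2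
      exact ⟨z, fun _ => hz⟩
    · exact ⟨0, fun hi' => absurd hi' hi⟩
  choose y' hy' using hex
  have hev : ∀ᶠ i in l, IsSol (A' i) (y' i) ∧ IsL2 (y' i) ∧ y' i 0 = v i := by
    filter_upwards [hA', hv] with i h1 h2 using hy' i ⟨h1, h2⟩
  have h0 : Tendsto (fun i => y' i 0) l (𝓝 (y 0)) :=
    hvw.congr' (by filter_upwards [hev] with i hi using hi.2.2.symm)
  refine (SturmLiouville.mem_stableSpace hA).2 ⟨y, hy, isL2_of_form_nonpos hD hA hy fun x hx => ?_, rfl⟩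
  have hlim := h.tendsto_sol hA' hA (hev.mono fun i hi => hi.1) hy h0 (hD.nonneg.trans hx)
  have hc : Continuous fun v : E => (inner ℂ v (S v)).re := by fun_prop
  refine le_of_tendsto ((hc.tendsto _).comp hlim) ?_
  filter_upwards [hev, hA', hD'] with i h1 h2 h3
  exact h1.2.1.form_nonpos h3 h2 h1.1 hx

end Dichotomy

/-! ### Diagonalization of unitary matrices -/

section Unitary

open Polynomial Unitary

variable {n : ℕ} {W : Matrix (Fin n) (Fin n) ℂ}

lemma isStarNormal_of_unitary (hW : W ∈ Matrix.unitaryGroup (Fin n) ℂ) : IsStarNormal W :=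
  ⟨by rw [Commute, SemiconjBy, (Unitary.mem_iff.1 hW).1, (Unitary.mem_iff.1 hW).2]⟩

lemma spectrum_finite (W : Matrix (Fin n) (Fin n) ℂ) : (spectrum ℂ W).Finite := by
  rw [← Matrix.spectrum_toLin']
  exact Module.End.finite_spectrum _

lemma norm_eq_one_of_mem_spectrum (hW : W ∈ Matrix.unitaryGroup (Fin n) ℂ) {z : ℂ}
    (hz : z ∈ spectrum ℂ W) : ‖z‖ = 1 := by
  have := spectrum.subset_circle_of_unitary (𝕜 := ℂ) hW hz
  simpa using this

/-- The spectrum is finite, so Lagrange interpolation turns any function of `W` into a polynomial in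
`W`. -/
lemma cfc_eq_aeval (hW : W ∈ Matrix.unitaryGroup (Fin n) ℂ) (f : ℂ → ℂ) :
    ∃ p : ℂ[X], (∀ z ∈ spectrum ℂ W, p.eval z = f z) ∧ cfc f W = aeval W p := by
  have := isStarNormal_of_unitary hW
  have hfin := spectrum_finite W
  refine ⟨Lagrange.interpolate hfin.toFinset id f, fun z hz => ?_, ?_⟩
  · exact Lagrange.eval_interpolate_at_node (v := id) f (injOn_id _) (hfin.mem_toFinset.2 hz)
  · rw [← cfc_polynomial _ W]
    refine cfc_congr fun z hz => ?_
    exact (Lagrange.eval_interpolate_at_node (v := id) f (injOn_id _) (hfin.mem_toFinset.2 hz)).symm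

lemma aeval_conj_diagonal (U : Matrix.unitaryGroup (Fin n) ℂ) (d : Fin n → ℂ) (p : ℂ[X]) :
    aeval (U.1 * Matrix.diagonal d * star U.1) p =
      U.1 * Matrix.diagonal (fun i => p.eval (d i)) * star U.1 := by
  have hU : U.1 * star U.1 = 1 := (Unitary.mem_iff.1 U.2).2
  have hU' : star U.1 * U.1 = 1 := (Unitary.mem_iff.1 U.2).1
  induction p using Polynomial.induction_on with
  | C r =>
    simp only [aeval_C, eval_C]
    rw [show Matrix.diagonal (fun _ : Fin n => r) = algebraMap ℂ (Matrix (Fin n) (Fin n) ℂ) r from rfl,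
      ← Algebra.commutes, mul_assoc, hU, mul_one]
  | add p q hp hq =>
    rw [map_add, hp, hq]
    simp only [eval_add]
    rw [← Matrix.diagonal_add, mul_add, add_mul]
  | monomial k r h =>
    have e : Matrix.diagonal (fun i => (C r * X ^ (k + 1)).eval (d i)) =
        Matrix.diagonal (fun i => (C r * X ^ k).eval (d i)) * Matrix.diagonal d := by
      rw [Matrix.diagonal_mul_diagonal]
      congr 1; ext i; simp [pow_succ, mul_assoc]
    rw [e, pow_succ, ← mul_assoc, map_mul, h, aeval_X]
    calc _ = U.1 * Matrix.diagonal (fun i => eval (d i) (C r * X ^ k)) * (star U.1 * U.1) *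
          Matrix.diagonal d * star U.1 := by simp only [mul_assoc]
      _ = _ := by rw [hU']; simp only [mul_assoc, one_mul]

/-- The argument is injective on the unit circle, so `W` is a polynomial in the Hermitian matrix
`arg W`, and the spectral theorem for the latter diagonalizes both. -/
lemma exists_diagonalization (hW : W ∈ Matrix.unitaryGroup (Fin n) ℂ) :
    ∃ (U : Matrix.unitaryGroup (Fin n) ℂ) (d : Fin n → ℂ),
      W = U.1 * Matrix.diagonal d * star U.1 := by
  have := isStarNormal_of_unitary hW
  have hfin := spectrum_finite W
  let f : ℂ → ℂ := fun z => (Complex.arg z : ℂ)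
  have hf : ContinuousOn f (spectrum ℂ W) := hfin.continuousOn _
  have hH : (cfc f W).IsHermitian := by
    change star (cfc f W) = cfc f W
    rw [← cfc_star]
    refine cfc_congr fun z _ => Complex.conj_ofReal _
  have hinj : InjOn f (hfin.toFinset : Set ℂ) := by
    intro z hz w hw h
    rw [Finset.mem_coe, hfin.mem_toFinset] at hz hw
    refine Complex.ext_norm_arg ?_ (Complex.ofReal_injective h)
    rw [norm_eq_one_of_mem_spectrum hW hz, norm_eq_one_of_mem_spectrum hW hw]
  have e : W = aeval (cfc f W) (Lagrange.interpolate hfin.toFinset f id) := by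
    rw [← cfc_map_polynomial _ f W this hf]
    conv_lhs => rw [← cfc_id ℂ W]
    refine cfc_congr fun z hz => ?_
    exact (Lagrange.eval_interpolate_at_node (v := f) id hinj (hfin.mem_toFinset.2 hz)).symm
  have hs := hH.spectral_theorem
  rw [conjStarAlgAut_apply] at hs
  rw [hs, aeval_conj_diagonal] at e
  exact ⟨_, _, e⟩

variable {U : Matrix.unitaryGroup (Fin n) ℂ} {d : Fin n → ℂ}

lemma charpoly_conj_diagonal (h : W = U.1 * Matrix.diagonal d * star U.1) :
    W.charpoly = ∏ i, (X - C (d i)) := by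
  rw [h, Matrix.charpoly_mul_comm, ← mul_assoc, (Unitary.mem_iff.1 U.2).1, one_mul,
    Matrix.charpoly_diagonal]

lemma roots_conj_diagonal (h : W = U.1 * Matrix.diagonal d * star U.1) :
    W.charpoly.roots = Finset.univ.val.map d := by
  rw [charpoly_conj_diagonal h, Polynomial.roots_prod]
  · simp
  · simp [Finset.prod_ne_zero_iff, Polynomial.X_sub_C_ne_zero]

lemma finrank_eigenspace_conj_diagonal (h : W = U.1 * Matrix.diagonal d * star U.1) (c : ℂ) :
    Module.finrank ℂ (Module.End.eigenspace (Matrix.toLin' W) c) =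
      (Finset.univ.filter fun i => d i = c).card := by
  classical
  have hU : IsUnit U.1.det := by
    rw [← Matrix.isUnit_iff_isUnit_det]
    exact IsUnit.of_mul_eq_one _ (Unitary.mem_iff.1 U.2).2
  have hU' : IsUnit (star U.1).det := by
    rw [← Matrix.isUnit_iff_isUnit_det]
    exact IsUnit.of_mul_eq_one _ (Unitary.mem_iff.1 U.2).1
  have e : W - c • (1 : Matrix (Fin n) (Fin n) ℂ) =
      U.1 * Matrix.diagonal (fun i => d i - c) * star U.1 := by
    rw [← Matrix.diagonal_sub, mul_sub, sub_mul, ← h,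
      show Matrix.diagonal (fun _ : Fin n => c) = c • (1 : Matrix (Fin n) (Fin n) ℂ) by
        rw [Matrix.smul_one_eq_diagonal], Matrix.mul_smul, Matrix.smul_mul, mul_one,
      (Unitary.mem_iff.1 U.2).2]
  have hr : (W - c • (1 : Matrix (Fin n) (Fin n) ℂ)).rank =
      (Finset.univ.filter fun i => ¬ d i = c).card := by
    rw [e, Matrix.rank_mul_eq_left_of_isUnit_det _ _ hU', Matrix.rank_mul_eq_right_of_isUnit_det _ _ hU,
      Matrix.rank_diagonal, Fintype.card_subtype]
    simp only [ne_eq, sub_eq_zero]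
  have hk : Module.End.eigenspace (Matrix.toLin' W) c =
      LinearMap.ker (Matrix.toLin' (W - c • (1 : Matrix (Fin n) (Fin n) ℂ))) := by
    rw [Module.End.eigenspace_def, map_sub, map_smul, Matrix.toLin'_one]
    rfl
  have h1 := (Matrix.toLin' (W - c • (1 : Matrix (Fin n) (Fin n) ℂ))).finrank_range_add_finrank_ker
  rw [← hk, Matrix.toLin'_apply', show Module.finrank ℂ (LinearMap.range (Matrix.mulVecLin (W - c • (1 : Matrix (Fin n) (Fin n) ℂ)))) = _ from hr, Module.finrank_fin_fun] at h1
  have h2 := Finset.card_filter_add_card_filter_not (s := (Finset.univ : Finset (Fin n))) (fun i => d i = c)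
  rw [Finset.card_univ, Fintype.card_fin] at h2
  omega

lemma mem_spectrum_iff_exists (h : W = U.1 * Matrix.diagonal d * star U.1) (c : ℂ) :
    c ∈ spectrum ℂ W ↔ ∃ i, d i = c := by
  rw [← Matrix.spectrum_toLin', ← Module.End.hasEigenvalue_iff_mem_spectrum, Module.End.hasEigenvalue_iff,
    ne_eq, ← Submodule.finrank_eq_zero, finrank_eigenspace_conj_diagonal h, Finset.card_eq_zero,
    Finset.filter_eq_empty_iff]
  simp

lemma hasEigenvalue_iff_mem_spectrum (W : Matrix (Fin n) (Fin n) ℂ) (c : ℂ) :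
    Module.End.HasEigenvalue (Matrix.toLin' W) c ↔ c ∈ spectrum ℂ W := by
  rw [← Matrix.spectrum_toLin', Module.End.hasEigenvalue_iff_mem_spectrum]

lemma trace_cfc (hW : W ∈ Matrix.unitaryGroup (Fin n) ℂ)
    (h : W = U.1 * Matrix.diagonal d * star U.1) (f : ℂ → ℂ) :
    (cfc f W).trace = ∑ i, f (d i) := by
  obtain ⟨p, hp, he⟩ := cfc_eq_aeval hW f
  rw [he]
  conv_lhs => rw [h]
  rw [aeval_conj_diagonal, Matrix.trace_mul_comm, ← mul_assoc, (Unitary.mem_iff.1 U.2).1, one_mul,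
    Matrix.trace_diagonal]
  exact Finset.sum_congr rfl fun i _ => hp _ ((mem_spectrum_iff_exists h _).2 ⟨i, rfl⟩)

lemma det_conj_diagonal (h : W = U.1 * Matrix.diagonal d * star U.1) : W.det = ∏ i, d i := by
  rw [h, Matrix.det_mul_comm, ← mul_assoc, (Unitary.mem_iff.1 U.2).1, one_mul, Matrix.det_diagonal]

end Unitary

/-! ### Angles on the unit circle -/

section Angles

open Real

/-- The angle in `[0, 2π)` of a point of the unit circle, counterclockwise from `-1`. -/
noncomputable def angle (z : ℂ) : ℝ := π - Complex.arg (starRingEnd ℂ z)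

lemma angle_nonneg (z : ℂ) : 0 ≤ angle z := sub_nonneg.2 (Complex.arg_le_pi _)

lemma angle_lt (z : ℂ) : angle z < 2 * π := by
  have := Complex.neg_pi_lt_arg (starRingEnd ℂ z)
  unfold angle; linarith

lemma arcPoint_add_two_pi (θ : ℝ) : arcPoint (θ + 2 * π) = arcPoint θ := by
  unfold arcPoint
  rw [show (((π + (θ + 2 * π) : ℝ) : ℂ) * Complex.I) = ((π + θ : ℝ) : ℂ) * Complex.I +
    2 * π * Complex.I by push_cast; ring, Complex.exp_periodic]

lemma arcPoint_sub_two_pi (θ : ℝ) : arcPoint (θ - 2 * π) = arcPoint θ := by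
  rw [← arcPoint_add_two_pi, sub_add_cancel]

lemma arcPoint_zero : arcPoint 0 = -1 := by
  unfold arcPoint
  rw [add_zero, Complex.exp_pi_mul_I]

lemma norm_arcPoint (θ : ℝ) : ‖arcPoint θ‖ = 1 := Complex.norm_exp_ofReal_mul_I _

lemma continuous_arcPoint : Continuous arcPoint := by
  unfold arcPoint; fun_prop

lemma arcPoint_angle {z : ℂ} (hz : ‖z‖ = 1) : arcPoint (angle z) = z := by
  have h := Complex.norm_mul_exp_arg_mul_I (starRingEnd ℂ z)
  rw [RCLike.norm_conj, hz, Complex.ofReal_one, one_mul] at h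
  have h2 := congrArg (starRingEnd ℂ) h
  rw [Complex.conj_conj, ← Complex.exp_conj] at h2
  unfold arcPoint angle
  rw [show (((π + (π - Complex.arg (starRingEnd ℂ z)) : ℝ) : ℂ) * Complex.I) =
    starRingEnd ℂ (Complex.arg (starRingEnd ℂ z) * Complex.I) + 2 * π * Complex.I by
      simp only [map_mul, Complex.conj_ofReal, Complex.conj_I]; push_cast; ring,
    Complex.exp_periodic, h2]

lemma angle_arcPoint {θ : ℝ} (h0 : 0 ≤ θ) (h1 : θ < 2 * π) : angle (arcPoint θ) = θ := by
  have : starRingEnd ℂ (arcPoint θ) = Complex.exp (((π - θ : ℝ) : ℂ) * Complex.I) := by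
    unfold arcPoint
    rw [← Complex.exp_conj, ← Complex.exp_periodic]
    congr 1
    simp only [map_mul, Complex.conj_ofReal, Complex.conj_I]; push_cast; ring
  unfold angle
  rw [this, Complex.arg_exp_mul_I, toIocMod_eq_self _ |>.2 ⟨by linarith, by linarith⟩]
  ring

/-- A branch of the angle that is cut at `e^{i(π + ε)}`. -/
noncomputable def cutAngle (ε : ℝ) (z : ℂ) : ℝ :=
  Complex.arg (-z * starRingEnd ℂ (arcPoint ε)) + ε + 2 * π

/-- The cut branch takes values in `(π + ε, 3π + ε)`: points on the arc between `-1` and the cut are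
lifted by one full turn, and these are the points counted by `arcCount`. -/
lemma cutAngle_eq {ε : ℝ} (h0 : 0 < ε) (h1 : ε < 2 * π) {z : ℂ} (hz : ‖z‖ = 1)
    (hne : z ≠ arcPoint ε) :
    cutAngle ε z = π + angle z + if angle z < ε then 2 * π else 0 := by
  have key : ∀ θ, ε < θ → θ < ε + 2 * π → cutAngle ε (arcPoint θ) = π + θ := by
    intro θ hθ hθ'
    have : -arcPoint θ * starRingEnd ℂ (arcPoint ε) =
        Complex.exp (((θ - ε - π : ℝ) : ℂ) * Complex.I) := by
      unfold arcPoint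
      rw [← Complex.exp_conj, neg_mul, ← Complex.exp_add, ← neg_one_mul, ← Complex.exp_pi_mul_I,
        ← Complex.exp_add, ← Complex.exp_periodic (((θ - ε - π : ℝ) : ℂ) * Complex.I)]
      congr 1
      simp only [map_mul, Complex.conj_ofReal, Complex.conj_I]; push_cast; ring
    unfold cutAngle
    rw [this, Complex.arg_exp_mul_I, toIocMod_eq_self _ |>.2 ⟨by linarith, by linarith⟩]
    ring
  have ha := arcPoint_angle hz
  split_ifs with h
  · have := key (angle z + 2 * π) (by linarith [angle_nonneg z]) (by linarith)
    rw [arcPoint_add_two_pi, ha] at this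
    rw [this]; ring
  · have hlt : ε < angle z := lt_of_le_of_ne (not_lt.1 h) fun he => hne (by rw [he, ha])
    have := key (angle z) hlt (by linarith [angle_lt z])
    rw [ha] at this
    rw [this]; ring

lemma exp_cutAngle (ε : ℝ) {z : ℂ} (hz : ‖z‖ = 1) :
    Complex.exp ((cutAngle ε z : ℂ) * Complex.I) = z := by
  have hn : ‖-z * starRingEnd ℂ (arcPoint ε)‖ = 1 := by
    rw [norm_mul, norm_neg, RCLike.norm_conj, hz, norm_arcPoint, one_mul]
  have h := Complex.norm_mul_exp_arg_mul_I (-z * starRingEnd ℂ (arcPoint ε))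
  rw [hn, Complex.ofReal_one, one_mul] at h
  unfold cutAngle
  rw [show ((Complex.arg (-z * starRingEnd ℂ (arcPoint ε)) + ε + 2 * π : ℝ) : ℂ) * Complex.I =
    (Complex.arg (-z * starRingEnd ℂ (arcPoint ε)) * Complex.I + ε * Complex.I) + 2 * π * Complex.I by
      push_cast; ring, Complex.exp_periodic, Complex.exp_add, h]
  have h2 : Complex.exp (ε * Complex.I) = -arcPoint ε := by
    unfold arcPoint
    push_cast
    rw [add_mul, Complex.exp_add, Complex.exp_pi_mul_I]; ring
  have h3 : starRingEnd ℂ (arcPoint ε) * arcPoint ε = 1 := by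
    rw [mul_comm, Complex.mul_conj, Complex.normSq_eq_norm_sq, norm_arcPoint]; simp
  rw [h2, show -z * starRingEnd ℂ (arcPoint ε) * -arcPoint ε =
    z * (starRingEnd ℂ (arcPoint ε) * arcPoint ε) by ring, h3, mul_one]

lemma cut_mem_slitPlane {ε : ℝ} {z : ℂ} (hz : ‖z‖ = 1) (hne : z ≠ arcPoint ε) :
    -z * starRingEnd ℂ (arcPoint ε) ∈ Complex.slitPlane := by
  rw [Complex.mem_slitPlane_iff_arg]
  have h3 : starRingEnd ℂ (arcPoint ε) * arcPoint ε = 1 := by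
    rw [mul_comm, Complex.mul_conj, Complex.normSq_eq_norm_sq, norm_arcPoint]; simp
  have hn : ‖-z * starRingEnd ℂ (arcPoint ε)‖ = 1 := by
    rw [norm_mul, norm_neg, RCLike.norm_conj, hz, norm_arcPoint, one_mul]
  refine ⟨fun h => hne ?_, fun h => by simp [h] at hn⟩
  have h4 := Complex.norm_mul_exp_arg_mul_I (-z * starRingEnd ℂ (arcPoint ε))
  rw [hn, h, Complex.ofReal_one, one_mul, Complex.exp_pi_mul_I] at h4
  calc z = z * (starRingEnd ℂ (arcPoint ε) * arcPoint ε) := by rw [h3, mul_one]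
    _ = -(-z * starRingEnd ℂ (arcPoint ε)) * arcPoint ε := by ring
    _ = arcPoint ε := by rw [← h4]; ring

end Angles

/-! ### Spectral flow as the change of a winding number -/

section SpectralFlow

open Real

variable {n : ℕ} {W : Matrix (Fin n) (Fin n) ℂ} {U : Matrix.unitaryGroup (Fin n) ℂ} {d : Fin n → ℂ}

lemma norm_diag (hW : W ∈ Matrix.unitaryGroup (Fin n) ℂ)
    (h : W = U.1 * Matrix.diagonal d * star U.1) (i : Fin n) : ‖d i‖ = 1 :=
  norm_eq_one_of_mem_spectrum hW ((mem_spectrum_iff_exists h _).2 ⟨i, rfl⟩)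

lemma arcCount_eq (hW : W ∈ Matrix.unitaryGroup (Fin n) ℂ)
    (h : W = U.1 * Matrix.diagonal d * star U.1) {ε : ℝ} (hε : ε ≤ 2 * π) :
    arcCount W ε = (Finset.univ.filter fun i => angle (d i) < ε).card := by
  classical
  unfold arcCount
  simp only [finrank_eigenspace_conj_diagonal h]
  set T : Finset (Fin n) := Finset.univ.filter fun i => angle (d i) < ε
  have hcard : ∀ θ ∈ Ico (0 : ℝ) ε, (Finset.univ.filter fun i => d i = arcPoint θ).card =
      (T.filter fun i => angle (d i) = θ).card := by
    intro θ hθ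
    congr 1
    ext i
    simp only [Finset.mem_filter, Finset.mem_univ, true_and, T]
    constructor
    · intro hi
      rw [hi, angle_arcPoint hθ.1 (hθ.2.trans_le hε)]
      exact ⟨hθ.2, rfl⟩
    · rintro ⟨-, hi⟩
      rw [← hi, arcPoint_angle (norm_diag hW h i)]
  rw [finsum_mem_congr rfl hcard, finsum_mem_eq_sum_of_inter_support_eq (t := T.image fun i => angle (d i))]
  · exact (Finset.card_eq_sum_card_fiberwise fun i hi => by
      simpa using Finset.mem_image_of_mem (fun i => angle (d i)) hi).symm
  · ext θ
    simp only [mem_inter_iff, Function.mem_support, Finset.coe_image, Finset.card_eq_zero, ne_eq,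
      Finset.filter_eq_empty_iff, not_forall, not_not]
    constructor
    · rintro ⟨-, i, hi, rfl⟩
      exact ⟨⟨i, hi, rfl⟩, i, hi, rfl⟩
    · rintro ⟨-, i, hi, rfl⟩
      exact ⟨⟨angle_nonneg _, (Finset.mem_filter.1 hi).2⟩, i, hi, rfl⟩

/-- The winding number relative to `-1` of a unitary matrix `W` together with a logarithm `iΘ` of
its determinant. -/
noncomputable def winding (Θ : ℝ) (W : Matrix (Fin n) (Fin n) ℂ) : ℝ :=
  (Θ - (W.charpoly.roots.map fun z => π + angle z).sum) / (2 * π)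

lemma winding_eq (h : W = U.1 * Matrix.diagonal d * star U.1) (Θ : ℝ) :
    winding Θ W = (Θ - ∑ i, (π + angle (d i))) / (2 * π) := by
  unfold winding
  rw [roots_conj_diagonal h, Multiset.map_map]
  rfl

/-- The left side is continuous in `W` away from the cut and the right side is combinatorial:
replacing angles by cut angles adds `2π` for each eigenvalue on the arc. -/
lemma trace_cfc_cutAngle (hW : W ∈ Matrix.unitaryGroup (Fin n) ℂ) {ε : ℝ} (hε : ε ∈ Ioo 0 (2 * π))
    (hne : arcPoint ε ∉ spectrum ℂ W) (Θ : ℝ) :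
    (Θ - ((cfc (fun z => (cutAngle ε z : ℂ)) W).trace).re) / (2 * π) =
      winding Θ W - arcCount W ε := by
  obtain ⟨U, d, h⟩ := exists_diagonalization hW
  rw [winding_eq h, arcCount_eq hW h hε.2.le, trace_cfc hW h]
  have : ∀ i, cutAngle ε (d i) = π + angle (d i) + if angle (d i) < ε then 2 * π else 0 := fun i =>
    cutAngle_eq hε.1 hε.2 (norm_diag hW h i) fun he =>
      hne ((mem_spectrum_iff_exists h _).2 ⟨i, he⟩)
  simp only [this, Complex.re_sum, Complex.ofReal_re, Finset.sum_add_distrib]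
  rw [← Finset.sum_filter, Finset.sum_const (2 * π), nsmul_eq_mul]
  have := pi_pos
  field_simp
  ring

lemma exp_trace_cfc_cutAngle (hW : W ∈ Matrix.unitaryGroup (Fin n) ℂ) (ε : ℝ) :
    Complex.exp ((((cfc (fun z => (cutAngle ε z : ℂ)) W).trace).re : ℂ) * Complex.I) = W.det := by
  obtain ⟨U, d, h⟩ := exists_diagonalization hW
  rw [trace_cfc hW h, det_conj_diagonal h, Complex.re_sum]
  push_cast
  rw [Finset.sum_mul, Complex.exp_sum]
  refine Finset.prod_congr rfl fun i _ => ?_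
  rw [Complex.ofReal_re, exp_cutAngle ε (norm_diag hW h i)]

section Path

variable {X : Type*} [TopologicalSpace X] {Z : Set X} {V : X → Matrix (Fin n) (Fin n) ℂ} {Θ : X → ℝ}

lemma isOpen_ne_arcPoint (ε : ℝ) :
    IsOpen {W : Matrix (Fin n) (Fin n) ℂ | arcPoint ε ∉ spectrum ℂ W} := by
  have : {W : Matrix (Fin n) (Fin n) ℂ | arcPoint ε ∉ spectrum ℂ W} =
      {W | (algebraMap ℂ _ (arcPoint ε) - W).det ≠ 0} := by
    ext W
    simp only [mem_ofPred_eq, spectrum.notMem_iff, Matrix.isUnit_iff_isUnit_det, isUnit_iff_ne_zero]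
  rw [this]
  exact isOpen_ne_fun (Continuous.matrix_det (by fun_prop)) continuous_const

/-- As long as `e^{i(π + ε)}` is not an eigenvalue, the winding number changes by the change of the
number of eigenvalues on the arc from `-1` to `e^{i(π + ε)}`. -/
lemma winding_sub_arcCount_eq (hZ : IsPreconnected Z) (hV : ContinuousOn V Z)
    (hU : ∀ x ∈ Z, V x ∈ Matrix.unitaryGroup (Fin n) ℂ) (hΘ : ContinuousOn Θ Z)
    (hdet : ∀ x ∈ Z, Complex.exp (Θ x * Complex.I) = (V x).det) {ε : ℝ} (hε : ε ∈ Ioo 0 (2 * π))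
    (hne : ∀ x ∈ Z, arcPoint ε ∉ spectrum ℂ (V x)) {x y : X} (hx : x ∈ Z) (hy : y ∈ Z) :
    winding (Θ x) (V x) - arcCount (V x) ε = winding (Θ y) (V y) - arcCount (V y) ε := by
  rw [← trace_cfc_cutAngle (hU x hx) hε (hne x hx), ← trace_cfc_cutAngle (hU y hy) hε (hne y hy)]
  set g : X → ℝ := fun x =>
    (Θ x - ((cfc (fun z => (cutAngle ε z : ℂ)) (V x)).trace).re) / (2 * π)
  have hopen : IsOpen {z : ℂ | -z * starRingEnd ℂ (arcPoint ε) ∈ Complex.slitPlane} :=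
    Complex.isOpen_slitPlane.preimage (by fun_prop)
  have hcfc : ContinuousOn (fun x => cfc (fun z => (cutAngle ε z : ℂ)) (V x)) Z := by
    refine ContinuousOn.cfc_of_mem_nhdsSet _
      (s := {z : ℂ | -z * starRingEnd ℂ (arcPoint ε) ∈ Complex.slitPlane}) ?_ hV
      (fun x hx => isStarNormal_of_unitary (hU x hx)) ?_
    · refine hopen.mem_nhdsSet.2 (iUnion₂_subset fun x hx z hz => ?_)
      exact cut_mem_slitPlane (norm_eq_one_of_mem_spectrum (hU x hx) hz)
        fun he => hne x hx (he ▸ hz)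
    · refine Complex.continuous_ofReal.comp_continuousOn ?_
      unfold cutAngle
      refine ((ContinuousOn.add ?_ continuousOn_const).add continuousOn_const)
      intro z hz
      exact ((Complex.continuousAt_arg hz).comp
        (f := fun z : ℂ => -z * starRingEnd ℂ (arcPoint ε)) (by fun_prop)).continuousWithinAt
  have hg : ContinuousOn g Z := by
    refine (hΘ.sub ?_).div_const _
    exact Complex.continuous_re.comp_continuousOn
      ((Continuous.matrix_trace continuous_id).comp_continuousOn hcfc)
  -- Both `Θ` and the trace are logarithms of the same determinant, so `g` is integer valued; being
  -- continuous on a preconnected set, it is constant.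
  have hmaps : MapsTo g Z (range ((↑) : ℤ → ℝ)) := by
    intro x hx
    have h1 := exp_trace_cfc_cutAngle (hU x hx) ε
    rw [← hdet x hx, Complex.exp_eq_exp_iff_exists_int] at h1
    obtain ⟨k, hk⟩ := h1
    refine ⟨-k, ?_⟩
    have h2 := congrArg Complex.im hk
    simp at h2
    have := pi_pos
    simp only [g]
    rw [h2]
    push_cast
    field_simp
    ring
  have hdisc : DiscreteTopology (range ((↑) : ℤ → ℝ)) :=
    (Int.isClosedEmbedding_coe_real.isEmbedding.toHomeomorph).symm.isEmbedding.discreteTopology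
  exact hZ.constant_of_mapsTo (T := range ((↑) : ℤ → ℝ)) ⟨hdisc⟩ hg hmaps hx hy

end Path

lemma exists_notMem_spectrum (W : Matrix (Fin n) (Fin n) ℂ) {b : ℝ} (hb : 0 < b) (hb' : b ≤ 2 * π) :
    ∃ ε ∈ Ioo 0 b, arcPoint ε ∉ spectrum ℂ W := by
  by_contra! hcon
  have hinj : InjOn arcPoint (Ioo 0 b) := fun x hx y hy he => by
    rw [← angle_arcPoint hx.1.le (hx.2.trans_le hb'), he, angle_arcPoint hy.1.le (hy.2.trans_le hb')]
  exact (Ioo_infinite hb) (((spectrum_finite W).subset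
    (image_subset_iff.2 hcon)).of_finite_image hinj)

section Interval

variable {V : ℝ → Matrix (Fin n) (Fin n) ℂ} {Θ : ℝ → ℝ} {a b : ℝ}

/-- On each subinterval the count changes by the change of winding, and the sum telescopes. In
particular the flow does not depend on the partition or the angles. -/
lemma IsSpectralFlow.eq_winding (hV : ContinuousOn V (Icc a b))
    (hU : ∀ x ∈ Icc a b, V x ∈ Matrix.unitaryGroup (Fin n) ℂ) (hΘ : ContinuousOn Θ (Icc a b))
    (hdet : ∀ x ∈ Icc a b, Complex.exp (Θ x * Complex.I) = (V x).det) {m : ℤ}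
    (h : IsSpectralFlow V a b m) : (m : ℝ) = winding (Θ b) (V b) - winding (Θ a) (V a) := by
  obtain ⟨N, t, ε, hmono, ht0, htN, hne, rfl⟩ := h
  push_cast
  have : ∀ j ∈ Finset.range N, (arcCount (V (t (j + 1))) (ε j) : ℝ) - arcCount (V (t j)) (ε j) =
      winding (Θ (t (j + 1))) (V (t (j + 1))) - winding (Θ (t j)) (V (t j)) := by
    intro j hj
    rw [Finset.mem_range] at hj
    obtain ⟨hε, hs⟩ := hne j hj
    have hle : t j ≤ t (j + 1) := hmono j.le_succ
    have hsub : Icc (t j) (t (j + 1)) ⊆ Icc a b := Icc_subset_Icc (ht0 ▸ hmono j.zero_le)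
      (htN ▸ hmono hj)
    have := winding_sub_arcCount_eq isPreconnected_Icc (hV.mono hsub) (fun x hx => hU x (hsub hx))
      (hΘ.mono hsub) (fun x hx => hdet x (hsub hx)) ⟨hε.1, hε.2.trans (by linarith [pi_pos])⟩
      (fun x hx he => hs x hx ((hasEigenvalue_iff_mem_spectrum _ _).2 he))
      (right_mem_Icc.2 hle) (left_mem_Icc.2 hle)
    linarith
  rw [Finset.sum_congr rfl this,
    Finset.sum_range_sub (fun j => winding (Θ (t j)) (V (t j))), ht0, htN]

/-- Near each parameter some angle in `(0, π)` avoids the finite spectrum and keeps avoiding it,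
since this is an open condition; a Lebesgue partition for this cover is admissible. -/
lemma exists_isSpectralFlow (hab : a ≤ b) (hV : ContinuousOn V (Icc a b)) :
    ∃ m, IsSpectralFlow V a b m := by
  choose ε hε hεne using fun x : Icc a b => exists_notMem_spectrum (V x) pi_pos (by linarith [pi_pos])
  have hV' : Continuous fun x : Icc a b => V x := continuousOn_iff_continuous_domRestrict.1 hV
  obtain ⟨t, ht0, hmono, ⟨N, hN⟩, hsub⟩ := exists_monotone_Icc_subset_open_cover_Icc hab
    (c := fun x : Icc a b => {y : Icc a b | arcPoint (ε x) ∉ spectrum ℂ (V y)})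
    (fun x => (isOpen_ne_arcPoint (ε x)).preimage hV')
    (fun x _ => mem_iUnion.2 ⟨x, hεne x⟩)
  choose p hp using hsub
  refine ⟨_, N, fun j => t j, fun j => ε (p j), fun i j hij => hmono hij, ht0, hN N le_rfl,
    fun j _ => ⟨hε _, fun s hs => ?_⟩, rfl⟩
  have hs' : s ∈ Icc a b := ⟨(t j).2.1.trans hs.1, hs.2.trans (t (j + 1)).2.2⟩
  rw [hasEigenvalue_iff_mem_spectrum]
  exact hp j (show (⟨s, hs'⟩ : Icc a b) ∈ Icc (t j) (t (j + 1)) from ⟨hs.1, hs.2⟩)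

lemma isSpectralFlow_iff (hab : a ≤ b) (hV : ContinuousOn V (Icc a b))
    (hU : ∀ x ∈ Icc a b, V x ∈ Matrix.unitaryGroup (Fin n) ℂ) (hΘ : ContinuousOn Θ (Icc a b))
    (hdet : ∀ x ∈ Icc a b, Complex.exp (Θ x * Complex.I) = (V x).det) {m : ℤ} :
    IsSpectralFlow V a b m ↔ (m : ℝ) = winding (Θ b) (V b) - winding (Θ a) (V a) := by
  refine ⟨fun h => h.eq_winding hV hU hΘ hdet, fun h => ?_⟩
  obtain ⟨m', hm'⟩ := exists_isSpectralFlow hab hV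
  have := hm'.eq_winding hV hU hΘ hdet
  have e : m = m' := by exact_mod_cast h.trans this.symm
  exact e ▸ hm'

/-- Crossings of `-1` in the clockwise direction. -/
def ClockwiseAt (V : ℝ → Matrix (Fin n) (Fin n) ℂ) (a b t : ℝ) : Prop :=
  ∃ δ > 0, ∀ s ∈ Icc a b, |s - t| < δ → s ≠ t → ∀ θ, |θ| < δ →
    arcPoint θ ∈ spectrum ℂ (V s) → (s - t) * θ < 0

/-- The spectrum is finite, so `-1` is at a positive distance from all other eigenvalues. -/
lemma exists_small_angles (W : Matrix (Fin n) (Fin n) ℂ) {δ : ℝ} (hδ : 0 < δ) :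
    ∃ ε ∈ Ioo 0 δ, ε < π ∧ ∀ θ, |θ| ≤ ε → arcPoint θ ∈ spectrum ℂ W → θ = 0 := by
  have h1 : ∀ᶠ ε in 𝓝[>] (0 : ℝ), ∀ z ∈ spectrum ℂ W, angle z ≠ 0 →
      ε < angle z ∧ ε < 2 * π - angle z := by
    rw [(spectrum_finite W).eventually_all]
    intro z _
    by_cases hz : angle z = 0
    · exact Eventually.of_forall fun ε h => absurd hz h
    · have p1 : 0 < angle z := lt_of_le_of_ne (angle_nonneg z) (Ne.symm hz)
      have p2 : 0 < 2 * π - angle z := sub_pos.2 (angle_lt z)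
      filter_upwards [Ioo_mem_nhdsGT p1, Ioo_mem_nhdsGT p2] with ε h1 h2 _ using ⟨h1.2, h2.2⟩
  have h2 : ∀ᶠ ε in 𝓝[>] (0 : ℝ), ε ∈ Ioo 0 δ := Ioo_mem_nhdsGT hδ
  have h3 : ∀ᶠ ε in 𝓝[>] (0 : ℝ), ε ∈ Ioo 0 π := Ioo_mem_nhdsGT pi_pos
  obtain ⟨ε, h1, h2, h3⟩ := (h1.and (h2.and h3)).exists
  refine ⟨ε, h2, h3.2, fun θ hθ hs => ?_⟩
  by_contra hne
  rw [abs_le] at hθ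
  rcases lt_or_gt_of_ne hne with h | h
  -- A small negative angle is seen by `angle` as one close to `2π`.
  · rw [← arcPoint_add_two_pi] at hs
    have ha := angle_arcPoint (θ := θ + 2 * π) (by linarith [h3.2, pi_pos]) (by linarith)
    have := h1 _ hs (by rw [ha]; linarith [h3.2, pi_pos])
    rw [ha] at this
    linarith [this.2]
  · have ha := angle_arcPoint h.le (by linarith [h3.2, pi_pos])
    have := h1 _ hs (by rw [ha]; exact hne)
    rw [ha] at this
    linarith [this.1]

/-- The multiplicity of the eigenvalue `-1`. -/
noncomputable def crossingDim (W : Matrix (Fin n) (Fin n) ℂ) : ℕ :=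
  Module.finrank ℂ (Module.End.eigenspace (Matrix.toLin' W) (-1))

lemma crossingDim_eq_zero_iff (W : Matrix (Fin n) (Fin n) ℂ) :
    crossingDim W = 0 ↔ (-1 : ℂ) ∉ spectrum ℂ W := by
  rw [← hasEigenvalue_iff_mem_spectrum, Module.End.hasEigenvalue_iff, crossingDim,
    Submodule.finrank_eq_zero, not_not]

/-- At a clockwise crossing the eigenvalues sitting at `-1` come from small positive angles and
leave to small negative ones. Since `-1` belongs to the counted arc, nothing changes up to and
including `t`, and the winding drops by the full multiplicity just after `t`. -/
lemma eventually_winding_eq (hV : ContinuousOn V (Icc a b))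
    (hU : ∀ x ∈ Icc a b, V x ∈ Matrix.unitaryGroup (Fin n) ℂ) (hΘ : ContinuousOn Θ (Icc a b))
    (hdet : ∀ x ∈ Icc a b, Complex.exp (Θ x * Complex.I) = (V x).det) {t : ℝ} (ht : t ∈ Icc a b)
    (hc : ClockwiseAt V a b t) :
    ∃ δ > 0, ∀ s ∈ Icc a b, |s - t| < δ → (s ≠ t → crossingDim (V s) = 0) ∧
      winding (Θ s) (V s) = winding (Θ t) (V t) - if t < s then (crossingDim (V t) : ℝ) else 0 := by
  obtain ⟨δ₁, hδ₁, hcw⟩ := hc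
  obtain ⟨ε, hε, hεπ, hsmall⟩ := exists_small_angles (V t) hδ₁
  have hε0 : 0 < ε := hε.1
  have hne1 : arcPoint ε ∉ spectrum ℂ (V t) := fun h =>
    hε0.ne' (hsmall ε (by rw [abs_of_pos hε0]) h)
  have hne2 : arcPoint (2 * π - ε) ∉ spectrum ℂ (V t) := fun h => by
    rw [← arcPoint_sub_two_pi] at h
    have := hsmall _ (by rw [abs_le]; constructor <;> linarith) h
    linarith
  have hev : ∀ᶠ s in 𝓝[Icc a b] t, arcPoint ε ∉ spectrum ℂ (V s) ∧
      arcPoint (2 * π - ε) ∉ spectrum ℂ (V s) :=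
    ((hV t ht).eventually ((isOpen_ne_arcPoint ε).mem_nhds hne1)).and
      ((hV t ht).eventually ((isOpen_ne_arcPoint (2 * π - ε)).mem_nhds hne2))
  rw [eventually_nhdsWithin_iff, Metric.eventually_nhds_iff] at hev
  obtain ⟨δ₂, hδ₂, hav⟩ := hev
  refine ⟨min δ₁ δ₂, lt_min hδ₁ hδ₂, fun s hs hst => ?_⟩
  have hst1 := hst.trans_le (min_le_left _ _)
  have hst2 := hst.trans_le (min_le_right _ _)
  refine ⟨fun hne => ?_, ?_⟩
  · rw [crossingDim_eq_zero_iff]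
    intro h
    rw [← arcPoint_zero] at h
    have := hcw s hs hst1 hne 0 (by simpa using hδ₁) h
    simp at this
  obtain ⟨Ut, dt, het⟩ := exists_diagonalization (hU t ht)
  obtain ⟨Us, ds, hes⟩ := exists_diagonalization (hU s hs)
  have hseg : ∀ x ∈ uIcc s t, x ∈ Icc a b ∧ dist x t < δ₂ := by
    intro x hx
    refine ⟨ordConnected_Icc.uIcc_subset hs ht hx, ?_⟩
    rw [Real.dist_eq]
    refine lt_of_le_of_lt ?_ hst2
    rcases le_total s t with h | h
    · rw [uIcc_of_le h] at hx
      rw [abs_of_nonpos (by linarith [hx.2]), abs_of_nonpos (by linarith)]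
      linarith [hx.1]
    · rw [uIcc_of_ge h] at hx
      rw [abs_of_nonneg (by linarith [hx.1]), abs_of_nonneg (by linarith)]
      linarith [hx.2]
  have key : ∀ η ∈ Ioo 0 (2 * π), (∀ x ∈ uIcc s t, arcPoint η ∉ spectrum ℂ (V x)) →
      winding (Θ s) (V s) - arcCount (V s) η = winding (Θ t) (V t) - arcCount (V t) η := by
    intro η hη hav
    have hsub : uIcc s t ⊆ Icc a b := fun x hx => (hseg x hx).1
    exact winding_sub_arcCount_eq isPreconnected_uIcc (hV.mono hsub) (fun x hx => hU x (hsub hx))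
      (hΘ.mono hsub) (fun x hx => hdet x (hsub hx)) hη hav left_mem_uIcc right_mem_uIcc
  have hang : ∀ i, dt i ∈ spectrum ℂ (V t) := fun i => (mem_spectrum_iff_exists het _).2 ⟨i, rfl⟩
  have hangs : ∀ i, ds i ∈ spectrum ℂ (V s) := fun i => (mem_spectrum_iff_exists hes _).2 ⟨i, rfl⟩
  split_ifs with hlt
  -- After the crossing, cut just past `-1`: at `t` the short arc contains only the eigenvalue `-1`,
  -- and at `s` it is empty.
  · have h1 := key ε ⟨hε0, by linarith⟩ fun x hx => (hav (hseg x hx).2 (hseg x hx).1).1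
    have hs0 : arcCount (V s) ε = 0 := by
      rw [arcCount_eq (hU s hs) hes (by linarith), Finset.card_eq_zero, Finset.filter_eq_empty_iff]
      intro i _ hi
      have := hcw s hs hst1 hlt.ne' (angle (ds i))
        (by rw [abs_of_nonneg (angle_nonneg _)]; exact hi.trans hε.2)
        (by rw [arcPoint_angle (norm_diag (hU s hs) hes i)]; exact hangs i)
      nlinarith [angle_nonneg (ds i)]
    have ht0 : arcCount (V t) ε = crossingDim (V t) := by
      rw [arcCount_eq (hU t ht) het (by linarith), crossingDim, finrank_eigenspace_conj_diagonal het]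
      congr 1
      ext i
      simp only [Finset.mem_filter, Finset.mem_univ, true_and]
      constructor
      · intro hi
        have := hsmall (angle (dt i)) (by rw [abs_of_nonneg (angle_nonneg _)]; exact hi.le)
          (by rw [arcPoint_angle (norm_diag (hU t ht) het i)]; exact hang i)
        rw [← arcPoint_angle (norm_diag (hU t ht) het i), this, arcPoint_zero]
      · intro hi
        rwa [hi, ← arcPoint_zero, angle_arcPoint le_rfl (by positivity)]
    rw [hs0, ht0] at h1
    push_cast at h1
    linarith
  -- Before the crossing, cut just short of `-1`: the long arc contains all `n` eigenvalues at both
  -- `s` and `t`.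
  · have h1 := key (2 * π - ε) ⟨by linarith, by linarith⟩
      fun x hx => (hav (hseg x hx).2 (hseg x hx).1).2
    rcases eq_or_lt_of_le (not_lt.1 hlt) with rfl | hlt'
    · simp
    have hs0 : arcCount (V s) (2 * π - ε) = n := by
      rw [arcCount_eq (hU s hs) hes (by linarith)]
      conv_rhs => rw [← Fintype.card_fin n, ← Finset.card_univ]
      congr 1
      rw [Finset.filter_eq_self]
      intro i _
      by_contra hi
      have hlt2 := angle_lt (ds i)
      have := hcw s hs hst1 hlt'.ne (angle (ds i) - 2 * π)
        (by rw [abs_of_nonpos (by linarith)]; linarith [hε.2])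
        (by rw [arcPoint_sub_two_pi, arcPoint_angle (norm_diag (hU s hs) hes i)]; exact hangs i)
      nlinarith
    have ht0 : arcCount (V t) (2 * π - ε) = n := by
      rw [arcCount_eq (hU t ht) het (by linarith)]
      conv_rhs => rw [← Fintype.card_fin n, ← Finset.card_univ]
      congr 1
      rw [Finset.filter_eq_self]
      intro i _
      by_contra hi
      have hlt2 := angle_lt (dt i)
      have := hsmall (angle (dt i) - 2 * π) (by rw [abs_of_nonpos (by linarith)]; linarith)
        (by rw [arcPoint_sub_two_pi, arcPoint_angle (norm_diag (hU t ht) het i)]; exact hang i)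
      linarith
    rw [hs0, ht0] at h1
    linarith

/-- If all crossings are clockwise, the winding number counts the crossings. -/
lemma winding_sub_winding_eq_sum (hab : a ≤ b) (hV : ContinuousOn V (Icc a b))
    (hU : ∀ x ∈ Icc a b, V x ∈ Matrix.unitaryGroup (Fin n) ℂ) (hΘ : ContinuousOn Θ (Icc a b))
    (hdet : ∀ x ∈ Icc a b, Complex.exp (Θ x * Complex.I) = (V x).det)
    (hc : ∀ t ∈ Icc a b, ClockwiseAt V a b t) :
    ∃ F : Finset ℝ, (∀ t, t ∈ F ↔ t ∈ Ico a b ∧ crossingDim (V t) ≠ 0) ∧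
      winding (Θ a) (V a) - winding (Θ b) (V b) = ((∑ t ∈ F, crossingDim (V t) : ℕ) : ℝ) := by
  classical
  choose! δ hδ hloc using fun t ht => eventually_winding_eq hV hU hΘ hdet ht (hc t ht)
  -- Crossings are isolated, so compactness leaves finitely many.
  have hfin : {t | t ∈ Icc a b ∧ crossingDim (V t) ≠ 0}.Finite := by
    obtain ⟨T, hT, hcov⟩ := isCompact_Icc.elim_nhds_subcover (s := Icc a b)
      (fun t => Metric.ball t (δ t)) fun t ht => Metric.ball_mem_nhds t (hδ t ht)
    refine T.finite_toSet.subset fun s hs => ?_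
    obtain ⟨t, htT, hst⟩ := mem_iUnion₂.1 (hcov hs.1)
    by_contra hne
    have hst' : |s - t| < δ t := by simpa [Real.dist_eq] using hst
    exact hs.2 ((hloc t (hT t htT) s hs.1 hst').1 fun h => hne (h ▸ htT))
  set T := hfin.toFinset
  have hT : ∀ t, t ∈ T ↔ t ∈ Icc a b ∧ crossingDim (V t) ≠ 0 := fun t => hfin.mem_toFinset
  -- Adding back the multiplicities of the crossings strictly before `s` cancels the drops and makes
  -- `g` locally constant.
  set g : ℝ → ℝ := fun s => winding (Θ s) (V s) + ∑ t ∈ T.filter (· < s), (crossingDim (V t) : ℝ)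
  have hg : ∀ t ∈ Icc a b, ∀ s ∈ Icc a b, |s - t| < δ t → g s = g t := by
    intro t ht s hs hst
    have h1 := (hloc t ht s hs hst).2
    have hclean : ∀ r ∈ T, |r - t| < δ t → r = t := fun r hr hrt => by
      by_contra hne
      exact ((hT r).1 hr).2 ((hloc t ht r ((hT r).1 hr).1 hrt).1 hne)
    simp only [g]
    rcases lt_trichotomy s t with hlt | rfl | hlt
    · rw [if_neg (not_lt.2 hlt.le), sub_zero] at h1
      rw [h1]
      congr 2
      ext r
      simp only [Finset.mem_filter, and_congr_right_iff]
      refine fun hr => ⟨fun h => h.trans hlt, fun h => ?_⟩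
      by_contra hrs
      have := hclean r hr (by
        rw [abs_of_neg (by linarith)] at hst ⊢
        linarith [not_lt.1 hrs])
      exact h.ne this
    · rfl
    · rw [if_pos hlt] at h1
      rw [h1]
      by_cases h0 : crossingDim (V t) = 0
      · rw [h0, Nat.cast_zero, sub_zero]
        congr 2
        ext r
        simp only [Finset.mem_filter, and_congr_right_iff]
        refine fun hr => ⟨fun h => ?_, fun h => h.trans hlt⟩
        by_contra hrt
        have := hclean r hr (by
          rw [abs_of_nonneg (by linarith [not_lt.1 hrt])]
          rw [abs_of_pos (by linarith)] at hst
          linarith)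
        exact ((hT r).1 hr).2 (this ▸ h0)
      · have e : T.filter (· < s) = insert t (T.filter (· < t)) := by
          ext r
          simp only [Finset.mem_filter, Finset.mem_insert]
          constructor
          · rintro ⟨hr, hrs⟩
            by_cases hrt : r < t
            · exact Or.inr ⟨hr, hrt⟩
            · refine Or.inl (hclean r hr ?_)
              rw [abs_of_nonneg (by linarith [not_lt.1 hrt])]
              rw [abs_of_pos (by linarith)] at hst
              linarith
          · rintro (rfl | ⟨hr, hrt⟩)
            · exact ⟨(hT _).2 ⟨ht, h0⟩, hlt⟩
            · exact ⟨hr, hrt.trans hlt⟩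
        rw [e, Finset.sum_insert (by simp)]
        ring
  have hderiv : ∀ t ∈ Icc a b, HasDerivWithinAt g 0 (Icc a b) t := by
    intro t ht
    refine (hasDerivWithinAt_const t (Icc a b) (g t)).congr_of_eventuallyEq ?_ rfl
    rw [EventuallyEq, eventually_nhdsWithin_iff, Metric.eventually_nhds_iff]
    exact ⟨δ t, hδ t ht, fun s hst hs => hg t ht s hs (by simpa [Real.dist_eq] using hst)⟩
  have hconst : g b = g a := by
    refine constant_of_has_deriv_right_zero (fun t ht => (hderiv t ht).continuousWithinAt)
      (fun t ht => ?_) b (right_mem_Icc.2 hab)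
    exact (hderiv t ⟨ht.1, ht.2.le⟩).mono_of_mem_nhdsWithin
      (Icc_mem_nhdsGE_of_mem ht)
  -- A crossing at `b` does not count, because its drop would only occur after `b`; a crossing at
  -- `a` does.
  refine ⟨T.filter (· < b), fun t => ?_, ?_⟩
  · rw [Finset.mem_filter, hT]
    exact ⟨fun h => ⟨⟨h.1.1.1, h.2⟩, h.1.2⟩, fun h => ⟨⟨⟨h.1.1, h.1.2.le⟩, h.2⟩, h.1.2⟩⟩
  · have e : T.filter (· < a) = ∅ := by
      rw [Finset.filter_eq_empty_iff]
      exact fun r hr => not_lt.2 ((hT r).1 hr).1.1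
    simp only [g, e, Finset.sum_empty, add_zero] at hconst
    push_cast
    linarith

lemma isOpen_prod_arcPoint :
    IsOpen {p : ℝ × Matrix (Fin n) (Fin n) ℂ | arcPoint p.1 ∉ spectrum ℂ p.2} := by
  have : {p : ℝ × Matrix (Fin n) (Fin n) ℂ | arcPoint p.1 ∉ spectrum ℂ p.2} =
      {p | (arcPoint p.1 • (1 : Matrix (Fin n) (Fin n) ℂ) - p.2).det ≠ 0} := by
    ext p
    simp only [mem_ofPred_eq, spectrum.notMem_iff, Matrix.isUnit_iff_isUnit_det, isUnit_iff_ne_zero,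
      Algebra.algebraMap_eq_smul_one]
  rw [this]
  refine isOpen_ne_fun (Continuous.matrix_det ?_) continuous_const
  exact ((continuous_arcPoint.comp continuous_fst).smul continuous_const).sub continuous_snd

/-- The condition is vacuous: by openness no eigenvalue is close to `-1` for parameters close to
`t`. -/
lemma clockwiseAt_of_notMem (hV : ContinuousOn V (Icc a b)) {t : ℝ} (ht : t ∈ Icc a b)
    (h : (-1 : ℂ) ∉ spectrum ℂ (V t)) : ClockwiseAt V a b t := by
  have hlim : Tendsto (fun p : ℝ × ℝ => (p.1, V p.2)) (𝓝 0 ×ˢ 𝓝[Icc a b] t) (𝓝 (0, V t)) :=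
    tendsto_fst.prodMk_nhds ((hV t ht).tendsto.comp tendsto_snd)
  have hev := hlim.eventually (isOpen_prod_arcPoint.mem_nhds
    (show arcPoint 0 ∉ spectrum ℂ (V t) by rwa [arcPoint_zero]))
  obtain ⟨p, hp, q, hq, hpq⟩ := eventually_prod_iff.1 hev
  rw [eventually_nhdsWithin_iff, Metric.eventually_nhds_iff] at hq
  rw [Metric.eventually_nhds_iff] at hp
  obtain ⟨δ₁, hδ₁, hp⟩ := hp
  obtain ⟨δ₂, hδ₂, hq⟩ := hq
  refine ⟨min δ₁ δ₂, lt_min hδ₁ hδ₂, fun s hs hst _ θ hθ hspec => absurd hspec ?_⟩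
  exact hpq (hp (by rw [Real.dist_eq, sub_zero]; exact hθ.trans_le (min_le_left _ _)))
    (hq (by rw [Real.dist_eq]; exact hst.trans_le (min_le_right _ _)) hs)

end Interval

end SpectralFlow

/-- A continuous family of unitary matrices on a rectangle has a continuous logarithm of its
determinant. -/
lemma exists_log_det {n : ℕ} {V : ℝ × ℝ → Matrix (Fin n) (Fin n) ℂ} {a b c d : ℝ} (hab : a ≤ b)
    (hcd : c ≤ d) (hV : ContinuousOn V (Icc a b ×ˢ Icc c d))
    (hU : ∀ p ∈ Icc a b ×ˢ Icc c d, V p ∈ Matrix.unitaryGroup (Fin n) ℂ) :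
    ∃ Θ : ℝ × ℝ → ℝ, Continuous Θ ∧
      ∀ p ∈ Icc a b ×ˢ Icc c d, Complex.exp (Θ p * Complex.I) = (V p).det := by
  -- Composing with the retraction onto the rectangle gives a circle-valued map on the simply
  -- connected plane, which lifts through the exponential covering.
  let r : ℝ × ℝ → ℝ × ℝ := fun p => ((projIcc a b hab p.1 : ℝ), (projIcc c d hcd p.2 : ℝ))
  have hr : Continuous r := by
    refine Continuous.prodMk ?_ ?_
    · exact continuous_subtype_val.comp (continuous_projIcc.comp continuous_fst)
    · exact continuous_subtype_val.comp (continuous_projIcc.comp continuous_snd)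
  have hrm : ∀ p, r p ∈ Icc a b ×ˢ Icc c d := fun p => ⟨Subtype.prop _, Subtype.prop _⟩
  have hre : ∀ p ∈ Icc a b ×ˢ Icc c d, r p = p := fun p hp => by
    simp only [r, projIcc_of_mem hab hp.1, projIcc_of_mem hcd hp.2]
  have hdet : Continuous fun p => (V (r p)).det :=
    Continuous.matrix_det (hV.comp_continuous hr hrm)
  have hnorm : ∀ p, ‖(V (r p)).det‖ = 1 := fun p => by
    exact CStarRing.norm_of_mem_unitary (Matrix.det_of_mem_unitary (hU _ (hrm p)))
  let f : C(ℝ × ℝ, Circle) := ⟨fun p => ⟨(V (r p)).det, mem_sphere_zero_iff_norm.2 (hnorm p)⟩,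
    hdet.subtype_mk _⟩
  obtain ⟨Θ, ⟨-, hΘ⟩, -⟩ := Circle.isCoveringMap_exp.existsUnique_continuousMap_lifts f (0, 0)
    (Complex.arg (f (0, 0))) (Circle.exp_arg _)
  refine ⟨Θ, Θ.continuous, fun p hp => ?_⟩
  have h1 := congrArg (Subtype.val) (congrFun hΘ p)
  simp only [Function.comp_apply] at h1
  have h2 : ((f p : Circle) : ℂ) = (V (r p)).det := rfl
  rw [hre p hp] at h2
  rw [← h2, ← Circle.coe_exp]
  exact h1

/-! ### Lagrangian subspaces and unitary matrices -/

section Act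

variable {k l m : Type*} [Fintype k] [Fintype l] [Fintype m] [DecidableEq m]

lemma act_mul [DecidableEq l] (A : Matrix k l ℂ) (B : Matrix l m ℂ) (v : EuclideanSpace ℂ m) :
    act (A * B) v = act A (act B v) := by
  unfold act
  rw [Matrix.toEuclideanLin, Matrix.toLpLin_mul (q := 2)]
  rfl

lemma act_one (v : EuclideanSpace ℂ m) : act (1 : Matrix m m ℂ) v = v := by
  unfold act
  rw [Matrix.toEuclideanLin, Matrix.toLpLin_one]
  rfl

lemma act_add (A B : Matrix l m ℂ) (v : EuclideanSpace ℂ m) :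
    act (A + B) v = act A v + act B v := by
  unfold act; rw [map_add]; rfl

lemma act_sub (A B : Matrix l m ℂ) (v : EuclideanSpace ℂ m) :
    act (A - B) v = act A v - act B v := by
  unfold act; rw [map_sub]; rfl

lemma act_neg (A : Matrix l m ℂ) (v : EuclideanSpace ℂ m) : act (-A) v = -act A v := by
  unfold act; rw [map_neg]; rfl

lemma act_smul (c : ℂ) (A : Matrix l m ℂ) (v : EuclideanSpace ℂ m) :
    act (c • A) v = c • act A v := by
  unfold act; rw [map_smul]; rfl

lemma act_zero (v : EuclideanSpace ℂ m) : act (0 : Matrix l m ℂ) v = 0 := by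
  unfold act; rw [map_zero]; rfl

lemma act_apply_zero (A : Matrix l m ℂ) : act A (0 : EuclideanSpace ℂ m) = 0 := by
  unfold act; rw [map_zero]

lemma act_apply_sub (A : Matrix l m ℂ) (u v : EuclideanSpace ℂ m) :
    act A (u - v) = act A u - act A v := by
  unfold act; rw [map_sub]

lemma act_apply_smul (A : Matrix l m ℂ) (c : ℂ) (v : EuclideanSpace ℂ m) :
    act A (c • v) = c • act A v := by
  unfold act; rw [map_smul]

lemma inner_act [DecidableEq l] (A : Matrix l m ℂ) (u : EuclideanSpace ℂ l) (v : EuclideanSpace ℂ m) :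
    inner ℂ u (act A v) = inner ℂ (act Aᴴ u) v := by
  unfold act
  rw [Matrix.toEuclideanLin_conjTranspose_eq_adjoint, LinearMap.adjoint_inner_left]

lemma eq_of_act_eq {A B : Matrix l m ℂ} (h : ∀ v, act A v = act B v) : A = B :=
  Matrix.toEuclideanLin.injective (LinearMap.ext h)

lemma rank_eq_finrank_range_act (A : Matrix l m ℂ) :
    A.rank = Module.finrank ℂ (LinearMap.range (Matrix.toEuclideanLin A)) := by
  rw [Matrix.toEuclideanLin, Matrix.toLpLin_eq_toLin]
  exact Matrix.rank_eq_finrank_range_toLin A _ _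

lemma toEuclideanCLM_eq_act (A : Matrix m m ℂ) (v : EuclideanSpace ℂ m) :
    Matrix.toEuclideanCLM (𝕜 := ℂ) A v = act A v := rfl

end Act

/-! ### Frames, the Cayley transform and `W̃` -/

section Lagrangian

variable {n : ℕ}

/-- The map `(φ, ψ) ↦ φ + iψ`. -/
noncomputable def plusMat (n : ℕ) : Matrix (Fin n) (Fin n ⊕ Fin n) ℂ :=
  Matrix.fromCols 1 (Complex.I • (1 : Matrix (Fin n) (Fin n) ℂ))

/-- The map `(φ, ψ) ↦ φ - iψ`. -/
noncomputable def minusMat (n : ℕ) : Matrix (Fin n) (Fin n ⊕ Fin n) ℂ :=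
  Matrix.fromCols 1 (-Complex.I • (1 : Matrix (Fin n) (Fin n) ℂ))

lemma plusMat_conjTranspose_mul :
    (plusMat n)ᴴ * plusMat n = 1 - Complex.I • Matrix.J (Fin n) ℂ := by
  unfold plusMat
  rw [Matrix.conjTranspose_fromCols_eq_fromRows_conjTranspose, Matrix.fromRows_mul_fromCols,
    Matrix.J, Matrix.fromBlocks_smul, ← Matrix.fromBlocks_one, sub_eq_add_neg, Matrix.fromBlocks_neg,
    Matrix.fromBlocks_add]
  simp [smul_smul]

lemma minusMat_conjTranspose_mul :
    (minusMat n)ᴴ * minusMat n = 1 + Complex.I • Matrix.J (Fin n) ℂ := by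
  unfold minusMat
  rw [Matrix.conjTranspose_fromCols_eq_fromRows_conjTranspose, Matrix.fromRows_mul_fromCols,
    Matrix.J, Matrix.fromBlocks_smul, ← Matrix.fromBlocks_one,
    Matrix.fromBlocks_add]
  simp [smul_smul]

lemma framePlus_eq (ℓ : Submodule ℂ (C2n n)) : framePlus ℓ = plusMat n * frame ℓ := by
  unfold framePlus plusMat
  conv_rhs => rw [← Matrix.fromRows_toRows (frame ℓ)]
  rw [Matrix.fromCols_mul_fromRows]
  simp

lemma frameMinus_eq (ℓ : Submodule ℂ (C2n n)) : frameMinus ℓ = minusMat n * frame ℓ := by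
  unfold frameMinus minusMat
  conv_rhs => rw [← Matrix.fromRows_toRows (frame ℓ)]
  rw [Matrix.fromCols_mul_fromRows]
  simp [sub_eq_add_neg]

/-- The unitary matrix with `U (φ - iψ) = φ + iψ` for `(φ, ψ) ∈ ℓ`, in terms of the projection. -/
noncomputable def cayley (ℓ : Submodule ℂ (C2n n)) : Matrix (Fin n) (Fin n) ℂ :=
  plusMat n * (Matrix.toEuclideanCLM (𝕜 := ℂ)).symm (proj ℓ) * (minusMat n)ᴴ

/-- The matrix depends linearly on the projection, so continuity needs no continuous choice of
frames. -/
lemma tendsto_cayley {ι : Type*} {f : Filter ι} {ℓ : ι → Submodule ℂ (C2n n)}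
    {L : Submodule ℂ (C2n n)} (h : Tendsto (fun i => proj (ℓ i)) f (𝓝 (proj L))) :
    Tendsto (fun i => cayley (ℓ i)) f (𝓝 (cayley L)) := by
  have hc : Continuous fun T : C2n n →L[ℂ] C2n n =>
      plusMat n * (Matrix.toEuclideanCLM (𝕜 := ℂ)).symm T * (minusMat n)ᴴ := by
    have h1 : Continuous fun T : C2n n →L[ℂ] C2n n =>
        (Matrix.toEuclideanCLM (n := Fin n ⊕ Fin n) (𝕜 := ℂ)).symm T :=
      ((Matrix.toEuclideanCLM (n := Fin n ⊕ Fin n)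
        (𝕜 := ℂ)).symm.toAlgEquiv.toLinearMap).continuous_of_finiteDimensional
    exact (continuous_const.matrix_mul h1).matrix_mul continuous_const
  exact (hc.tendsto _).comp h

variable {ℓ ℓ₁ ℓ₂ : Submodule ℂ (C2n n)}

lemma exists_isFrame (h : Module.finrank ℂ ℓ = n) : ∃ X, IsFrame X ℓ := by
  have e : (EuclideanSpace ℂ (Fin n)) ≃ₗ[ℂ] ℓ :=
    LinearEquiv.ofFinrankEq _ _ (by rw [h, finrank_euclideanSpace, Fintype.card_fin])
  have hr : LinearMap.range (Matrix.toEuclideanLin (Matrix.toEuclideanLin.symm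
      (ℓ.subtype ∘ₗ e.toLinearMap))) = ℓ := by
    rw [LinearEquiv.apply_symm_apply, LinearMap.range_comp, LinearEquiv.range, Submodule.map_top,
      Submodule.range_subtype]
  refine ⟨Matrix.toEuclideanLin.symm (ℓ.subtype ∘ₗ e.toLinearMap), ?_, hr⟩
  rw [rank_eq_finrank_range_act, hr, h]

lemma isFrame_frame (h : Module.finrank ℂ ℓ = n) : IsFrame (frame ℓ) ℓ := by
  have hex := exists_isFrame h
  unfold frame
  rw [dif_pos hex]
  exact hex.choose_spec

lemma IsFrame.act_injective {X : Matrix (Fin n ⊕ Fin n) (Fin n) ℂ} (h : IsFrame X ℓ) {c : Cn n}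
    (hc : act X c = 0) : c = 0 := by
  have h1 := (Matrix.toEuclideanLin X).finrank_range_add_finrank_ker
  rw [← rank_eq_finrank_range_act, h.1, finrank_euclideanSpace, Fintype.card_fin] at h1
  have h2 : Module.finrank ℂ (LinearMap.ker (Matrix.toEuclideanLin X)) = 0 := by omega
  rw [Submodule.finrank_eq_zero] at h2
  have : c ∈ LinearMap.ker (Matrix.toEuclideanLin X) := hc
  rwa [h2, Submodule.mem_bot] at this

lemma IsFrame.mem_iff {X : Matrix (Fin n ⊕ Fin n) (Fin n) ℂ} (h : IsFrame X ℓ) {y : C2n n} :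
    y ∈ ℓ ↔ ∃ c, act X c = y := by
  rw [← h.2]; rfl

lemma isUnit_det_of_act_injective {A : Matrix (Fin n) (Fin n) ℂ} (h : ∀ c, act A c = 0 → c = 0) :
    IsUnit A.det := by
  rw [← Matrix.isUnit_iff_isUnit_det, ← Matrix.mulVec_injective_iff_isUnit]
  intro v w hvw
  have := h (WithLp.toLp 2 (v - w)) (by
    change WithLp.toLp 2 (A.mulVec (v - w)) = 0
    rw [Matrix.mulVec_sub, hvw, sub_self]; rfl)
  have h2 := congrArg WithLp.ofLp this
  exact sub_eq_zero.1 h2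

lemma inner_plusMat (u v : C2n n) : inner ℂ (act (plusMat n) u) (act (plusMat n) v) =
    inner ℂ u v - Complex.I * inner ℂ u (act (Matrix.J (Fin n) ℂ) v) := by
  rw [inner_act, ← act_mul, ← Matrix.conjTranspose_conjTranspose ((plusMat n)ᴴ * plusMat n),
    ← inner_act, Matrix.conjTranspose_mul, Matrix.conjTranspose_conjTranspose,
    plusMat_conjTranspose_mul, act_sub, act_one, act_smul, inner_sub_right, inner_smul_right]

lemma inner_minusMat (u v : C2n n) : inner ℂ (act (minusMat n) u) (act (minusMat n) v) =
    inner ℂ u v + Complex.I * inner ℂ u (act (Matrix.J (Fin n) ℂ) v) := by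
  rw [inner_act, ← act_mul, ← Matrix.conjTranspose_conjTranspose ((minusMat n)ᴴ * minusMat n),
    ← inner_act, Matrix.conjTranspose_mul, Matrix.conjTranspose_conjTranspose,
    minusMat_conjTranspose_mul, act_add, act_one, act_smul, inner_add_right, inner_smul_right]

lemma eq_zero_of_plusMat_of_minusMat {y : C2n n} (hp : act (plusMat n) y = 0)
    (hm : act (minusMat n) y = 0) : y = 0 := by
  have h1 := inner_plusMat y y
  have h2 := inner_minusMat y y
  rw [hp, inner_zero_left] at h1
  rw [hm, inner_zero_left] at h2
  have : inner ℂ y y = (0 : ℂ) := by linear_combination -(h1 + h2) / 2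
  exact inner_self_eq_zero.1 this

namespace IsLagrangian

variable (h : IsLagrangian ℓ)
include h

/-- The maps `φ ± iψ` fail to be isometric only by a multiple of the symplectic form, which vanishes
on `ℓ`. This is what makes the Cayley transform well defined and unitary. -/
lemma inner_plusMat {u v : C2n n} (hu : u ∈ ℓ) (hv : v ∈ ℓ) :
    inner ℂ (act (plusMat n) u) (act (plusMat n) v) = inner ℂ u v := by
  rw [SturmLiouville.inner_plusMat, h.2 v hv u hu, mul_zero, sub_zero]

lemma inner_minusMat {u v : C2n n} (hu : u ∈ ℓ) (hv : v ∈ ℓ) :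
    inner ℂ (act (minusMat n) u) (act (minusMat n) v) = inner ℂ u v := by
  rw [SturmLiouville.inner_minusMat, h.2 v hv u hu, mul_zero, add_zero]

/-- Since `minusMatᴴ * minusMat = 1 + iJ` and `J y` is orthogonal to `ℓ`, the projection onto `ℓ`
returns `y` itself. -/
lemma cayley_minusMat {y : C2n n} (hy : y ∈ ℓ) :
    act (cayley ℓ) (act (minusMat n) y) = act (plusMat n) y := by
  have h1 : act ((Matrix.toEuclideanCLM (𝕜 := ℂ)).symm (proj ℓ)) =
      fun v : C2n n => proj ℓ v := by
    funext v
    rw [← toEuclideanCLM_eq_act, StarAlgEquiv.apply_symm_apply]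
  have h2 : proj ℓ (act (Matrix.J (Fin n) ℂ) y) = 0 := by
    unfold proj
    rw [Submodule.starProjection_apply_eq_zero_iff, Submodule.mem_orthogonal]
    exact fun u hu => h.2 y hy u hu
  have h3 : proj ℓ y = y := Submodule.starProjection_eq_self_iff.2 hy
  unfold cayley
  rw [act_mul, act_mul, ← act_mul (minusMat n)ᴴ, minusMat_conjTranspose_mul, act_add,
    act_one, act_smul, h1]
  simp only [map_add, map_smul, h2, h3, smul_zero, add_zero]

lemma isUnit_frameMinus : IsUnit (frameMinus ℓ).det := by
  refine isUnit_det_of_act_injective fun c hc => (isFrame_frame h.1).act_injective ?_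
  rw [frameMinus_eq, act_mul] at hc
  have hm : act (frame ℓ) c ∈ ℓ := (isFrame_frame h.1).mem_iff.2 ⟨c, rfl⟩
  have := h.inner_minusMat hm hm
  rw [hc, inner_zero_left] at this
  exact inner_self_eq_zero.1 this.symm

lemma isUnit_framePlus : IsUnit (framePlus ℓ).det := by
  refine isUnit_det_of_act_injective fun c hc => (isFrame_frame h.1).act_injective ?_
  rw [framePlus_eq, act_mul] at hc
  have hm : act (frame ℓ) c ∈ ℓ := (isFrame_frame h.1).mem_iff.2 ⟨c, rfl⟩
  have := h.inner_plusMat hm hm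
  rw [hc, inner_zero_left] at this
  exact inner_self_eq_zero.1 this.symm

lemma cayley_mul_frameMinus : cayley ℓ * frameMinus ℓ = framePlus ℓ := by
  refine eq_of_act_eq fun c => ?_
  rw [act_mul, frameMinus_eq, framePlus_eq, act_mul, act_mul]
  exact h.cayley_minusMat ((isFrame_frame h.1).mem_iff.2 ⟨c, rfl⟩)

lemma exists_minusMat (v : Cn n) : ∃ y ∈ ℓ, act (minusMat n) y = v := by
  refine ⟨act (frame ℓ) (act (frameMinus ℓ)⁻¹ v), (isFrame_frame h.1).mem_iff.2 ⟨_, rfl⟩, ?_⟩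
  rw [← act_mul, ← frameMinus_eq, ← act_mul, Matrix.mul_nonsing_inv _ h.isUnit_frameMinus, act_one]

lemma exists_plusMat (v : Cn n) : ∃ y ∈ ℓ, act (plusMat n) y = v := by
  refine ⟨act (frame ℓ) (act (framePlus ℓ)⁻¹ v), (isFrame_frame h.1).mem_iff.2 ⟨_, rfl⟩, ?_⟩
  rw [← act_mul, ← framePlus_eq, ← act_mul, Matrix.mul_nonsing_inv _ h.isUnit_framePlus, act_one]

lemma cayley_mem_unitaryGroup : cayley ℓ ∈ Matrix.unitaryGroup (Fin n) ℂ := by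
  rw [Matrix.mem_unitaryGroup_iff', Matrix.star_eq_conjTranspose]
  refine eq_of_act_eq fun v => ext_inner_left ℂ fun u => ?_
  obtain ⟨y, hy, rfl⟩ := h.exists_minusMat v
  obtain ⟨z, hz, rfl⟩ := h.exists_minusMat u
  rw [act_mul, inner_act, Matrix.conjTranspose_conjTranspose, h.cayley_minusMat hy,
    h.cayley_minusMat hz, h.inner_plusMat hz hy, act_one, h.inner_minusMat hz hy]

lemma cayley_conjTranspose_plusMat {y : C2n n} (hy : y ∈ ℓ) :
    act (cayley ℓ)ᴴ (act (plusMat n) y) = act (minusMat n) y := by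
  rw [← h.cayley_minusMat hy, ← act_mul, ← Matrix.star_eq_conjTranspose,
    Matrix.mem_unitaryGroup_iff'.1 h.cayley_mem_unitaryGroup, act_one]

end IsLagrangian

/-- The chosen frames cancel, which reduces unitarity and continuity of `W̃` to those of the Cayley
transform. -/
lemma Wtilde_eq (h₁ : IsLagrangian ℓ₁) (h₂ : IsLagrangian ℓ₂) :
    Wtilde ℓ₁ ℓ₂ = -(cayley ℓ₁ * (cayley ℓ₂)ᴴ) := by
  unfold Wtilde
  have hu := Matrix.mem_unitaryGroup_iff'.1 h₂.cayley_mem_unitaryGroup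
  have h3 : frameMinus ℓ₂ = (cayley ℓ₂)ᴴ * framePlus ℓ₂ := by
    rw [← h₂.cayley_mul_frameMinus, ← Matrix.mul_assoc, ← Matrix.star_eq_conjTranspose, hu,
      Matrix.one_mul]
  rw [← h₁.cayley_mul_frameMinus, Matrix.mul_nonsing_inv_cancel_right _ _ h₁.isUnit_frameMinus, h3,
    Matrix.mul_assoc, Matrix.mul_nonsing_inv_cancel_right _ _ h₂.isUnit_framePlus]

lemma Wtilde_mem_unitaryGroup (h₁ : IsLagrangian ℓ₁) (h₂ : IsLagrangian ℓ₂) :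
    Wtilde ℓ₁ ℓ₂ ∈ Matrix.unitaryGroup (Fin n) ℂ := by
  rw [Wtilde_eq h₁ h₂]
  have h1 := h₁.cayley_mem_unitaryGroup
  have h2 := h₂.cayley_mem_unitaryGroup
  have h3 := mul_mem h1 (Unitary.star_mem h2)
  rw [Matrix.star_eq_conjTranspose] at h3
  rw [Matrix.mem_unitaryGroup_iff] at h3 ⊢
  rwa [star_neg, neg_mul_neg]

lemma act_Wtilde_plusMat (h₁ : IsLagrangian ℓ₁) (h₂ : IsLagrangian ℓ₂) {y z : C2n n}
    (hy : y ∈ ℓ₁) (hz : z ∈ ℓ₂) (hyz : act (minusMat n) y = act (minusMat n) z) :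
    act (Wtilde ℓ₁ ℓ₂) (act (plusMat n) z) = -act (plusMat n) y := by
  rw [Wtilde_eq h₁ h₂, act_neg, act_mul, h₂.cayley_conjTranspose_plusMat hz, ← hyz,
    h₁.cayley_minusMat hy]

/-- An eigenvector is encoded by vectors of the two spaces with the same `φ - iψ` whose `φ + iψ`
differ by a phase; for `c = -1` the vectors coincide. -/
lemma exists_of_mem_spectrum_Wtilde (h₁ : IsLagrangian ℓ₁) (h₂ : IsLagrangian ℓ₂) {c : ℂ}
    (hc : c ∈ spectrum ℂ (Wtilde ℓ₁ ℓ₂)) :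
    ∃ y ∈ ℓ₁, ∃ z ∈ ℓ₂, z ≠ 0 ∧ act (minusMat n) y = act (minusMat n) z ∧
      act (plusMat n) y = -c • act (plusMat n) z := by
  rw [← hasEigenvalue_iff_mem_spectrum] at hc
  obtain ⟨w, hw⟩ := hc.exists_hasEigenvector
  have hw' : act (Wtilde ℓ₁ ℓ₂) (WithLp.toLp 2 w) = c • WithLp.toLp 2 w :=
    congrArg (WithLp.toLp 2) hw.apply_eq_smul
  obtain ⟨z, hz, hzw⟩ := h₂.exists_plusMat (WithLp.toLp 2 w)
  obtain ⟨y, hy, hyz⟩ := h₁.exists_minusMat (act (minusMat n) z)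
  rw [← hzw, act_Wtilde_plusMat h₁ h₂ hy hz hyz] at hw'
  refine ⟨y, hy, z, hz, ?_, hyz, ?_⟩
  · rintro rfl
    rw [act_apply_zero] at hzw
    exact hw.2 (congrArg WithLp.ofLp hzw.symm)
  · rw [neg_smul, ← hw', neg_neg]

/-- The map `φ + iψ` is injective on the intersection, being isometric there, and its image is the
eigenspace at `-1`. -/
lemma crossingDim_Wtilde (h₁ : IsLagrangian ℓ₁) (h₂ : IsLagrangian ℓ₂) :
    crossingDim (Wtilde ℓ₁ ℓ₂) = Module.finrank ℂ (ℓ₁ ⊓ ℓ₂ : Submodule ℂ (C2n n)) := by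
  set f : C2n n →ₗ[ℂ] (Fin n → ℂ) :=
    (WithLp.linearEquiv 2 ℂ (Fin n → ℂ)).toLinearMap ∘ₗ Matrix.toEuclideanLin (plusMat n)
  have hf : Function.Injective (f.domRestrict (ℓ₁ ⊓ ℓ₂)) := by
    rw [← LinearMap.ker_eq_bot, LinearMap.ker_eq_bot']
    rintro ⟨y, hy⟩ h
    have h' : act (plusMat n) y = 0 := congrArg (WithLp.toLp 2) h
    have := h₁.inner_plusMat hy.1 hy.1
    rw [h', inner_zero_left] at this
    exact Subtype.ext (inner_self_eq_zero.1 this.symm)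
  rw [← LinearMap.finrank_range_of_inj hf, LinearMap.range_domRestrict]
  unfold crossingDim
  suffices h : Module.End.eigenspace (Matrix.toLin' (Wtilde ℓ₁ ℓ₂)) (-1) =
      Submodule.map f (ℓ₁ ⊓ ℓ₂) by rw [h]
  ext w
  rw [Module.End.mem_eigenspace_iff, Submodule.mem_map]
  constructor
  · intro hw
    have hw' : act (Wtilde ℓ₁ ℓ₂) (WithLp.toLp 2 w) = (-1 : ℂ) • WithLp.toLp 2 w :=
      congrArg (WithLp.toLp 2) hw
    obtain ⟨z, hz, hzw⟩ := h₂.exists_plusMat (WithLp.toLp 2 w)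
    obtain ⟨y, hy, hyz⟩ := h₁.exists_minusMat (act (minusMat n) z)
    rw [← hzw, act_Wtilde_plusMat h₁ h₂ hy hz hyz, neg_one_smul, neg_inj] at hw'
    have : y = z := by
      refine sub_eq_zero.1 (eq_zero_of_plusMat_of_minusMat ?_ ?_)
      · rw [act_apply_sub, sub_eq_zero]; exact hw'
      · rw [act_apply_sub, sub_eq_zero]; exact hyz
    subst this
    exact ⟨y, ⟨hy, hz⟩, congrArg WithLp.ofLp hzw⟩
  · rintro ⟨y, hy, rfl⟩
    have := act_Wtilde_plusMat h₁ h₂ hy.1 hy.2 rfl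
    rw [neg_one_smul]
    exact congrArg WithLp.ofLp this

lemma tendsto_Wtilde {ι : Type*} {f : Filter ι} {L L' : ι → Submodule ℂ (C2n n)}
    (hL : ∀ᶠ i in f, IsLagrangian (L i)) (hL' : ∀ᶠ i in f, IsLagrangian (L' i))
    (h₁ : IsLagrangian ℓ₁) (h₂ : IsLagrangian ℓ₂)
    (h : Tendsto (fun i => proj (L i)) f (𝓝 (proj ℓ₁)))
    (h' : Tendsto (fun i => proj (L' i)) f (𝓝 (proj ℓ₂))) :
    Tendsto (fun i => Wtilde (L i) (L' i)) f (𝓝 (Wtilde ℓ₁ ℓ₂)) := by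
  rw [Wtilde_eq h₁ h₂]
  have h3 : Tendsto (fun i => -(cayley (L i) * (cayley (L' i))ᴴ)) f
      (𝓝 (-(cayley ℓ₁ * (cayley ℓ₂)ᴴ))) := by
    have := (tendsto_cayley h').star
    exact ((tendsto_cayley h).mul this).neg
  refine h3.congr' ?_
  filter_upwards [hL, hL'] with i h1 h2
  rw [Wtilde_eq h1 h2]

lemma PathTendsto.limSpace_eq {L : ℝ → Submodule ℂ (C2n n)} (h : PathTendsto L ℓ) :
    limSpace L = ℓ := by
  have hex : ∃ L', PathTendsto L L' := ⟨ℓ, h⟩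
  unfold limSpace
  rw [dif_pos hex]
  have h1 : proj hex.choose = proj ℓ := tendsto_nhds_unique hex.choose_spec h
  have h2 := congrArg (fun T : C2n n →L[ℂ] C2n n => LinearMap.range T.toLinearMap) h1
  simpa [proj] using h2

end Lagrangian

/-! ### The two components of `ℂ²ⁿ` -/

section Components

variable {n : ℕ}

/-- The first component of a vector in `ℂⁿ ⊕ ℂⁿ`. -/
noncomputable def up : C2n n →L[ℂ] Cn n :=
  LinearMap.toContinuousLinearMap
    { toFun := fun y => WithLp.toLp 2 fun i => y (Sum.inl i)
      map_add' := fun _ _ => rfl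
      map_smul' := fun _ _ => rfl }

/-- The second component of a vector in `ℂⁿ ⊕ ℂⁿ`. -/
noncomputable def low : C2n n →L[ℂ] Cn n :=
  LinearMap.toContinuousLinearMap
    { toFun := fun y => WithLp.toLp 2 fun i => y (Sum.inr i)
      map_add' := fun _ _ => rfl
      map_smul' := fun _ _ => rfl }

/-- The vector in `ℂⁿ ⊕ ℂⁿ` with the given components. -/
noncomputable def pair (u v : Cn n) : C2n n := WithLp.toLp 2 (Sum.elim u v)

@[simp] lemma up_apply (y : C2n n) (i : Fin n) : up y i = y (Sum.inl i) := rfl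
@[simp] lemma low_apply (y : C2n n) (i : Fin n) : low y i = y (Sum.inr i) := rfl
@[simp] lemma up_pair (u v : Cn n) : up (pair u v) = u := rfl
@[simp] lemma low_pair (u v : Cn n) : low (pair u v) = v := rfl

lemma ext_up_low {y z : C2n n} (h1 : up y = up z) (h2 : low y = low z) : y = z := by
  ext (i | i)
  · exact congrArg (fun v : Cn n => v i) h1
  · exact congrArg (fun v : Cn n => v i) h2

lemma inner_eq_up_low (y z : C2n n) :
    inner ℂ y z = inner ℂ (up y) (up z) + inner ℂ (low y) (low z) := by
  simp only [PiLp.inner_apply, Fintype.sum_sum_type, up_apply, low_apply]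

lemma norm_sq_eq_up_low (y : C2n n) : ‖y‖ ^ 2 = ‖up y‖ ^ 2 + ‖low y‖ ^ 2 := by
  have := congrArg Complex.re (inner_eq_up_low y y)
  simp only [Complex.add_re] at this
  simpa only [inner_self_eq_norm_sq, ← RCLike.re_eq_complex_re] using this

lemma norm_up_le (y : C2n n) : ‖up y‖ ≤ ‖y‖ := by
  refine le_of_sq_le_sq ?_ (norm_nonneg _)
  rw [norm_sq_eq_up_low]; nlinarith [sq_nonneg ‖low y‖]

lemma norm_low_le (y : C2n n) : ‖low y‖ ≤ ‖y‖ := by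
  refine le_of_sq_le_sq ?_ (norm_nonneg _)
  rw [norm_sq_eq_up_low y]; nlinarith [sq_nonneg ‖up y‖]

lemma up_act_fromBlocks (A B C D : Matrix (Fin n) (Fin n) ℂ) (y : C2n n) :
    up (act (Matrix.fromBlocks A B C D) y) = act A (up y) + act B (low y) := by
  ext i
  change (Matrix.fromBlocks A B C D).mulVec y.ofLp (Sum.inl i) = _
  rw [Matrix.fromBlocks_mulVec]
  rfl

lemma low_act_fromBlocks (A B C D : Matrix (Fin n) (Fin n) ℂ) (y : C2n n) :
    low (act (Matrix.fromBlocks A B C D) y) = act C (up y) + act D (low y) := by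
  ext i
  change (Matrix.fromBlocks A B C D).mulVec y.ofLp (Sum.inr i) = _
  rw [Matrix.fromBlocks_mulVec]
  rfl

lemma up_act_J (y : C2n n) : up (act (Matrix.J (Fin n) ℂ) y) = -low y := by
  rw [Matrix.J, up_act_fromBlocks, act_zero, act_neg, act_one, zero_add]

lemma low_act_J (y : C2n n) : low (act (Matrix.J (Fin n) ℂ) y) = up y := by
  rw [Matrix.J, low_act_fromBlocks, act_zero, act_one, add_zero]

/-- The matrix `[[0, B], [C, 0]]` as an operator, linearly in `(B, C)`. -/
noncomputable def offDiag : (Matrix (Fin n) (Fin n) ℂ × Matrix (Fin n) (Fin n) ℂ) →L[ℂ]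
    (C2n n →L[ℂ] C2n n) :=
  LinearMap.toContinuousLinearMap
    { toFun := fun p => Matrix.toEuclideanCLM (𝕜 := ℂ) (Matrix.fromBlocks 0 p.1 p.2 0)
      map_add' := fun p q => by
        rw [← map_add, Matrix.fromBlocks_add]; simp
      map_smul' := fun c p => by
        rw [RingHom.id_apply, ← map_smul, Matrix.fromBlocks_smul]; simp }

lemma up_offDiag (p : Matrix (Fin n) (Fin n) ℂ × Matrix (Fin n) (Fin n) ℂ) (y : C2n n) :
    up (offDiag p y) = act p.1 (low y) := by
  have : offDiag p y = act (Matrix.fromBlocks 0 p.1 p.2 0) y := rfl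
  rw [this, up_act_fromBlocks, act_zero, zero_add]

lemma low_offDiag (p : Matrix (Fin n) (Fin n) ℂ × Matrix (Fin n) (Fin n) ℂ) (y : C2n n) :
    low (offDiag p y) = act p.2 (up y) := by
  have : offDiag p y = act (Matrix.fromBlocks 0 p.1 p.2 0) y := rfl
  rw [this, low_act_fromBlocks, act_zero, add_zero]

/-- The operator of the Hermitian form `K |φ|² + 2 Re ⟪φ, ψ⟫`. -/
noncomputable def formOp (n : ℕ) (K : ℝ) : C2n n →L[ℂ] C2n n :=
  Matrix.toEuclideanCLM (𝕜 := ℂ) (Matrix.fromBlocks ((K : ℂ) • 1) 1 1 0)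

lemma up_formOp (K : ℝ) (y : C2n n) : up (formOp n K y) = (K : ℂ) • up y + low y := by
  have : formOp n K y = act (Matrix.fromBlocks ((K : ℂ) • 1) 1 1 0) y := rfl
  rw [this, up_act_fromBlocks, act_smul, act_one, act_one]

lemma low_formOp (K : ℝ) (y : C2n n) : low (formOp n K y) = up y := by
  have : formOp n K y = act (Matrix.fromBlocks ((K : ℂ) • 1) 1 1 0) y := rfl
  rw [this, low_act_fromBlocks, act_one, act_zero, add_zero]

lemma formOp_symm (K : ℝ) (y z : C2n n) :
    inner ℂ y (formOp n K z) = inner ℂ (formOp n K y) z := by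
  rw [inner_eq_up_low, inner_eq_up_low, up_formOp, low_formOp, up_formOp, low_formOp,
    inner_add_left, inner_add_right, inner_smul_left, inner_smul_right, Complex.conj_ofReal]
  ring

lemma re_inner_formOp (K : ℝ) (y : C2n n) :
    (inner ℂ y (formOp n K y)).re = K * ‖up y‖ ^ 2 + 2 * (inner ℂ (up y) (low y)).re := by
  rw [inner_eq_up_low, up_formOp, low_formOp, inner_add_right, inner_smul_right,
    ← inner_conj_symm (low y) (up y)]
  simp only [Complex.add_re, Complex.re_ofReal_mul, Complex.conj_re]
  have : (inner ℂ (up y) (up y)).re = ‖up y‖ ^ 2 := inner_self_eq_norm_sq (𝕜 := ℂ) (up y)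
  rw [this]; ring

lemma norm_act_le (A : Matrix (Fin n) (Fin n) ℂ) (v : Cn n) : ‖act A v‖ ≤ ‖A‖ * ‖v‖ := by
  rw [← toEuclideanCLM_eq_act, Matrix.l2_opNorm_def]
  exact ContinuousLinearMap.le_opNorm _ _

lemma norm_le_of_act_le {A : Matrix (Fin n) (Fin n) ℂ} {c : ℝ} (hc : 0 ≤ c)
    (h : ∀ v, ‖act A v‖ ≤ c * ‖v‖) : ‖A‖ ≤ c := by
  rw [Matrix.l2_opNorm_def]
  exact ContinuousLinearMap.opNorm_le_bound _ hc h

lemma abs_re_inner_act_le (A : Matrix (Fin n) (Fin n) ℂ) (v : Cn n) :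
    |(inner ℂ v (act A v)).re| ≤ ‖A‖ * ‖v‖ ^ 2 := by
  refine (Complex.abs_re_le_norm _).trans ((norm_inner_le_norm _ _).trans ?_)
  nlinarith [norm_act_le A v, norm_nonneg v]

end Components

/-! ### Positive definite matrices -/

section Coercive

variable {n : ℕ} {A B R : Matrix (Fin n) (Fin n) ℂ} {θ M r : ℝ}

/-- `A ≥ θ` in the sense of quadratic forms. -/
def Coercive (A : Matrix (Fin n) (Fin n) ℂ) (θ : ℝ) : Prop :=
  ∀ v : Cn n, θ * ‖v‖ ^ 2 ≤ (inner ℂ v (act A v)).re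

lemma Coercive.norm_le (h : Coercive A θ) (v : Cn n) : θ * ‖v‖ ≤ ‖act A v‖ := by
  rcases (norm_nonneg v).eq_or_lt with h0 | h0
  · rw [← h0, mul_zero]; exact norm_nonneg _
  · have h1 := (h v).trans ((Complex.re_le_norm _).trans (norm_inner_le_norm _ _))
    rw [sq, ← mul_assoc, mul_comm] at h1
    exact le_of_mul_le_mul_left h1 h0

lemma Coercive.isUnit_det (h : Coercive A θ) (hθ : 0 < θ) : IsUnit A.det := by
  refine isUnit_det_of_act_injective fun c hc => ?_
  have := h.norm_le c
  rw [hc, norm_zero] at this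
  exact norm_le_zero_iff.1 (le_of_mul_le_mul_left (by simpa using this) hθ)

lemma Coercive.act_act_inv (h : Coercive A θ) (hθ : 0 < θ) (v : Cn n) :
    act A (act A⁻¹ v) = v := by
  rw [← act_mul, Matrix.mul_nonsing_inv _ (h.isUnit_det hθ), act_one]

lemma Coercive.act_inv_act (h : Coercive A θ) (hθ : 0 < θ) (v : Cn n) :
    act A⁻¹ (act A v) = v := by
  rw [← act_mul, Matrix.nonsing_inv_mul _ (h.isUnit_det hθ), act_one]

lemma Coercive.norm_inv_le (h : Coercive A θ) (hθ : 0 < θ) : ‖A⁻¹‖ ≤ θ⁻¹ := by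
  refine norm_le_of_act_le (inv_nonneg.2 hθ.le) fun v => ?_
  have := h.norm_le (act A⁻¹ v)
  rw [h.act_act_inv hθ] at this
  rwa [inv_mul_eq_div, le_div_iff₀' hθ]

lemma Coercive.norm_inv_sub_inv_le (hA : Coercive A θ) (hB : Coercive B θ) (hθ : 0 < θ) :
    ‖A⁻¹ - B⁻¹‖ ≤ θ⁻¹ ^ 2 * ‖A - B‖ := by
  have h : A⁻¹ - B⁻¹ = A⁻¹ * (B - A) * B⁻¹ := by
    rw [mul_sub, sub_mul, Matrix.nonsing_inv_mul _ (hA.isUnit_det hθ), one_mul, mul_assoc,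
      Matrix.mul_nonsing_inv _ (hB.isUnit_det hθ), mul_one]
  rw [h]
  refine (norm_mul_le _ _).trans ?_
  have h1 := hA.norm_inv_le hθ
  have h2 := hB.norm_inv_le hθ
  have h3 := norm_mul_le A⁻¹ (B - A)
  rw [norm_sub_rev B A] at h3
  have h4 : 0 ≤ θ⁻¹ := inv_nonneg.2 hθ.le
  calc ‖A⁻¹ * (B - A)‖ * ‖B⁻¹‖ ≤ (‖A⁻¹‖ * ‖A - B‖) * ‖B⁻¹‖ := by gcongr
    _ ≤ (θ⁻¹ * ‖A - B‖) * θ⁻¹ := by gcongr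
    _ = _ := by ring

lemma Coercive.inv (h : Coercive A θ) (hθ : 0 < θ) (hM : ‖A‖ ≤ M) (hM0 : 0 < M) :
    Coercive A⁻¹ (θ / M ^ 2) := by
  intro v
  have h1 := h (act A⁻¹ v)
  rw [h.act_act_inv hθ] at h1
  have h2 : ‖v‖ ≤ M * ‖act A⁻¹ v‖ := by
    have := norm_act_le A (act A⁻¹ v)
    rw [h.act_act_inv hθ] at this
    exact this.trans (by gcongr)
  rw [← inner_conj_symm, Complex.conj_re]
  refine le_trans ?_ h1
  rw [div_mul_eq_mul_div, div_le_iff₀ (by positivity)]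
  have h3 : ‖v‖ ^ 2 ≤ (M * ‖act A⁻¹ v‖) ^ 2 := by gcongr
  nlinarith

/-- Half the right side is `⟪ψ, A⁻¹ψ⟫ + ⟪φ, Rφ⟫ + K Re⟪φ, A⁻¹ψ⟫` in real parts. The first two terms
are coercive, and a sufficiently positive `R` absorbs the cross term. This single estimate yields
every dichotomy below. -/
lemma Coercive.form_ge (hA : Coercive A θ) (hθ : 0 < θ) (hM : ‖A‖ ≤ M) (hM0 : 0 < M)
    (hR : Coercive R r) {K : ℝ} (hK : 0 ≤ K)
    (hr : θ / M ^ 2 / 2 + (K * θ⁻¹) ^ 2 / (2 * (θ / M ^ 2)) ≤ r) (y : C2n n) :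
    θ / M ^ 2 * ‖y‖ ^ 2 ≤ 2 * (inner ℂ (formOp n K y) (offDiag (A⁻¹, R) y)).re := by
  set p := θ / M ^ 2 with hp
  have hp0 : 0 < p := by positivity
  rw [inner_eq_up_low, up_formOp, low_formOp, up_offDiag, low_offDiag, inner_add_left,
    inner_smul_left, Complex.conj_ofReal, norm_sq_eq_up_low]
  simp only [Complex.add_re, Complex.re_ofReal_mul]
  have h1 := hA.inv hθ hM hM0 (low y)
  have h2 := hR (up y)
  have h3 : -(‖up y‖ * (θ⁻¹ * ‖low y‖)) ≤ (inner ℂ (up y) (act A⁻¹ (low y))).re := by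
    refine neg_le_of_abs_le ((Complex.abs_re_le_norm _).trans
      ((norm_inner_le_norm _ _).trans ?_))
    gcongr
    exact (norm_act_le _ _).trans (by gcongr; exact hA.norm_inv_le hθ)
  rw [← hp] at h1
  -- Young's inequality, weighted so that the cross term costs only half of the coercivity in `ψ`.
  have h4 : K * θ⁻¹ * (‖up y‖ * ‖low y‖) ≤
      p / 2 * ‖low y‖ ^ 2 + (K * θ⁻¹) ^ 2 / (2 * p) * ‖up y‖ ^ 2 := by
    have : 0 ≤ (p * ‖low y‖ - K * θ⁻¹ * ‖up y‖) ^ 2 / (2 * p) := by positivity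
    have h5 : (p * ‖low y‖ - K * θ⁻¹ * ‖up y‖) ^ 2 / (2 * p) =
      p / 2 * ‖low y‖ ^ 2 + (K * θ⁻¹) ^ 2 / (2 * p) * ‖up y‖ ^ 2
        - K * θ⁻¹ * (‖up y‖ * ‖low y‖) := by
      field_simp
      ring
    linarith
  have h6 := mul_le_mul_of_nonneg_left h3 hK
  have h7 := mul_le_mul_of_nonneg_right hr (sq_nonneg ‖up y‖)
  nlinarith

end Coercive

/-! ### Coefficients -/

section Coefficients

variable {n : ℕ}

/-- The coefficient matrix of the first order system for `(φ, P φ')`. -/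
noncomputable def coef (P V Q : ℝ → Matrix (Fin n) (Fin n) ℂ) (lam x : ℝ) : C2n n →L[ℂ] C2n n :=
  offDiag ((P x)⁻¹, V x - (lam : ℂ) • Q x)

/-- Coefficients for which the standing assumptions hold everywhere on the real line. -/
structure Regular (P V Q : ℝ → Matrix (Fin n) (Fin n) ℂ) (Pp Vp Qp : Matrix (Fin n) (Fin n) ℂ)
    (θ C η : ℝ) : Prop where
  θ_pos : 0 < θ
  C_nonneg : 0 ≤ C
  η_pos : 0 < η
  contP : Continuous P
  measV : AEStronglyMeasurable V volume
  measQ : AEStronglyMeasurable Q volume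
  hermP : ∀ x, (P x).IsHermitian
  hermV : ∀ x, (V x).IsHermitian
  hermQ : ∀ x, (Q x).IsHermitian
  coerciveP : ∀ x, Coercive (P x) θ
  coerciveQ : ∀ x, Coercive (Q x) θ
  decayP : ∀ x, ‖P x - Pp‖ ≤ C * Real.exp (-η * max x 0)
  decayV : ∀ x, ‖V x - Vp‖ ≤ C * Real.exp (-η * max x 0)
  decayQ : ∀ x, ‖Q x - Qp‖ ≤ C * Real.exp (-η * max x 0)
  hermPp : Pp.IsHermitian
  hermVp : Vp.IsHermitian
  hermQp : Qp.IsHermitian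
  coercivePp : Coercive Pp θ
  coerciveQp : Coercive Qp θ

variable {P V Q : ℝ → Matrix (Fin n) (Fin n) ℂ} {Pp Vp Qp : Matrix (Fin n) (Fin n) ℂ}
  {θ C η : ℝ}

lemma kappa_mul_le (hθ : 0 < θ) (hQ : Coercive Qp θ) (v : Cn n) :
    kappa Vp Qp * (inner ℂ v (act Qp v)).re ≤ (inner ℂ v (act Vp v)).re := by
  by_cases hv : v = 0
  · simp [hv]
  have hpos : ∀ r : Cn n, r ≠ 0 → 0 < (inner ℂ r (act Qp r)).re := fun r hr =>
    lt_of_lt_of_le (by have := norm_pos_iff.2 hr; positivity) (hQ r)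
  rw [← le_div_iff₀ (hpos v hv)]
  -- A lower bound for the quotients must be exhibited, since a real infimum over a set unbounded
  -- below has the default value `0`.
  refine ciInf_le (f := fun r : {r : Cn n // r ≠ 0} =>
    (inner ℂ r.1 (act Vp r.1)).re / (inner ℂ r.1 (act Qp r.1)).re) ⟨-(‖Vp‖ / θ), ?_⟩ ⟨v, hv⟩
  rintro _ ⟨r, rfl⟩
  have h1 := (neg_le_of_abs_le (abs_re_inner_act_le Vp r.1))
  have h2 := hQ r.1
  simp only
  rw [le_div_iff₀ (hpos _ r.2)]
  have h3 : ‖Vp‖ * ‖r.1‖ ^ 2 ≤ ‖Vp‖ / θ * (inner ℂ r.1 (act Qp r.1)).re := by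
    rw [div_mul_eq_mul_div, le_div_iff₀ hθ, mul_assoc, mul_comm _ θ]
    gcongr
  linarith

lemma norm_le_add {A B : Matrix (Fin n) (Fin n) ℂ} {c η x : ℝ} (hc : 0 ≤ c) (hη : 0 < η)
    (h : ‖A - B‖ ≤ c * Real.exp (-η * max x 0)) : ‖A‖ ≤ ‖B‖ + c := by
  have h1 : Real.exp (-η * max x 0) ≤ 1 := by
    rw [Real.exp_le_one_iff]
    nlinarith [le_max_right x 0]
  have h2 : ‖A‖ ≤ ‖B‖ + ‖A - B‖ := by
    simpa using norm_add_le B (A - B)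
  nlinarith

lemma re_inner_act_sub_smul (A B : Matrix (Fin n) (Fin n) ℂ) (lam : ℝ) (v : Cn n) :
    (inner ℂ v (act (A - (lam : ℂ) • B) v)).re =
      (inner ℂ v (act A v)).re - lam * (inner ℂ v (act B v)).re := by
  rw [act_sub, act_smul, inner_sub_right, inner_smul_right, Complex.sub_re, Complex.re_ofReal_mul]

lemma Dichotomy.mono {E : Type*} [NormedAddCommGroup E] [InnerProductSpace ℂ E]
    {A : ℝ → E →L[ℂ] E} {S : E →L[ℂ] E} {c c' x₀ x₁ : ℝ} (h : Dichotomy A S c x₀) (hc : 0 < c')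
    (hcc : c' ≤ c) (hx : x₀ ≤ x₁) : Dichotomy A S c' x₁ :=
  ⟨h.symm, hc, h.nonneg.trans hx, fun x hx' v =>
    (mul_le_mul_of_nonneg_right hcc (sq_nonneg _)).trans (h.le x (hx.trans hx') v)⟩

namespace Regular

variable (h : Regular P V Q Pp Vp Qp θ C η)
include h

/-- The limiting system with constant coefficients satisfies the same assumptions, so every result
below also covers the asymptotic space. -/
lemma const : Regular (fun _ => Pp) (fun _ => Vp) (fun _ => Qp) Pp Vp Qp θ C η where
  θ_pos := h.θ_pos
  C_nonneg := h.C_nonneg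
  η_pos := h.η_pos
  contP := continuous_const
  measV := aestronglyMeasurable_const
  measQ := aestronglyMeasurable_const
  hermP _ := h.hermPp
  hermV _ := h.hermVp
  hermQ _ := h.hermQp
  coerciveP _ := h.coercivePp
  coerciveQ _ := h.coerciveQp
  decayP x := by rw [sub_self, norm_zero]; have := h.C_nonneg; positivity
  decayV x := by rw [sub_self, norm_zero]; have := h.C_nonneg; positivity
  decayQ x := by rw [sub_self, norm_zero]; have := h.C_nonneg; positivity
  hermPp := h.hermPp
  hermVp := h.hermVp
  hermQp := h.hermQp
  coercivePp := h.coercivePp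
  coerciveQp := h.coerciveQp

lemma norm_P_le (x : ℝ) : ‖P x‖ ≤ ‖Pp‖ + C := norm_le_add h.C_nonneg h.η_pos (h.decayP x)
lemma norm_V_le (x : ℝ) : ‖V x‖ ≤ ‖Vp‖ + C := norm_le_add h.C_nonneg h.η_pos (h.decayV x)
lemma norm_Q_le (x : ℝ) : ‖Q x‖ ≤ ‖Qp‖ + C := norm_le_add h.C_nonneg h.η_pos (h.decayQ x)

lemma continuous_inv : Continuous fun x => (P x)⁻¹ := by
  refine continuous_iff_continuousAt.2 fun x => ?_
  rw [ContinuousAt, tendsto_iff_norm_sub_tendsto_zero]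
  have h1 : Tendsto (fun y => θ⁻¹ ^ 2 * ‖P y - P x‖) (𝓝 x) (𝓝 (θ⁻¹ ^ 2 * 0)) :=
    ((tendsto_iff_norm_sub_tendsto_zero.1 h.contP.continuousAt)).const_mul _
  rw [mul_zero] at h1
  exact squeeze_zero (fun _ => norm_nonneg _)
    (fun y => (h.coerciveP y).norm_inv_sub_inv_le (h.coerciveP x) h.θ_pos) h1

lemma exists_bddCoef (Λ : ℝ) : ∃ M, ∀ lam : ℝ, |lam| ≤ Λ → BddCoef (coef P V Q lam) M := by
  refine ⟨‖offDiag (n := n)‖ * (θ⁻¹ + ((‖Vp‖ + C) + Λ * (‖Qp‖ + C))), fun lam hlam => ⟨?_, ?_⟩⟩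
  · exact (offDiag (n := n)).continuous.comp_aestronglyMeasurable
      (h.continuous_inv.aestronglyMeasurable.prodMk (h.measV.sub (h.measQ.const_smul (lam : ℂ))))
  · intro x
    refine ((offDiag (n := n)).le_opNorm _).trans ?_
    gcongr
    have h1 := (h.coerciveP x).norm_inv_le h.θ_pos
    have h2 : ‖V x - (lam : ℂ) • Q x‖ ≤ (‖Vp‖ + C) + Λ * (‖Qp‖ + C) := by
      refine (norm_sub_le _ _).trans (add_le_add (h.norm_V_le x) ?_)
      rw [norm_smul, Complex.norm_real, Real.norm_eq_abs]
      have h3 := (abs_nonneg lam).trans hlam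
      gcongr
      exact h.norm_Q_le x
    have h3 : 0 ≤ θ⁻¹ := inv_nonneg.2 h.θ_pos.le
    have h4 := (norm_nonneg _).trans h2
    rw [Prod.norm_def]
    exact max_le (h1.trans (by linarith)) (h2.trans (by linarith))

lemma norm_coef_sub_le (lam mu x : ℝ) :
    ‖coef P V Q lam x - coef P V Q mu x‖ ≤ ‖offDiag (n := n)‖ * (|lam - mu| * (‖Qp‖ + C)) := by
  unfold coef
  rw [← map_sub]
  refine ((offDiag (n := n)).le_opNorm _).trans ?_
  gcongr
  have h1 : V x - (lam : ℂ) • Q x - (V x - (mu : ℂ) • Q x) = -((lam - mu : ℝ) : ℂ) • Q x := by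
    push_cast; rw [neg_smul, sub_smul]; abel
  rw [Prod.mk_sub_mk, Prod.norm_def, sub_self, norm_zero, h1, norm_smul, norm_neg,
    Complex.norm_real, Real.norm_eq_abs, max_eq_right (by positivity)]
  gcongr
  exact h.norm_Q_le x

lemma norm_coef_sub_plus_le (lam : ℝ) {x : ℝ} (hx : 0 ≤ x) :
    ‖coef P V Q lam x - coef (fun _ => Pp) (fun _ => Vp) (fun _ => Qp) lam x‖ ≤
      ‖offDiag (n := n)‖ * ((θ⁻¹ ^ 2 + 1 + |lam|) * (C * Real.exp (-η * x))) := by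
  unfold coef
  rw [← map_sub]
  refine ((offDiag (n := n)).le_opNorm _).trans ?_
  gcongr
  have e1 := h.decayP x
  have e2 := h.decayV x
  have e3 := h.decayQ x
  rw [max_eq_left hx] at e1 e2 e3
  set d := C * Real.exp (-η * x)
  have hd : 0 ≤ d := (norm_nonneg _).trans e1
  have h1 : ‖(P x)⁻¹ - Pp⁻¹‖ ≤ θ⁻¹ ^ 2 * d :=
    ((h.coerciveP x).norm_inv_sub_inv_le h.coercivePp h.θ_pos).trans (by gcongr)
  have h2 : ‖V x - (lam : ℂ) • Q x - (Vp - (lam : ℂ) • Qp)‖ ≤ d + |lam| * d := by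
    have : V x - (lam : ℂ) • Q x - (Vp - (lam : ℂ) • Qp) =
        (V x - Vp) - (lam : ℂ) • (Q x - Qp) := by rw [smul_sub]; abel
    rw [this]
    refine (norm_sub_le _ _).trans ?_
    rw [norm_smul, Complex.norm_real, Real.norm_eq_abs]
    gcongr
  rw [Prod.mk_sub_mk, Prod.norm_def]
  have h3 : 0 ≤ θ⁻¹ ^ 2 * d := by positivity
  have h4 : 0 ≤ |lam| * d := by positivity
  exact max_le (h1.trans (by nlinarith)) (h2.trans (by nlinarith))

/-- At infinity `V₊ - λ₁Q₊ ≥ (κ - λ₁)Q₊ ≥ 2r`; far out the exponentially small errors consume at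
most half of this, and decreasing `λ` only helps because `Q` is positive. The constants are thus
common to all `λ ≤ λ₁`. -/
lemma exists_dichotomy_of_lt_kappa {lam₁ : ℝ} (hl : lam₁ < kappa Vp Qp) :
    ∃ c x₀, 0 < c ∧ ∀ lam ≤ lam₁, Dichotomy (coef P V Q lam) (formOp n 0) c x₀ := by
  set r := (kappa Vp Qp - lam₁) * θ / 2 with hr
  have hr0 : 0 < r := by have := sub_pos.2 hl; have := h.θ_pos; positivity
  have hdec : Tendsto (fun x => (1 + |lam₁|) * (C * Real.exp (-η * x))) atTop (𝓝 0) := by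
    have h1 : Tendsto (fun x => Real.exp (-η * x)) atTop (𝓝 0) :=
      Real.tendsto_exp_atBot.comp (tendsto_id.const_mul_atTop_of_neg (neg_lt_zero.2 h.η_pos))
    simpa using (h1.const_mul C).const_mul (1 + |lam₁|)
  obtain ⟨x₁, hx₁⟩ := eventually_atTop.1 (hdec.eventually (eventually_le_nhds hr0))
  -- The term `θ / (2r)` is added so that `θ / M² / 2 ≤ r`, which is the condition of
  -- `Coercive.form_ge` for `K = 0`.
  set M := ‖Pp‖ + C + 1 + θ / (2 * r) with hM
  have hθ := h.θ_pos
  have hC := h.C_nonneg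
  have hM1 : 1 ≤ M := by have : 0 ≤ θ / (2 * r) := by positivity
                         linarith [norm_nonneg Pp]
  have hM0 : 0 < M := by linarith
  refine ⟨θ / M ^ 2, max x₁ 0, by positivity, fun lam hlam => ⟨formOp_symm 0, by positivity,
    le_max_right _ _, fun x hx y => ?_⟩⟩
  refine (h.coerciveP x).form_ge hθ ((h.norm_P_le x).trans ?_) hM0 (r := r) ?_ le_rfl ?_ y
  · have : 0 ≤ θ / (2 * r) := by positivity
    linarith
  · intro v
    rw [re_inner_act_sub_smul]
    have hx0 := (le_max_right x₁ 0).trans hx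
    have hd := hx₁ x ((le_max_left _ _).trans hx)
    have e2 := h.decayV x
    have e3 := h.decayQ x
    rw [max_eq_left hx0] at e2 e3
    set d := C * Real.exp (-η * x)
    have f1 := kappa_mul_le (Vp := Vp) hθ h.coerciveQp v
    have f2 := h.coerciveQp v
    have f3 := neg_le_of_abs_le (abs_re_inner_act_le (V x - Vp) v)
    have f4 := abs_re_inner_act_le (Q x - Qp) v
    have f5 := h.coerciveQ x v
    rw [act_sub, inner_sub_right, Complex.sub_re] at f3 f4
    set a := (inner ℂ v (act (V x) v)).re
    set a' := (inner ℂ v (act Vp v)).re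
    set b := (inner ℂ v (act (Q x) v)).re
    set b' := (inner ℂ v (act Qp v)).re
    have hb : 0 ≤ b := (by positivity : (0:ℝ) ≤ θ * ‖v‖ ^ 2).trans f5
    have g1 : lam * b ≤ lam₁ * b := mul_le_mul_of_nonneg_right hlam hb
    have g2 : lam₁ * (b - b') ≤ |lam₁| * (d * ‖v‖ ^ 2) := by
      refine (le_abs_self _).trans ?_
      rw [abs_mul]
      gcongr
      exact f4.trans (by gcongr)
    have g3 : ‖V x - Vp‖ * ‖v‖ ^ 2 ≤ d * ‖v‖ ^ 2 := by gcongr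
    have g4 : (kappa Vp Qp - lam₁) * (θ * ‖v‖ ^ 2) ≤ (kappa Vp Qp - lam₁) * b' :=
      mul_le_mul_of_nonneg_left f2 (sub_pos.2 hl).le
    have g5 := mul_le_mul_of_nonneg_right hd (sq_nonneg ‖v‖)
    have g6 : (kappa Vp Qp - lam₁) * (θ * ‖v‖ ^ 2) = 2 * (r * ‖v‖ ^ 2) := by rw [hr]; ring
    nlinarith
  · rw [zero_mul, zero_pow two_ne_zero, zero_div, add_zero, div_div, div_le_iff₀ (by positivity)]
    have h1 : θ / (2 * r) ≤ M := by linarith [norm_nonneg Pp]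
    rw [div_le_iff₀ (by positivity)] at h1
    nlinarith

/-- For very negative `λ` the term `-λQ` dominates the bounded `V` on the whole half-line, so
monotonicity starts at `0` and a positive `K` is affordable. -/
lemma exists_dichotomy_of_le {K : ℝ} (hK : 0 ≤ K) :
    ∃ c Λ, ∀ lam ≤ Λ, Dichotomy (coef P V Q lam) (formOp n K) c 0 := by
  have hθ := h.θ_pos
  have hC := h.C_nonneg
  set M := ‖Pp‖ + C + 1 with hM
  have hM0 : 0 < M := by positivity
  set r := θ / M ^ 2 / 2 + (K * θ⁻¹) ^ 2 / (2 * (θ / M ^ 2)) with hr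
  have hr0 : 0 ≤ r := by positivity
  refine ⟨θ / M ^ 2, -((r + (‖Vp‖ + C)) / θ), fun lam hlam => ⟨formOp_symm K, by positivity,
    le_rfl, fun x hx y => ?_⟩⟩
  refine (h.coerciveP x).form_ge hθ ((h.norm_P_le x).trans (by linarith)) hM0 ?_ hK
    hr.symm.le y
  intro v
  rw [re_inner_act_sub_smul]
  have f3 := neg_le_of_abs_le (abs_re_inner_act_le (V x) v)
  have f4 : ‖V x‖ * ‖v‖ ^ 2 ≤ (‖Vp‖ + C) * ‖v‖ ^ 2 := by gcongr; exact h.norm_V_le x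
  have f5 := h.coerciveQ x v
  have hl : r + (‖Vp‖ + C) ≤ -lam * θ := by rw [← div_le_iff₀ hθ]; linarith
  have hl0 : 0 ≤ -lam := by
    have : 0 ≤ (r + (‖Vp‖ + C)) / θ := by positivity
    linarith
  have f6 := mul_le_mul_of_nonneg_left f5 hl0
  have f7 := mul_le_mul_of_nonneg_right hl (sq_nonneg ‖v‖)
  nlinarith

end Regular

end Coefficients

/-! ### Correcting the coefficients on a null set -/

section Regularize

variable {n : ℕ}

lemma neBot_inf_ae {l : Filter ℝ} (h : ∀ s ∈ l, volume (s ∩ Ioi 0) ≠ 0) :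
    (l ⊓ ae (volume.restrict (Ioi (0 : ℝ)))).NeBot := by
  rw [inf_neBot_iff]
  intro s hs t ht
  rw [mem_ae_iff, Measure.restrict_apply' measurableSet_Ioi] at ht
  by_contra hne
  rw [not_nonempty_iff_eq_empty] at hne
  have hsub : s ∩ Ioi 0 ⊆ tᶜ ∩ Ioi 0 := by
    refine fun x hx => ⟨fun hxt => ?_, hx.2⟩
    have : x ∈ s ∩ t := ⟨hx.1, hxt⟩
    rw [hne] at this
    exact this
  exact h s hs (measure_mono_null hsub ht)

/-- Every right neighbourhood of `x` has positive measure, so a closed condition on a continuous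
function passes from almost every point to every point. -/
lemma mem_of_continuousOn_of_ae {X : Type*} [TopologicalSpace X] {f : ℝ → X} {s : Set X}
    (hs : IsClosed s) (hf : ContinuousOn f (Ici 0))
    (h : ∀ᵐ x ∂(volume.restrict (Ioi (0 : ℝ))), f x ∈ s) {x : ℝ} (hx : 0 ≤ x) : f x ∈ s := by
  have : (𝓝[>] x ⊓ ae (volume.restrict (Ioi (0 : ℝ)))).NeBot := by
    refine neBot_inf_ae fun t ht h0 => ?_
    obtain ⟨u, hu, hut⟩ := mem_nhdsGT_iff_exists_Ioo_subset.1 ht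
    have hsub : Ioo x u ⊆ t ∩ Ioi 0 := fun z hz => ⟨hut hz, hx.trans_lt hz.1⟩
    have h1 : volume (Ioo x u) = 0 := measure_mono_null hsub h0
    rw [Real.volume_Ioo, ENNReal.ofReal_eq_zero] at h1
    have : x < u := hu
    linarith
  have h1 : Tendsto f (𝓝[>] x ⊓ ae (volume.restrict (Ioi (0 : ℝ)))) (𝓝 (f x)) :=
    ((hf x hx).mono (fun z hz => hx.trans (le_of_lt hz))).mono_left inf_le_left
  exact hs.mem_of_tendsto h1 (h.filter_mono inf_le_right)

lemma mem_of_tendsto_of_ae {X : Type*} [TopologicalSpace X] {f : ℝ → X} {s : Set X} {a : X}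
    (hs : IsClosed s) (hf : Tendsto f (atTop ⊓ ae (volume.restrict (Ioi (0 : ℝ)))) (𝓝 a))
    (h : ∀ᵐ x ∂(volume.restrict (Ioi (0 : ℝ))), f x ∈ s) : a ∈ s := by
  have : (atTop ⊓ ae (volume.restrict (Ioi (0 : ℝ)))).NeBot := by
    refine neBot_inf_ae fun t ht h0 => ?_
    obtain ⟨u, hu⟩ := mem_atTop_sets.1 ht
    have hsub : Ioi (max u 0) ⊆ t ∩ Ioi 0 := fun z hz =>
      ⟨hu z ((le_max_left _ _).trans (le_of_lt hz)), (le_max_right u 0).trans_lt hz⟩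
    have h1 : volume (Ioi (max u 0)) = 0 := measure_mono_null hsub h0
    rw [Real.volume_Ioi] at h1
    exact ENNReal.top_ne_zero h1
  exact hs.mem_of_tendsto hf (h.filter_mono inf_le_right)

lemma isClosed_coercive (θ : ℝ) : IsClosed {A : Matrix (Fin n) (Fin n) ℂ | Coercive A θ} := by
  have hc : ∀ v : Cn n, Continuous fun A : Matrix (Fin n) (Fin n) ℂ => act A v := fun v =>
    LinearMap.continuous_of_finiteDimensional
      { toFun := fun A : Matrix (Fin n) (Fin n) ℂ => act A v
        map_add' := fun A B => act_add A B v
        map_smul' := fun c A => act_smul c A v }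
  simp only [Coercive, ofPred_forall]
  exact isClosed_iInter fun v => isClosed_le continuous_const
    (Complex.continuous_re.comp (continuous_const.inner (hc v)))

lemma isClosed_isHermitian : IsClosed {A : Matrix (Fin n) (Fin n) ℂ | A.IsHermitian} :=
  isClosed_eq continuous_star continuous_id

variable {P V Q : ℝ → Matrix (Fin n) (Fin n) ℂ} {Pp Vp Qp : Matrix (Fin n) (Fin n) ℂ}

/-- Solutions depend on `V` and `Q` only almost everywhere, so these are replaced by their limits
outside a good measurable set. `P` is continuous and inherits its bounds at every point of the
half-line. Afterwards no null sets need to be tracked in the estimates. -/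
theorem exists_regular (h1 : AssumptionA1 P V Q) (h2 : AssumptionA2 P V Q Pp Vp Qp) :
    ∃ (P' V' Q' : ℝ → Matrix (Fin n) (Fin n) ℂ) (θ C η : ℝ), Regular P' V' Q' Pp Vp Qp θ C η ∧
      (∀ x, 0 ≤ x → P' x = P x) ∧
      ∀ᵐ x ∂(volume.restrict (Ioi (0 : ℝ))), V' x = V x ∧ Q' x = Q x := by
  obtain ⟨θP, θQ, CV, hθP, hθQ, -, hb⟩ := h1.bounds
  obtain ⟨C, η, hη, hd⟩ := h2.decay
  have hs : ∀ᵐ x ∂(volume.restrict (Ioi (0 : ℝ))),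
      (P x).IsHermitian ∧ (V x).IsHermitian ∧ (Q x).IsHermitian := by
    rw [restrict_Ioi_eq_restrict_Ici]; exact h1.selfAdjoint
  set θ := min θP θQ with hθdef
  have hθ : 0 < θ := lt_min hθP hθQ
  have hcont : ContinuousOn P (Ici 0) := ACLoc.continuousOn h1.acP
  have hPco : ∀ᵐ x ∂(volume.restrict (Ioi (0 : ℝ))), Coercive (P x) θ := by
    filter_upwards [hb] with x hx v
    exact (mul_le_mul_of_nonneg_right (min_le_left _ _) (sq_nonneg _)).trans (hx v).1
  have hQco : ∀ᵐ x ∂(volume.restrict (Ioi (0 : ℝ))), Coercive (Q x) θ := by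
    filter_upwards [hb] with x hx v
    exact (mul_le_mul_of_nonneg_right (min_le_right _ _) (sq_nonneg _)).trans (hx v).2.1
  have hexp : Tendsto (fun x => C * Real.exp (-η * x)) atTop (𝓝 0) := by
    have h1 : Tendsto (fun x => Real.exp (-η * x)) atTop (𝓝 0) :=
      Real.tendsto_exp_atBot.comp (tendsto_id.const_mul_atTop_of_neg (neg_lt_zero.2 hη))
    simpa using h1.const_mul C
  have hlim : ∀ {F : ℝ → Matrix (Fin n) (Fin n) ℂ} {L : Matrix (Fin n) (Fin n) ℂ},
      (∀ᵐ x ∂(volume.restrict (Ioi (0 : ℝ))), ‖F x - L‖ ≤ C * Real.exp (-η * x)) →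
      Tendsto F (atTop ⊓ ae (volume.restrict (Ioi (0 : ℝ)))) (𝓝 L) := by
    intro F L hF
    rw [tendsto_iff_norm_sub_tendsto_zero]
    exact squeeze_zero' (Eventually.of_forall fun _ => norm_nonneg _)
      (hF.filter_mono inf_le_right) (hexp.mono_left inf_le_left)
  -- The endstates inherit the coercivity constant of the coefficients, so one `θ` serves both
  -- systems.
  have hPp : Coercive Pp θ :=
    mem_of_tendsto_of_ae (isClosed_coercive θ) (hlim (hd.mono fun x hx => hx.1)) hPco
  have hQp : Coercive Qp θ :=
    mem_of_tendsto_of_ae (isClosed_coercive θ) (hlim (hd.mono fun x hx => hx.2.2.1)) hQco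
  obtain ⟨G, hG, hGm, hGp⟩ := ((hs.and hQco).and hd).exists_measurable_mem
  have hGpos : ∀ᵐ x ∂(volume.restrict (Ioi (0 : ℝ))), x ∈ G ∩ Ioi 0 :=
    (show ∀ᵐ x ∂(volume.restrict (Ioi (0 : ℝ))), x ∈ G from hG).and
      (ae_restrict_mem measurableSet_Ioi)
  have hm : MeasurableSet (G ∩ Ioi (0 : ℝ)) := hGm.inter measurableSet_Ioi
  set mod : (ℝ → Matrix (Fin n) (Fin n) ℂ) → Matrix (Fin n) (Fin n) ℂ →
      ℝ → Matrix (Fin n) (Fin n) ℂ :=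
    fun F L x => L + (G ∩ Ioi 0).indicator (fun x => F x - L) x with hmod
  have hin : ∀ F L x, x ∈ G ∩ Ioi 0 → mod F L x = F x := fun F L x hx => by
    simp only [hmod, indicator_of_mem hx]; abel
  have hout : ∀ F L x, x ∉ G ∩ Ioi 0 → mod F L x = L := fun F L x hx => by
    simp only [hmod, indicator_of_notMem hx, add_zero]
  have hmeas : ∀ {F : ℝ → Matrix (Fin n) (Fin n) ℂ} (L : Matrix (Fin n) (Fin n) ℂ),
      LocallyIntegrableOn F (Ici 0) → AEStronglyMeasurable (mod F L) volume := fun {F} L hF => by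
    refine aestronglyMeasurable_const.add ((aestronglyMeasurable_indicator_iff hm).2 ?_)
    have hsub : G ∩ Ioi (0 : ℝ) ⊆ Ici 0 := fun x hx => mem_Ici.2 (le_of_lt hx.2)
    exact (hF.aestronglyMeasurable.mono_measure
      (Measure.restrict_mono hsub le_rfl)).sub aestronglyMeasurable_const
  have hdecay : ∀ {F : ℝ → Matrix (Fin n) (Fin n) ℂ} {L : Matrix (Fin n) (Fin n) ℂ},
      (∀ x ∈ G, ‖F x - L‖ ≤ C * Real.exp (-η * x)) →
      ∀ x, ‖mod F L x - L‖ ≤ |C| * Real.exp (-η * max x 0) := by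
    intro F L hF x
    by_cases hx : x ∈ G ∩ Ioi 0
    · rw [hin F L x hx, max_eq_left (le_of_lt hx.2)]
      exact (hF x hx.1).trans (by gcongr; exact le_abs_self C)
    · rw [hout F L x hx, sub_self, norm_zero]; positivity
  refine ⟨fun x => P (max x 0), mod V Vp, mod Q Qp, θ, |C|, η,
    { θ_pos := hθ, C_nonneg := abs_nonneg C, η_pos := hη
      contP := hcont.comp_continuous (continuous_id.max continuous_const) fun x => mem_Ici.2 (le_max_right x 0)
      measV := hmeas Vp h1.locIntV
      measQ := hmeas Qp h1.locIntQ
      hermP := fun x => mem_of_continuousOn_of_ae isClosed_isHermitian hcont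
        (hs.mono fun x hx => hx.1) (le_max_right x 0)
      hermV := fun x => ?_
      hermQ := fun x => ?_
      coerciveP := fun x => mem_of_continuousOn_of_ae (isClosed_coercive θ) hcont hPco
        (le_max_right x 0)
      coerciveQ := fun x => ?_
      decayP := fun x => ?_
      decayV := hdecay fun x hx => (hGp x hx).2.2.1
      decayQ := hdecay fun x hx => (hGp x hx).2.2.2.1
      hermPp := h2.posDefP.1
      hermVp := h2.selfAdjointV
      hermQp := h2.posDefQ.1
      coercivePp := hPp
      coerciveQp := hQp }, fun x hx => by simp only [max_eq_left hx], ?_⟩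
  · by_cases hx : x ∈ G ∩ Ioi 0
    · rw [hin _ _ x hx]; exact (hGp x hx.1).1.1.2.1
    · rw [hout _ _ x hx]; exact h2.selfAdjointV
  · by_cases hx : x ∈ G ∩ Ioi 0
    · rw [hin _ _ x hx]; exact (hGp x hx.1).1.1.2.2
    · rw [hout _ _ x hx]; exact h2.posDefQ.1
  · by_cases hx : x ∈ G ∩ Ioi 0
    · rw [hin _ _ x hx]; exact (hGp x hx.1).1.2
    · rw [hout _ _ x hx]; exact hQp
  · have h3 : ∀ z, 0 ≤ z → (‖P z - Pp‖ - |C| * Real.exp (-η * z)) ∈ Iic (0 : ℝ) := by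
      intro z hz
      have he : Continuous fun z => |C| * Real.exp (-η * z) := by fun_prop
      refine mem_of_continuousOn_of_ae isClosed_Iic
        ((hcont.sub continuousOn_const).norm.sub he.continuousOn) ?_ hz
      filter_upwards [hd] with t ht
      refine mem_Iic.2 (sub_nonpos.2 ?_)
      exact ht.1.trans (mul_le_mul_of_nonneg_right (le_abs_self C) (Real.exp_pos _).le)
    exact sub_nonpos.1 (h3 _ (le_max_right x 0))
  · filter_upwards [hGpos] with x hx
    exact ⟨hin _ _ x hx, hin _ _ x hx⟩

end Regularize

/-! ### The spaces of initial values of square integrable solutions -/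

section Stable

variable {n : ℕ}

/-- The values at `x` of the square integrable solutions. -/
noncomputable def stab (P V Q : ℝ → Matrix (Fin n) (Fin n) ℂ) (x lam : ℝ) :
    Submodule ℂ (C2n n) :=
  stableSpace fun s => coef P V Q lam (x + s)

variable {P V Q P' V' Q' : ℝ → Matrix (Fin n) (Fin n) ℂ} {Pp Vp Qp : Matrix (Fin n) (Fin n) ℂ}
  {θ C η lam mu : ℝ}

lemma act_J_eq_act_bMatrix_iff {x : ℝ} {y w : C2n n} :
    act (Matrix.J (Fin n) ℂ) w = act (bMatrix P V Q x lam) y ↔ w = coef P V Q lam x y := by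
  have h1 : up (act (bMatrix P V Q x lam) y) = -act (V x - (lam : ℂ) • Q x) (up y) := by
    rw [bMatrix, up_act_fromBlocks, act_zero, add_zero, ← act_neg, neg_sub]
  have h2 : low (act (bMatrix P V Q x lam) y) = act (P x)⁻¹ (low y) := by
    rw [bMatrix, low_act_fromBlocks, act_zero, zero_add]
  have h3 : up (coef P V Q lam x y) = act (P x)⁻¹ (low y) := up_offDiag _ _
  have h4 : low (coef P V Q lam x y) = act (V x - (lam : ℂ) • Q x) (up y) := low_offDiag _ _
  constructor
  · intro h
    refine ext_up_low ?_ ?_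
    · rw [h3, ← h2, ← h, low_act_J]
    · rw [h4, ← neg_inj, ← h1, ← h, up_act_J]
  · rintro rfl
    refine ext_up_low ?_ ?_
    · rw [up_act_J, h1, h4]
    · rw [low_act_J, h2, h3]

namespace Regular

variable (h : Regular P V Q Pp Vp Qp θ C η)
include h

lemma bddCoef (lam : ℝ) : ∃ M, BddCoef (coef P V Q lam) M :=
  (h.exists_bddCoef |lam|).imp fun _ hM => hM lam le_rfl

lemma isSolution_iff (hP : ∀ x, 0 ≤ x → P x = P' x)
    (hVQ : ∀ᵐ x ∂(volume.restrict (Ioi (0 : ℝ))), V x = V' x ∧ Q x = Q' x) {y : ℝ → C2n n} :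
    IsSolution P' V' Q' lam y ↔ IsSol (coef P V Q lam) y := by
  obtain ⟨M, hA⟩ := h.bddCoef lam
  rw [ae_restrict_iff' measurableSet_Ioi] at hVQ
  have hco : ∀ᵐ x, 0 < x → coef P V Q lam x = coef P' V' Q' lam x := by
    filter_upwards [hVQ] with x hx hx0
    rw [coef, coef, (hx hx0).1, (hx hx0).2, hP x (le_of_lt hx0)]
  constructor
  · rintro ⟨hac, hy⟩
    rw [ae_restrict_iff' measurableSet_Ioi] at hy
    refine IsSol.of_ac hA hac ?_
    filter_upwards [hy, hco, hac.ae_differentiableAt] with x h1 h2 h3 hx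
    rw [h2 hx, ← act_J_eq_act_bMatrix_iff.1 (h1 hx)]
    exact (h3 hx).hasDerivAt
  · intro hy
    refine ⟨hy.acLoc hA, ?_⟩
    rw [ae_restrict_iff' measurableSet_Ioi]
    filter_upwards [hco, hy.ae_hasDerivAt hA] with x h2 h3 hx
    rw [act_J_eq_act_bMatrix_iff, (h3 hx).deriv, h2 hx]

lemma mem_stab {x : ℝ} (hx : 0 ≤ x) {v : C2n n} :
    v ∈ stab P V Q x lam ↔ ∃ y, IsSol (coef P V Q lam) y ∧ IsL2 y ∧ y x = v := by
  obtain ⟨M, hA⟩ := h.bddCoef lam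
  exact mem_stableSpace_shift hA hx

lemma ellTwo_eq_stab (hP : ∀ x, 0 ≤ x → P x = P' x)
    (hVQ : ∀ᵐ x ∂(volume.restrict (Ioi (0 : ℝ))), V x = V' x ∧ Q x = Q' x) {x : ℝ} (hx : 0 ≤ x) :
    ellTwo P' V' Q' x lam = stab P V Q x lam := by
  have hiff : ∀ y, IsSolution P' V' Q' lam y ↔ IsSol (coef P V Q lam) y := fun y =>
    h.isSolution_iff hP hVQ
  unfold ellTwo
  simp only [hiff]
  refine le_antisymm (Submodule.span_le.2 ?_) fun v hv => Submodule.subset_span ?_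
  · exact fun v hv => (h.mem_stab hx).2 hv
  · exact (h.mem_stab hx).1 hv

/-- The form `2 Re⟪φ, ψ⟫` is nonpositive on the graph `φ = -ψ` and nonnegative on the graph `φ = ψ`,
both of dimension `n`. -/
lemma finrank_stab (hl : lam < kappa Vp Qp) {x : ℝ} (hx : 0 ≤ x) :
    Module.finrank ℂ (stab P V Q x lam) = n := by
  obtain ⟨M, hA⟩ := h.bddCoef lam
  obtain ⟨c, x₀, -, hD⟩ := h.exists_dichotomy_of_lt_kappa hl
  have hker : ∀ f : C2n n →L[ℂ] Cn n, (∀ v, f (pair v 0) = v) →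
      Module.finrank ℂ (LinearMap.ker f.toLinearMap) = n := by
    intro f hf
    have h1 := f.toLinearMap.finrank_range_add_finrank_ker
    rw [LinearMap.range_eq_top.2 fun v => ⟨pair v 0, hf v⟩, finrank_top, finrank_euclideanSpace,
      finrank_euclideanSpace] at h1
    simp only [Fintype.card_sum, Fintype.card_fin] at h1
    omega
  have h1 := hker (up + low) fun v => by simp
  have h2 := hker (up - low) fun v => by simp
  refine (finrank_stableSpace (hA.shift x) ((hD lam le_rfl).shift hx)
    (Nm := LinearMap.ker (up + low : C2n n →L[ℂ] Cn n).toLinearMap)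
    (Np := LinearMap.ker (up - low : C2n n →L[ℂ] Cn n).toLinearMap) ?_ ?_ ?_).trans h1
  · intro v hv
    have : up v = -low v := eq_neg_of_add_eq_zero_left (by simpa using hv)
    rw [re_inner_formOp, this, inner_neg_left, Complex.neg_re]
    have : 0 ≤ (inner ℂ (low v) (low v)).re := inner_self_nonneg (𝕜 := ℂ)
    linarith
  · intro v hv
    have : up v = low v := sub_eq_zero.1 (by simpa using hv)
    rw [re_inner_formOp, this]
    have : 0 ≤ (inner ℂ (low v) (low v)).re := inner_self_nonneg (𝕜 := ℂ)
    linarith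
  · rw [h1, h2, finrank_euclideanSpace]
    simp

omit h in
lemma _root_.SturmLiouville.inner_act_of_isHermitian {A : Matrix (Fin n) (Fin n) ℂ}
    (hA : A.IsHermitian) (u v : Cn n) : inner ℂ (act A u) v = inner ℂ u (act A v) := by
  rw [inner_act, hA.eq]

/-- Lagrange's identity: self-adjointness of `P`, `V` and `Q` cancels everything in the derivative
of the symplectic form except the difference of the spectral parameters. -/
lemma symplectic_coef (lam mu x : ℝ) (u v : C2n n) :
    inner ℂ (coef P V Q lam x u) (act (Matrix.J (Fin n) ℂ) v) +
      inner ℂ u (act (Matrix.J (Fin n) ℂ) (coef P V Q mu x v)) =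
      ((mu - lam : ℝ) : ℂ) * inner ℂ (up u) (act (Q x) (up v)) := by
  have h3 : ∀ (lam : ℝ) y, up (coef P V Q lam x y) = act (P x)⁻¹ (low y) :=
    fun _ _ => up_offDiag _ _
  have h4 : ∀ (lam : ℝ) y, low (coef P V Q lam x y) = act (V x - (lam : ℂ) • Q x) (up y) :=
    fun _ _ => low_offDiag _ _
  rw [inner_eq_up_low, inner_eq_up_low u, up_act_J, low_act_J, up_act_J, low_act_J, h3, h3, h4, h4,
    inner_neg_right, inner_neg_right, inner_act_of_isHermitian (h.hermP x).inv, act_sub, act_sub,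
    inner_sub_left, inner_sub_right, inner_act_of_isHermitian (h.hermV x), act_smul, act_smul,
    inner_smul_left, inner_smul_right, Complex.conj_ofReal,
    inner_act_of_isHermitian (h.hermQ x)]
  push_cast
  ring

lemma tendsto_integral_up {y z : ℝ → C2n n} (hy : IsSol (coef P V Q lam) y)
    (hz : IsSol (coef P V Q mu) z) (hy2 : IsL2 y) (hz2 : IsL2 z) :
    Tendsto (fun X => ((mu - lam : ℝ) : ℂ) *
      ∫ s in (0 : ℝ)..X, inner ℂ (up (y s)) (act (Q s) (up (z s)))) atTop
      (𝓝 (-inner ℂ (y 0) (act (Matrix.J (Fin n) ℂ) (z 0)))) := by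
  obtain ⟨M, hA⟩ := h.bddCoef lam
  obtain ⟨M', hB⟩ := h.bddCoef mu
  have h0 : Tendsto (fun X => inner ℂ (y X) (act (Matrix.J (Fin n) ℂ) (z X))) atTop (𝓝 0) := by
    have h1 := hy2.tendsto_zero hA hy
    have h2 := ((Matrix.toEuclideanCLM (𝕜 := ℂ) (Matrix.J (Fin n) ℂ)).continuous.tendsto 0).comp
      (hz2.tendsto_zero hB hz)
    have h3 := h1.inner (𝕜 := ℂ) h2
    rw [inner_zero_left] at h3
    exact h3
  have h1 := h0.sub_const (inner ℂ (y 0) (act (Matrix.J (Fin n) ℂ) (z 0)))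
  rw [zero_sub] at h1
  refine h1.congr' ?_
  filter_upwards [eventually_ge_atTop 0] with X hX
  have h2 := (hy.integral_inner hA hB hz (Matrix.toEuclideanCLM (𝕜 := ℂ) (Matrix.J (Fin n) ℂ))
    le_rfl hX).2
  simp only [toEuclideanCLM_eq_act, h.symplectic_coef] at h2
  rw [← h2, intervalIntegral.integral_const_mul]

/-- For equal parameters the symplectic form of two solutions is constant, and for square integrable
ones it tends to zero. -/
lemma isLagrangian_stab (hl : lam < kappa Vp Qp) {x : ℝ} (hx : 0 ≤ x) :
    IsLagrangian (stab P V Q x lam) := by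
  refine ⟨h.finrank_stab hl hx, ?_⟩
  obtain ⟨M, hA⟩ := h.bddCoef lam
  intro u hu v hv
  obtain ⟨z, hz, hz2, rfl⟩ := (mem_stableSpace (hA.shift x)).1 hu
  obtain ⟨y, hy, hy2, rfl⟩ := (mem_stableSpace (hA.shift x)).1 hv
  have h0 : Tendsto (fun X => inner ℂ (y X) (act (Matrix.J (Fin n) ℂ) (z X))) atTop (𝓝 0) := by
    have h1 := hy2.tendsto_zero (hA.shift x) hy
    have h2 := ((Matrix.toEuclideanCLM (𝕜 := ℂ) (Matrix.J (Fin n) ℂ)).continuous.tendsto 0).comp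
      (hz2.tendsto_zero (hA.shift x) hz)
    have h3 := h1.inner (𝕜 := ℂ) h2
    rw [inner_zero_left] at h3
    exact h3
  refine tendsto_nhds_unique (tendsto_const_nhds.congr' ?_) h0
  filter_upwards [eventually_ge_atTop 0] with X hX
  have h2 := (hy.integral_inner (hA.shift x) (hA.shift x) hz
    (Matrix.toEuclideanCLM (𝕜 := ℂ) (Matrix.J (Fin n) ℂ)) le_rfl hX).2
  simp only [toEuclideanCLM_eq_act, h.symplectic_coef] at h2
  rw [sub_self] at h2
  simp only [Complex.ofReal_zero, zero_mul, intervalIntegral.integral_zero] at h2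
  exact (sub_eq_zero.1 h2.symm).symm

end Regular

end Stable

lemma IsSol.norm_sub_le_mul {E : Type*} [NormedAddCommGroup E] [InnerProductSpace ℂ E]
    {A : ℝ → E →L[ℂ] E} {M : ℝ} {y : ℝ → E} (hA : BddCoef A M) (hy : IsSol A y) {a b : ℝ}
    (ha : 0 ≤ a) (hb : 0 ≤ b) :
    ‖y b - y a‖ ≤ M * (‖y a‖ * Real.exp (M * |b - a|)) * |b - a| := by
  rw [hy.eq_add hA ha hb, add_sub_cancel_left]
  refine intervalIntegral.norm_integral_le_of_norm_le_const fun s hs => ?_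
  have hM := hA.nonneg
  have hs0 : 0 ≤ s := uIcc_subset_Ici ha hb (uIoc_subset_uIcc hs)
  have hsb : |s - a| ≤ |b - a| := abs_sub_left_of_mem_uIcc (uIoc_subset_uIcc hs)
  refine ((A s).le_opNorm _).trans (mul_le_mul (hA.bound s) ((hy.norm_le hA ha hs0).trans ?_)
    (norm_nonneg _) hM)
  gcongr

/-! ### Continuity of the spaces of square integrable solutions -/

section Continuity

variable {n : ℕ} {P V Q : ℝ → Matrix (Fin n) (Fin n) ℂ} {Pp Vp Qp : Matrix (Fin n) (Fin n) ℂ}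
  {θ C η lam : ℝ}

/-- The asymptotic space, given by the limits of the coefficients. -/
noncomputable def stabPlus (Pp Vp Qp : Matrix (Fin n) (Fin n) ℂ) (lam : ℝ) :
    Submodule ℂ (C2n n) :=
  stab (fun _ => Pp) (fun _ => Vp) (fun _ => Qp) 0 lam

/-- The spaces `stab P V Q x lam` for `0 ≤ x ≤ ∞`, where `x = t / (1 - t)`. -/
noncomputable def compStab (P V Q : ℝ → Matrix (Fin n) (Fin n) ℂ)
    (Pp Vp Qp : Matrix (Fin n) (Fin n) ℂ) (t lam : ℝ) : Submodule ℂ (C2n n) :=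
  if t < 1 then stab P V Q (t / (1 - t)) lam else stabPlus Pp Vp Qp lam

namespace Regular

variable (h : Regular P V Q Pp Vp Qp θ C η)
include h

lemma exists_uniform (hl : lam < kappa Vp Qp) : ∃ M c x₀, ∀ᶠ mu in 𝓝 lam,
    (BddCoef (coef P V Q mu) M ∧ Dichotomy (coef P V Q mu) (formOp n 0) c x₀) ∧
    (BddCoef (coef (fun _ => Pp) (fun _ => Vp) (fun _ => Qp) mu) M ∧
      Dichotomy (coef (fun _ => Pp) (fun _ => Vp) (fun _ => Qp) mu) (formOp n 0) c x₀) := by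
  obtain ⟨l', hl1, hl2⟩ := exists_between hl
  obtain ⟨M, hM⟩ := h.exists_bddCoef (|lam| + 1)
  obtain ⟨M', hM'⟩ := h.const.exists_bddCoef (|lam| + 1)
  obtain ⟨c, x₀, hc, hD⟩ := h.exists_dichotomy_of_lt_kappa hl2
  obtain ⟨c', x₀', hc', hD'⟩ := h.const.exists_dichotomy_of_lt_kappa hl2
  refine ⟨max M M', min c c', max x₀ x₀', ?_⟩
  have h1 : ∀ᶠ mu in 𝓝 lam, |mu| ≤ |lam| + 1 :=
    (continuous_abs.tendsto lam).eventually (eventually_le_nhds (lt_add_one _))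
  filter_upwards [h1, eventually_le_nhds hl1] with mu hmu hmul
  exact ⟨⟨(hM mu hmu).mono (le_max_left _ _),
    (hD mu hmul).mono (lt_min hc hc') (min_le_left _ _) (le_max_left _ _)⟩,
    (hM' mu hmu).mono (le_max_right _ _),
    (hD' mu hmul).mono (lt_min hc hc') (min_le_right _ _) (le_max_right _ _)⟩

variable {ι : Type*} {l : Filter ι} {x mu : ι → ℝ}

lemma coefTendsto (hmu : Tendsto mu l (𝓝 lam)) (x : ℝ) :
    CoefTendsto (fun i s => coef P V Q (mu i) (x + s)) l fun s => coef P V Q lam (x + s) := by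
  intro X δ hδ
  have h1 : Tendsto (fun i => ‖offDiag (n := n)‖ * (|mu i - lam| * (‖Qp‖ + C))) l (𝓝 0) := by
    have := (tendsto_iff_norm_sub_tendsto_zero.1 hmu).mul_const (‖Qp‖ + C)
    simpa using this.const_mul ‖offDiag (n := n)‖
  filter_upwards [h1.eventually (eventually_le_nhds hδ)] with i hi s _
  exact (h.norm_coef_sub_le _ _ _).trans hi

/-- Translating the origin to `x i → ∞` turns the system into the constant one; hence the asymptotic
space is the stable space of the limiting coefficients. -/
lemma coefTendsto_plus (hmu : Tendsto mu l (𝓝 lam)) (hx : Tendsto x l atTop) :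
    CoefTendsto (fun i s => coef P V Q (mu i) (x i + s)) l
      fun s => coef (fun _ => Pp) (fun _ => Vp) (fun _ => Qp) lam (0 + s) := by
  intro X δ hδ
  have h1 : Tendsto (fun i => ‖offDiag (n := n)‖ * (|mu i - lam| * (‖Qp‖ + C))) l (𝓝 0) := by
    have := (tendsto_iff_norm_sub_tendsto_zero.1 hmu).mul_const (‖Qp‖ + C)
    simpa using this.const_mul ‖offDiag (n := n)‖
  have h2 : Tendsto (fun i => ‖offDiag (n := n)‖ *
      ((θ⁻¹ ^ 2 + 1 + |lam|) * (C * Real.exp (-η * x i)))) l (𝓝 0) := by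
    have h1 : Tendsto (fun i => Real.exp (-η * x i)) l (𝓝 0) :=
      Real.tendsto_exp_atBot.comp (hx.const_mul_atTop_of_neg (neg_lt_zero.2 h.η_pos))
    simpa only [mul_zero] using
      ((h1.const_mul C).const_mul (θ⁻¹ ^ 2 + 1 + |lam|)).const_mul ‖offDiag (n := n)‖
  have h3 := h1.add h2
  rw [add_zero] at h3
  filter_upwards [h3.eventually (eventually_le_nhds hδ), hx.eventually_ge_atTop 0] with i hi hxi s hs
  refine le_trans ?_ hi
  refine (norm_sub_le_norm_sub_add_norm_sub _ (coef P V Q lam (x i + s)) _).trans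
    (add_le_add (h.norm_coef_sub_le _ _ _)
      ((h.norm_coef_sub_plus_le lam (add_nonneg hxi hs.1)).trans ?_))
  have := h.C_nonneg
  have := h.η_pos
  gcongr ?_ * (?_ * (_ * Real.exp ?_))
  nlinarith [hs.1]

lemma tendsto_proj_stabPlus (hl : lam < kappa Vp Qp) (hmu : Tendsto mu l (𝓝 lam))
    (hx : Tendsto x l atTop) :
    Tendsto (fun i => proj (stab P V Q (x i) (mu i))) l (𝓝 (proj (stabPlus Pp Vp Qp lam))) := by
  obtain ⟨M, c, x₀, hu⟩ := h.exists_uniform hl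
  have hx0 := hx.eventually_ge_atTop 0
  refine tendsto_starProjection ?_ fun U hU v w hv hvw => ?_
  · filter_upwards [hmu.eventually (eventually_lt_nhds hl), hx0] with i hi hxi
    rw [h.finrank_stab hi hxi, stabPlus, h.const.finrank_stab hl le_rfl]
  · have hlam := hu.self_of_nhds.2
    have hev := (hmu.eventually hu).and hx0
    refine CoefTendsto.mem_stableSpace (M := M) (c := c) (x₀ := x₀) (S := formOp n 0)
      (A' := fun i s => coef P V Q (mu i) (x i + s))
      (h.coefTendsto_plus (hmu.mono_left hU) (hx.mono_left hU))
      ((hev.filter_mono hU).mono fun i hi => hi.1.1.1.shift _)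
      ((hev.filter_mono hU).mono fun i hi => hi.1.1.2.shift hi.2)
      (hlam.1.shift 0) (hlam.2.shift le_rfl) (Eventually.of_forall hv) hvw

/-- Translation of merely measurable coefficients is not uniformly continuous, so `CoefTendsto` is
unavailable when the base point moves. Only `λ` is varied in the coefficients, and the base point is
corrected separately. -/
lemma tendsto_proj_stab (hl : lam < kappa Vp Qp) (hmu : Tendsto mu l (𝓝 lam)) {x' : ℝ}
    (hx' : 0 ≤ x') (hx : Tendsto x l (𝓝 x')) (hx0 : ∀ᶠ i in l, 0 ≤ x i) :
    Tendsto (fun i => proj (stab P V Q (x i) (mu i))) l (𝓝 (proj (stab P V Q x' lam))) := by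
  obtain ⟨M, c, x₀, hu⟩ := h.exists_uniform hl
  refine tendsto_starProjection ?_ fun U hU v w hv hvw => ?_
  · filter_upwards [hmu.eventually (eventually_lt_nhds hl), hx0] with i hi hxi
    rw [h.finrank_stab hi hxi, h.finrank_stab hl hx']
  · have hlam := hu.self_of_nhds.1
    have hev := ((hmu.eventually hu).and hx0).filter_mono hU
    -- Each vector is carried along its own solution from `x i` to the fixed point `x'`; the
    -- displacement vanishes in the limit by the growth bound.
    have hch : ∀ᶠ i in (U : Filter ι), ∃ w', w' ∈ stab P V Q x' (mu i) ∧
        ‖w' - v i‖ ≤ M * (‖v i‖ * Real.exp (M * |x' - x i|)) * |x' - x i| := by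
      filter_upwards [hev] with i hi
      obtain ⟨y, hy, hy2, hyv⟩ := (h.mem_stab hi.2).1 (hv i)
      refine ⟨y x', (h.mem_stab hx').2 ⟨y, hy, hy2, rfl⟩, ?_⟩
      rw [← hyv]
      exact hy.norm_sub_le_mul hi.1.1.1 hi.2 hx'
    obtain ⟨w', hw'⟩ := hch.choice
    have hlim : Tendsto w' U (𝓝 w) := by
      have h1 : Tendsto (fun i => |x' - x i|) U (𝓝 0) := by
        have := (hx.mono_left hU).const_sub x'
        rw [sub_self] at this
        simpa using this.abs
      have h2 : Tendsto (fun i => M * (‖v i‖ * Real.exp (M * |x' - x i|)) * |x' - x i|) U (𝓝 0) := by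
        have := ((hvw.norm.mul ((Real.continuous_exp.tendsto _).comp
          (h1.const_mul M))).const_mul M).mul h1
        simpa using this
      have h3 : Tendsto (fun i => w' i - v i) U (𝓝 0) :=
        squeeze_zero_norm' (hw'.mono fun i hi => hi.2) h2
      simpa using h3.add hvw
    exact CoefTendsto.mem_stableSpace (M := M) (c := c) (x₀ := x₀) (S := formOp n 0)
      (A' := fun i s => coef P V Q (mu i) (x' + s))
      (h.coefTendsto (hmu.mono_left hU) x')
      (hev.mono fun i hi => hi.1.1.1.shift _)
      (hev.mono fun i hi => hi.1.1.2.shift hx')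
      (hlam.1.shift x') (hlam.2.shift hx') (hw'.mono fun i hi => hi.1) hlim

lemma continuousOn_compStab :
    ContinuousOn (fun p : ℝ × ℝ => proj (compStab P V Q Pp Vp Qp p.1 p.2))
      (Icc 0 1 ×ˢ Iio (kappa Vp Qp)) := by
  rintro ⟨t, lam⟩ ⟨ht, hl⟩
  have hl' : lam < kappa Vp Qp := hl
  set F := 𝓝[Icc 0 1 ×ˢ Iio (kappa Vp Qp)] (t, lam) with hF
  have h1 : Tendsto (fun p : ℝ × ℝ => p.1) F (𝓝 t) := (continuous_fst.tendsto _).mono_left inf_le_left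
  have h2 : Tendsto (fun p : ℝ × ℝ => p.2) F (𝓝 lam) :=
    (continuous_snd.tendsto _).mono_left inf_le_left
  have h3 : ∀ᶠ p : ℝ × ℝ in F, p.1 ∈ Icc (0 : ℝ) 1 :=
    (eventually_mem_nhdsWithin (s := Icc (0:ℝ) 1 ×ˢ Iio (kappa Vp Qp))).mono fun p hp => hp.1
  have h4 : ∀ p : ℝ × ℝ, proj (compStab P V Q Pp Vp Qp p.1 p.2) =
      if p.1 < 1 then proj (stab P V Q (p.1 / (1 - p.1)) p.2) else proj (stabPlus Pp Vp Qp p.2) := by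
    intro p
    unfold compStab
    split_ifs <;> rfl
  change Tendsto (fun p : ℝ × ℝ => proj (compStab P V Q Pp Vp Qp p.1 p.2)) F _
  refine Tendsto.congr (fun p => (h4 p).symm) ?_
  change Tendsto _ F (𝓝 (proj (compStab P V Q Pp Vp Qp t lam)))
  rcases ht.2.eq_or_lt with rfl | ht1
  · rw [show proj (compStab P V Q Pp Vp Qp 1 lam) = proj (stabPlus Pp Vp Qp lam) from
      (h4 (1, lam)).trans (if_neg (lt_irrefl (1 : ℝ)))]
    -- Approach to the edge `t = 1` splits into points with `t < 1`, where `x → ∞`, and points on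
    -- the edge, where only `λ` moves.
    refine Tendsto.if ?_ ?_
    · refine h.tendsto_proj_stabPlus hl' (h2.mono_left inf_le_left) ?_
      have h5 : Tendsto (fun p : ℝ × ℝ => 1 - p.1) (F ⊓ 𝓟 {p : ℝ × ℝ | p.1 < 1}) (𝓝[>] 0) := by
        refine tendsto_nhdsWithin_iff.2 ⟨?_, ?_⟩
        · have := (h1.mono_left (inf_le_left (b := 𝓟 {p : ℝ × ℝ | p.1 < 1}))).const_sub 1
          simpa using this
        · filter_upwards [(le_principal_iff.1 inf_le_right : {p : ℝ × ℝ | p.1 < 1} ∈ _)] with p hp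
          exact sub_pos.2 hp
      exact (h1.mono_left inf_le_left).pos_mul_atTop one_pos (tendsto_inv_nhdsGT_zero.comp h5)
    · exact h.const.tendsto_proj_stab hl' (h2.mono_left inf_le_left) le_rfl tendsto_const_nhds
        (Eventually.of_forall fun _ => le_rfl)
  · rw [show proj (compStab P V Q Pp Vp Qp t lam) = proj (stab P V Q (t / (1 - t)) lam) from
      (h4 (t, lam)).trans (if_pos ht1)]
    have h5 : Tendsto (fun p : ℝ × ℝ => p.1 / (1 - p.1)) F (𝓝 (t / (1 - t))) :=
      h1.div (h1.const_sub 1) (sub_pos.2 ht1).ne'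
    refine (h.tendsto_proj_stab hl' h2 (div_nonneg ht.1 (sub_pos.2 ht1).le) h5
      (h3.mono fun p hp => div_nonneg hp.1 (sub_nonneg.2 hp.2))).congr' ?_
    filter_upwards [h1.eventually (eventually_lt_nhds ht1)] with p hp
    rw [if_pos hp]

lemma isLagrangian_compStab (hl : lam < kappa Vp Qp) {t : ℝ} (ht : t ∈ Icc 0 1) :
    IsLagrangian (compStab P V Q Pp Vp Qp t lam) := by
  unfold compStab
  split_ifs
  · exact h.isLagrangian_stab hl (div_nonneg ht.1 (sub_nonneg.2 ht.2))
  · exact h.const.isLagrangian_stab hl le_rfl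

end Regular

end Continuity

/-! ### The boundary space -/

section Boundary

variable {n : ℕ} {α₁ α₂ : Matrix (Fin n) (Fin n) ℂ} {ℓ : Submodule ℂ (C2n n)}

lemma J_conjTranspose_mul_self : (Matrix.J (Fin n) ℂ)ᴴ * Matrix.J (Fin n) ℂ = 1 := by
  have h1 : (Matrix.J (Fin n) ℂ)ᴴ = -Matrix.J (Fin n) ℂ := by
    rw [Matrix.J, Matrix.fromBlocks_conjTranspose, Matrix.fromBlocks_neg]
    simp
  rw [h1, neg_mul, Matrix.J_squared, neg_neg]

lemma AssumptionA3.isLagrangian_ellOne (h : AssumptionA3 α₁ α₂) :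
    IsLagrangian (ellOne α₁ α₂) := by
  refine ⟨?_, ?_⟩
  · rw [ellOne, ← rank_eq_finrank_range_act, Matrix.rank_mul_eq_right_of_isUnit_det _ _
      (Matrix.isUnit_det_J _ _), Matrix.rank_conjTranspose, h.rank_eq]
  · rintro _ ⟨a, rfl⟩ _ ⟨b, rfl⟩
    set B := Matrix.J (Fin n) ℂ * (bcMatrix α₁ α₂)ᴴ with hB
    change inner ℂ (act B b) (act (Matrix.J (Fin n) ℂ) (act B a)) = 0
    have : Bᴴ * (Matrix.J (Fin n) ℂ * B) = 0 := by
      rw [hB, Matrix.conjTranspose_mul, Matrix.conjTranspose_conjTranspose, Matrix.mul_assoc,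
        ← Matrix.mul_assoc (Matrix.J (Fin n) ℂ)ᴴ, J_conjTranspose_mul_self, Matrix.one_mul,
        ← Matrix.mul_assoc, h.selfAdjoint]
    rw [← act_mul, ← Matrix.conjTranspose_conjTranspose B, ← inner_act, ← act_mul,
      Matrix.conjTranspose_conjTranspose, this, act_zero, inner_zero_right]

lemma act_bcMatrix (y : C2n n) :
    act (bcMatrix α₁ α₂) y = act α₁ (up y) + act α₂ (low y) := by
  ext i
  change (bcMatrix α₁ α₂).mulVec y.ofLp i = _
  rw [bcMatrix, Matrix.fromCols_mulVec]
  rfl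

/-- The condition `αJα* = 0` puts `ℓ₁` into the kernel of `α`, and both have dimension `n`. -/
lemma AssumptionA3.mem_ellOne_iff (h : AssumptionA3 α₁ α₂) {y : C2n n} :
    y ∈ ellOne α₁ α₂ ↔ act α₁ (up y) + act α₂ (low y) = 0 := by
  have h1 := (Matrix.toEuclideanLin (bcMatrix α₁ α₂)).finrank_range_add_finrank_ker
  rw [← rank_eq_finrank_range_act, h.rank_eq, finrank_euclideanSpace, Fintype.card_sum,
    Fintype.card_fin] at h1
  have hle : ellOne α₁ α₂ ≤ LinearMap.ker (Matrix.toEuclideanLin (bcMatrix α₁ α₂)) := by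
    rintro _ ⟨a, rfl⟩
    change act (bcMatrix α₁ α₂) (act (Matrix.J (Fin n) ℂ * (bcMatrix α₁ α₂)ᴴ) a) = 0
    rw [← act_mul, ← Matrix.mul_assoc, h.selfAdjoint, act_zero]
  rw [Submodule.eq_of_le_of_finrank_eq hle (h.isLagrangian_ellOne.1.trans (Nat.add_left_cancel h1).symm),
    ← act_bcMatrix]
  rfl

/-- On a Lagrangian subspace the number `⟪φ, ψ⟫` depends on `φ` alone, so it is bounded by a
multiple of `|φ|²` that a large `K` outweighs. -/
lemma IsLagrangian.exists_form_nonneg (h : IsLagrangian ℓ) :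
    ∃ K : ℝ, 0 ≤ K ∧ ∀ y ∈ ℓ, 0 ≤ (inner ℂ y (formOp n K y)).re := by
  set f : ℓ →ₗ[ℂ] LinearMap.range ((up : C2n n →L[ℂ] Cn n).toLinearMap.domRestrict ℓ) :=
    ((up : C2n n →L[ℂ] Cn n).toLinearMap.domRestrict ℓ).rangeRestrict with hf
  obtain ⟨g, hg⟩ := f.exists_rightInverse_of_surjective (LinearMap.range_rangeRestrict _)
  set G := LinearMap.toContinuousLinearMap (ℓ.subtype ∘ₗ g) with hG
  refine ⟨2 * ‖G‖, by positivity, fun y hy => ?_⟩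
  set w := f ⟨y, hy⟩ with hw
  have hwn : ‖w‖ = ‖up y‖ := rfl
  have hGw : G w ∈ ℓ := (g w).2
  have hup : up (G w) = up y := congrArg Subtype.val (LinearMap.congr_fun hg w)
  -- `G w` is a lift of `φ` to `ℓ` depending linearly on `φ`. It differs from `y` only in the second
  -- component, and isotropy makes that difference orthogonal to `φ`.
  have h1 := h.2 y hy (G w - y) (ℓ.sub_mem hGw hy)
  rw [inner_eq_up_low, up_act_J, low_act_J, map_sub, hup, sub_self, inner_zero_left, zero_add,
    map_sub, inner_sub_left, sub_eq_zero] at h1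
  have h2 : |(inner ℂ (up y) (low y)).re| ≤ ‖G‖ * ‖up y‖ ^ 2 := by
    rw [← inner_conj_symm, ← h1, Complex.conj_re]
    refine (Complex.abs_re_le_norm _).trans ((norm_inner_le_norm _ _).trans ?_)
    have h3 := (norm_low_le (G w)).trans (G.le_opNorm w)
    rw [hwn] at h3
    calc ‖low (G w)‖ * ‖up y‖ ≤ (‖G‖ * ‖up y‖) * ‖up y‖ := by gcongr
      _ = _ := by ring
  rw [re_inner_formOp]
  have := neg_le_of_abs_le h2
  linarith

variable {P V Q : ℝ → Matrix (Fin n) (Fin n) ℂ} {Pp Vp Qp : Matrix (Fin n) (Fin n) ℂ}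
  {θ C η lam : ℝ}

lemma Regular.inf_stab_eq_bot (h : Regular P V Q Pp Vp Qp θ C η) {K c x : ℝ}
    (hK : ∀ y ∈ ℓ, 0 ≤ (inner ℂ y (formOp n K y)).re)
    (hD : Dichotomy (coef P V Q lam) (formOp n K) c 0) (hx : 0 ≤ x) :
    ℓ ⊓ stab P V Q x lam = ⊥ := by
  obtain ⟨M, hA⟩ := h.bddCoef lam
  rw [Submodule.eq_bot_iff]
  rintro v ⟨hv1, hv2⟩
  obtain ⟨y, hy, hy2, rfl⟩ := (h.mem_stab hx).1 hv2
  by_contra hne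
  exact (hy2.form_neg hD hA hy hx hne).not_ge (hK _ hv1)

/-- The form is nonnegative on `ℓ` and strictly negative on nonzero vectors of the stable space, at
every `x` and also at infinity. -/
lemma Regular.exists_inf_compStab_eq_bot (h : Regular P V Q Pp Vp Qp θ C η)
    (hL : IsLagrangian ℓ) :
    ∃ Λ : ℝ, ∀ lam ≤ Λ, ∀ t ∈ Icc (0 : ℝ) 1, ℓ ⊓ compStab P V Q Pp Vp Qp t lam = ⊥ := by
  obtain ⟨K, hK0, hK⟩ := hL.exists_form_nonneg
  obtain ⟨c, Λ, hD⟩ := h.exists_dichotomy_of_le hK0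
  obtain ⟨c', Λ', hD'⟩ := h.const.exists_dichotomy_of_le hK0
  refine ⟨min Λ Λ', fun lam hlam t ht => ?_⟩
  unfold compStab
  split_ifs
  · exact h.inf_stab_eq_bot hK (hD lam (hlam.trans (min_le_left _ _)))
      (div_nonneg ht.1 (sub_nonneg.2 ht.2))
  · exact h.const.inf_stab_eq_bot hK (hD' lam (hlam.trans (min_le_right _ _))) le_rfl

end Boundary

/-! ### Monotonicity in the spectral parameter -/

section Monotonicity

variable {n : ℕ} {P V Q : ℝ → Matrix (Fin n) (Fin n) ℂ} {Pp Vp Qp : Matrix (Fin n) (Fin n) ℂ}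
  {θ C η lam mu : ℝ} {y z : ℝ → C2n n}

namespace Regular

variable (h : Regular P V Q Pp Vp Qp θ C η)
include h

lemma aestronglyMeasurable_inner (hy : ContinuousOn y (Ici 0)) (hz : ContinuousOn z (Ici 0)) :
    AEStronglyMeasurable (fun s => inner ℂ (up (y s)) (act (Q s) (up (z s))))
      (volume.restrict (Ioi 0)) := by
  have hQ : AEStronglyMeasurable (fun s => Matrix.toEuclideanCLM (𝕜 := ℂ) (Q s))
      (volume.restrict (Ioi 0)) := by
    have h1 : Continuous fun A : Matrix (Fin n) (Fin n) ℂ => Matrix.toEuclideanCLM (𝕜 := ℂ) A :=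
      ((Matrix.toEuclideanCLM (n := Fin n)
        (𝕜 := ℂ)).toAlgEquiv.toLinearMap).continuous_of_finiteDimensional
    exact h1.comp_aestronglyMeasurable h.measQ.restrict
  have hm : ∀ {w : ℝ → C2n n}, ContinuousOn w (Ici 0) →
      AEStronglyMeasurable (fun s => up (w s)) (volume.restrict (Ioi 0)) := fun hw =>
    (up.continuous.comp_continuousOn (hw.mono Ioi_subset_Ici_self)).aestronglyMeasurable
      measurableSet_Ioi
  exact (hm hy).inner (isBoundedBilinearMap_apply.continuous.comp_aestronglyMeasurable
    (hQ.prodMk (hm hz)))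

lemma norm_inner_le (s : ℝ) (u v : C2n n) :
    ‖inner ℂ (up u) (act (Q s) (up v))‖ ≤ (‖Qp‖ + C) * (‖u‖ * ‖v‖) := by
  have h1 := h.C_nonneg
  calc ‖inner ℂ (up u) (act (Q s) (up v))‖ ≤ ‖up u‖ * ‖act (Q s) (up v)‖ := norm_inner_le_norm _ _
    _ ≤ ‖u‖ * (‖Q s‖ * ‖up v‖) := by
        gcongr
        · exact norm_up_le u
        · exact norm_act_le _ _
    _ ≤ ‖u‖ * ((‖Qp‖ + C) * ‖v‖) := by
        gcongr
        · exact h.norm_Q_le s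
        · exact norm_up_le v
    _ = _ := by ring

lemma integrableOn_inner (hy : ContinuousOn y (Ici 0)) (hz : ContinuousOn z (Ici 0))
    (hy2 : IsL2 y) (hz2 : IsL2 z) :
    IntegrableOn (fun s => inner ℂ (up (y s)) (act (Q s) (up (z s)))) (Ioi 0) := by
  rw [isL2_iff hy] at hy2
  rw [isL2_iff hz] at hz2
  refine Integrable.mono' ((hy2.add hz2).const_mul (‖Qp‖ + C))
    (h.aestronglyMeasurable_inner hy hz) (Eventually.of_forall fun s => ?_)
  refine (h.norm_inner_le s _ _).trans ?_
  have := h.C_nonneg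
  gcongr
  simp only [Pi.add_apply]
  nlinarith [sq_nonneg (‖y s‖ - ‖z s‖), sq_nonneg ‖y s‖, sq_nonneg ‖z s‖]

lemma integral_inner_eq (hy : IsSol (coef P V Q lam) y) (hz : IsSol (coef P V Q mu) z)
    (hy2 : IsL2 y) (hz2 : IsL2 z) :
    ((mu - lam : ℝ) : ℂ) * ∫ s in Ioi (0 : ℝ), inner ℂ (up (y s)) (act (Q s) (up (z s))) =
      -inner ℂ (y 0) (act (Matrix.J (Fin n) ℂ) (z 0)) :=
  tendsto_nhds_unique ((intervalIntegral_tendsto_integral_Ioi 0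
    (h.integrableOn_inner hy.cont hz.cont hy2 hz2) tendsto_id).const_mul _)
    (h.tendsto_integral_up hy hz hy2 hz2)

/-- If the first component vanished at `x₀`, so would the form, although it is strictly negative
there on nonzero square integrable solutions. -/
lemma up_ne_zero (hl : lam < kappa Vp Qp) (hy : IsSol (coef P V Q lam) y) (hy2 : IsL2 y)
    (h0 : y 0 ≠ 0) : ∃ x, 0 ≤ x ∧ up (y x) ≠ 0 := by
  obtain ⟨M, hA⟩ := h.bddCoef lam
  obtain ⟨c, x₀, -, hD⟩ := h.exists_dichotomy_of_lt_kappa hl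
  have hx₀ := (hD lam le_rfl).nonneg
  refine ⟨x₀, hx₀, fun hup => ?_⟩
  have hne : y x₀ ≠ 0 := fun h1 => by
    have := hy.norm_le hA hx₀ le_rfl
    rw [h1, norm_zero, zero_mul] at this
    exact h0 (norm_le_zero_iff.1 this)
  have := hy2.form_neg (hD lam le_rfl) hA hy le_rfl hne
  rw [re_inner_formOp, hup, inner_zero_left] at this
  simp at this

lemma re_integral_inner_pos (hl : lam < kappa Vp Qp) (hy : IsSol (coef P V Q lam) y)
    (hy2 : IsL2 y) (h0 : y 0 ≠ 0) :
    0 < (∫ s in Ioi (0 : ℝ), inner ℂ (up (y s)) (act (Q s) (up (y s)))).re := by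
  have hi := h.integrableOn_inner hy.cont hy.cont hy2 hy2
  have hθ := h.θ_pos
  have hre : (∫ s in Ioi (0 : ℝ), inner ℂ (up (y s)) (act (Q s) (up (y s)))).re =
      ∫ s in Ioi (0 : ℝ), (inner ℂ (up (y s)) (act (Q s) (up (y s)))).re :=
    (Complex.reCLM.integral_comp_comm hi).symm
  have hpos : ∀ s, 0 ≤ (inner ℂ (up (y s)) (act (Q s) (up (y s)))).re := fun s =>
    (by positivity : (0 : ℝ) ≤ θ * ‖up (y s)‖ ^ 2).trans (h.coerciveQ s _)
  rw [hre]
  refine (integral_nonneg hpos).lt_of_ne fun heq => ?_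
  have h1 := (integral_eq_zero_iff_of_nonneg hpos hi.re).1 heq.symm
  obtain ⟨x, hx, hne⟩ := h.up_ne_zero hl hy hy2 h0
  refine hne (mem_of_continuousOn_of_ae (f := fun x => up (y x)) isClosed_singleton
    (up.continuous.comp_continuousOn hy.cont) ?_ hx)
  filter_upwards [h1] with s hs
  have h2 := h.coerciveQ s (up (y s))
  have hs' : (inner ℂ (up (y s)) (act (Q s) (up (y s)))).re = 0 := hs
  rw [hs'] at h2
  have h3 : ‖up (y s)‖ ^ 2 ≤ 0 := le_of_mul_le_mul_left (by simpa using h2) hθ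
  exact norm_eq_zero.1 (pow_eq_zero_iff two_ne_zero |>.1 (le_antisymm h3 (sq_nonneg _)))

/-- Dominated convergence: normalized initial values and the uniform decay rate of
`Dichotomy.exists_decay` supply the majorant. -/
lemma tendsto_integral_inner (hl : lam < kappa Vp Qp) {mu : ℕ → ℝ}
    (hmu : Tendsto mu atTop (𝓝 lam)) {z : ℕ → ℝ → C2n n}
    (hz : ∀ k, IsSol (coef P V Q (mu k)) (z k)) (hz2 : ∀ k, IsL2 (z k)) (hz1 : ∀ k, ‖z k 0‖ = 1)
    (hy : IsSol (coef P V Q lam) y) (hy2 : IsL2 y)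
    (h0 : Tendsto (fun k => z k 0) atTop (𝓝 (y 0))) :
    Tendsto (fun k => ∫ s in Ioi (0 : ℝ), inner ℂ (up (y s)) (act (Q s) (up (z k s)))) atTop
      (𝓝 (∫ s in Ioi (0 : ℝ), inner ℂ (up (y s)) (act (Q s) (up (y s))))) := by
  obtain ⟨M, c, x₀, hu⟩ := h.exists_uniform hl
  obtain ⟨K, γ, hK, hγ, hdec⟩ := Dichotomy.exists_decay M (formOp n 0) c x₀
  have hev := hmu.eventually hu
  have hlam := hu.self_of_nhds.1
  have hC := h.C_nonneg
  have hq : (0 : ℝ) ≤ ‖Qp‖ + C := by positivity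
  have hexp : IntegrableOn (fun s : ℝ => Real.exp (-γ * s)) (Ioi 0) := exp_neg_integrableOn_Ioi 0 hγ
  refine tendsto_integral_filter_of_dominated_convergence
    (fun s => (‖Qp‖ + C) * (‖y s‖ ^ 2 + K * Real.exp (-γ * s)))
    (Eventually.of_forall fun k => h.aestronglyMeasurable_inner hy.cont (hz k).cont) ?_
    ((((isL2_iff hy.cont).1 hy2).add (hexp.const_mul K)).const_mul _) ?_
  · filter_upwards [hev] with k hk
    rw [ae_restrict_iff' measurableSet_Ioi]
    refine Eventually.of_forall fun s hs => ?_
    refine (h.norm_inner_le s _ _).trans ?_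
    have h1 := hdec _ hk.1.1 hk.1.2 (z k) (hz k) (hz2 k) s (le_of_lt hs)
    rw [hz1 k, one_pow, mul_one] at h1
    gcongr
    nlinarith [sq_nonneg (‖y s‖ - ‖z k s‖), sq_nonneg ‖y s‖, sq_nonneg ‖z k s‖]
  · rw [ae_restrict_iff' measurableSet_Ioi]
    refine Eventually.of_forall fun s hs => ?_
    have hct : CoefTendsto (fun k => coef P V Q (mu k)) atTop (coef P V Q lam) := by
      simpa using h.coefTendsto hmu 0
    have h1 := hct.tendsto_sol (hev.mono fun k hk => hk.1.1) hlam.1 (Eventually.of_forall hz) hy h0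
      (le_of_lt hs)
    have h2 : Tendsto (fun k => up (z k s)) atTop (𝓝 (up (y s))) := (up.continuous.tendsto _).comp h1
    have h3 : Tendsto (fun k => act (Q s) (up (z k s))) atTop (𝓝 (act (Q s) (up (y s)))) :=
      ((Matrix.toEuclideanCLM (𝕜 := ℂ) (Q s)).continuous.tendsto _).comp h2
    exact tendsto_const_nhds.inner h3

omit h in
lemma _root_.SturmLiouville.arcPoint_eq_neg_exp (θ : ℝ) :
    arcPoint θ = -Complex.exp (θ * Complex.I) := by
  unfold arcPoint
  rw [Complex.ofReal_add, add_mul, Complex.exp_add, Complex.exp_pi_mul_I, neg_one_mul]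

omit h in
lemma _root_.SturmLiouville.norm_sq_plusMat_add_minusMat (v : C2n n) :
    ‖act (plusMat n) v‖ ^ 2 + ‖act (minusMat n) v‖ ^ 2 = 2 * ‖v‖ ^ 2 := by
  have h1 := inner_plusMat v v
  have h2 := inner_minusMat v v
  have h3 : inner ℂ (act (plusMat n) v) (act (plusMat n) v) +
      inner ℂ (act (minusMat n) v) (act (minusMat n) v) = inner ℂ v v + inner ℂ v v := by
    rw [h1, h2]; ring
  have h4 := congrArg (RCLike.re : ℂ → ℝ) h3
  rw [map_add, map_add, inner_self_eq_norm_sq, inner_self_eq_norm_sq, inner_self_eq_norm_sq] at h4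
  rw [h4, two_mul]

omit h in
lemma _root_.SturmLiouville.two_I_mul_inner_J (u v : C2n n) :
    2 * Complex.I * inner ℂ u (act (Matrix.J (Fin n) ℂ) v) =
      inner ℂ (act (minusMat n) u) (act (minusMat n) v) -
        inner ℂ (act (plusMat n) u) (act (plusMat n) v) := by
  rw [inner_plusMat, inner_minusMat]; ring

end Regular

end Monotonicity

/-! ### Crossings in the spectral parameter are clockwise -/

section Clockwise

variable {n : ℕ} {P V Q : ℝ → Matrix (Fin n) (Fin n) ℂ} {Pp Vp Qp : Matrix (Fin n) (Fin n) ℂ}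
  {θ C η lam : ℝ} {ℓ : Submodule ℂ (C2n n)}

lemma exists_unit_of_arcPoint_mem_spectrum {ℓ' : Submodule ℂ (C2n n)} (hℓ : IsLagrangian ℓ)
    (hℓ' : IsLagrangian ℓ') {τ : ℝ} (hτ : arcPoint τ ∈ spectrum ℂ (Wtilde ℓ ℓ')) :
    ∃ y ∈ ℓ, ∃ z ∈ ℓ', ‖z‖ = 1 ∧ act (minusMat n) y = act (minusMat n) z ∧
      act (plusMat n) y = Complex.exp (τ * Complex.I) • act (plusMat n) z := by
  obtain ⟨y, hy, z, hz, hz0, hm, hp⟩ := exists_of_mem_spectrum_Wtilde hℓ hℓ' hτ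
  rw [arcPoint_eq_neg_exp, neg_neg] at hp
  set r : ℂ := ((‖z‖⁻¹ : ℝ) : ℂ)
  refine ⟨r • y, ℓ.smul_mem r hy, r • z, ℓ'.smul_mem r hz, ?_, ?_, ?_⟩
  · rw [norm_smul, Complex.norm_real, norm_inv, norm_norm, inv_mul_cancel₀ (norm_ne_zero_iff.2 hz0)]
  · rw [act_apply_smul, act_apply_smul, hm]
  · rw [act_apply_smul, act_apply_smul, hp, smul_comm]

/-- Because `⟪u, J y⟫ = 0`, only `z - y` contributes, and its component under `φ - iψ` is zero. What
remains is the factor `exp (iτ) - 1 = 2i sin (τ/2) exp (iτ/2)`. -/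
lemma inner_J_eq_of_crossing {u y z : C2n n} {τ : ℝ}
    (huy : inner ℂ u (act (Matrix.J (Fin n) ℂ) y) = 0)
    (hm : act (minusMat n) y = act (minusMat n) z)
    (hp : act (plusMat n) y = Complex.exp (τ * Complex.I) • act (plusMat n) z) :
    inner ℂ u (act (Matrix.J (Fin n) ℂ) z) = Real.sin (τ / 2) *
      (Complex.exp ((τ / 2 : ℝ) * Complex.I) * inner ℂ (act (plusMat n) u) (act (plusMat n) z)) := by
  have h1 := two_I_mul_inner_J u (z - y)
  rw [act_apply_sub, act_apply_sub, act_apply_sub, hm, hp, sub_self, inner_zero_right, zero_sub,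
    inner_sub_right, huy, sub_zero, inner_sub_right, inner_smul_right] at h1
  have h2 : Complex.exp (τ * Complex.I) =
      Complex.exp ((τ / 2 : ℝ) * Complex.I) * Complex.exp ((τ / 2 : ℝ) * Complex.I) := by
    rw [← Complex.exp_add]; congr 1; push_cast; ring
  have h3 : Complex.exp ((τ / 2 : ℝ) * Complex.I) * Complex.exp (-((τ / 2 : ℝ) * Complex.I)) = 1 := by
    rw [← Complex.exp_add, add_neg_cancel, Complex.exp_zero]
  rw [Complex.ofReal_sin, Complex.sin]
  have h4 : (2 * Complex.I) ≠ 0 := by simp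
  refine mul_left_cancel₀ h4 ?_
  rw [h1, h2, neg_mul]
  have h5 := Complex.I_mul_I
  set E := Complex.exp ((τ / 2 : ℝ) * Complex.I)
  set F := Complex.exp (-((τ / 2 : ℝ) * Complex.I))
  set p := inner ℂ (act (plusMat n) u) (act (plusMat n) z)
  linear_combination p * h3 - E * p * (F - E) * h5

/-- Suppose eigenvalues at angles `τ → 0` violate the sign rule for parameters `s → t`. Lagrange's
identity against a limit solution equates `(s - t)` times a quantity tending to a positive number
with `-sin (τ/2)` times a quantity tending to `1`, in real parts. Hence `s - t` and `τ` have
opposite signs. No differentiability in `λ` is needed. -/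
lemma Regular.clockwiseAt (h : Regular P V Q Pp Vp Qp θ C η) (hℓ : IsLagrangian ℓ) {a b : ℝ}
    (hb : b < kappa Vp Qp) {t : ℝ} (ht : t ∈ Icc a b) :
    ClockwiseAt (fun lam => Wtilde ℓ (stab P V Q 0 lam)) a b t := by
  have hlt : ∀ s ∈ Icc a b, s < kappa Vp Qp := fun s hs => hs.2.trans_lt hb
  by_contra hcon
  unfold ClockwiseAt at hcon
  push Not at hcon
  have hcon' : ∀ k : ℕ, ∃ s ∈ Icc a b, |s - t| < 1 / ((k : ℝ) + 1) ∧ s ≠ t ∧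
      ∃ τ, |τ| < 1 / ((k : ℝ) + 1) ∧ 0 ≤ (s - t) * τ ∧ ∃ y ∈ ℓ, ∃ z, IsSol (coef P V Q s) z ∧
        IsL2 z ∧ ‖z 0‖ = 1 ∧ act (minusMat n) y = act (minusMat n) (z 0) ∧
        act (plusMat n) y = Complex.exp (τ * Complex.I) • act (plusMat n) (z 0) := by
    intro k
    obtain ⟨s, hs, hst, hne, τ, hτ, hspec, hsgn⟩ := hcon (1 / ((k : ℝ) + 1)) (by positivity)
    obtain ⟨y, hy, w, hw, hw1, hm, hp⟩ := exists_unit_of_arcPoint_mem_spectrum hℓ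
      (h.isLagrangian_stab (hlt s hs) le_rfl) hspec
    obtain ⟨z, hz, hz2, rfl⟩ := (h.mem_stab le_rfl).1 hw
    exact ⟨s, hs, hst, hne, τ, hτ, hsgn, y, hy, z, hz, hz2, hw1, hm, hp⟩
  choose s hs hst hne τ hτ hsgn y hy z hz hz2 hz1 hm hp using hcon'
  obtain ⟨w, hwmem, f, hf, hfw⟩ := (isCompact_sphere (0 : C2n n) 1).tendsto_subseq
    (x := fun k => z k 0) fun k => mem_sphere_zero_iff_norm.2 (hz1 k)
  have hwn : ‖w‖ = 1 := mem_sphere_zero_iff_norm.1 hwmem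
  have hone : Tendsto (fun k => 1 / ((f k : ℝ) + 1)) atTop (𝓝 0) :=
    tendsto_one_div_add_atTop_nhds_zero_nat.comp hf.tendsto_atTop
  have hsl : Tendsto (fun k => s (f k)) atTop (𝓝 t) := by
    rw [tendsto_iff_norm_sub_tendsto_zero]
    exact squeeze_zero (fun _ => norm_nonneg _) (fun k => (hst (f k)).le) hone
  have hτl : Tendsto (fun k => τ (f k)) atTop (𝓝 0) :=
    squeeze_zero_norm (fun k => (hτ (f k)).le) hone
  -- the limit of the boundary values lies in both spaces
  have hplus : Tendsto (fun k => act (plusMat n) (z (f k) 0)) atTop (𝓝 (act (plusMat n) w)) :=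
    ((LinearMap.continuous_of_finiteDimensional (Matrix.toEuclideanLin (plusMat n))).tendsto w).comp
      hfw
  have hexp : Tendsto (fun k => Complex.exp (τ (f k) * Complex.I)) atTop (𝓝 1) := by
    have : Continuous fun r : ℝ => Complex.exp (r * Complex.I) := by fun_prop
    simpa [Function.comp_def] using (this.tendsto 0).comp hτl
  -- The two vectors agree under `φ - iψ`, and under `φ + iψ` they differ by the factor `exp (iτ) -
  -- 1`, which tends to zero.
  have hdiff : Tendsto (fun k => y (f k) - z (f k) 0) atTop (𝓝 0) := by
    have h1 : Tendsto (fun k => ‖(Complex.exp (τ (f k) * Complex.I) - 1) •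
        act (plusMat n) (z (f k) 0)‖) atTop (𝓝 0) := by
      simpa using ((hexp.sub_const 1).smul hplus).norm
    refine squeeze_zero_norm (fun k => ?_) h1
    have h2 := norm_sq_plusMat_add_minusMat (y (f k) - z (f k) 0)
    rw [act_apply_sub, act_apply_sub, hm, hp, sub_self, norm_zero,
      show ∀ (c : ℂ) (v : Cn n), c • v - v = (c - 1) • v by
        intro c v; rw [sub_smul, one_smul]] at h2
    refine le_of_sq_le_sq ?_ (norm_nonneg _)
    nlinarith [sq_nonneg ‖y (f k) - z (f k) 0‖]
  have hwℓ : w ∈ ℓ := by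
    have h1 : Tendsto (fun k => y (f k)) atTop (𝓝 w) := by simpa using hdiff.add hfw
    exact (Submodule.closed_of_finiteDimensional ℓ).mem_of_tendsto h1
      (Eventually.of_forall fun k => hy (f k))
  have hwst : w ∈ stab P V Q 0 t := by
    obtain ⟨M, c, x₀, hu⟩ := h.exists_uniform (hlt t ht)
    have hev := hsl.eventually hu
    have hlam := hu.self_of_nhds.1
    exact CoefTendsto.mem_stableSpace (M := M) (c := c) (x₀ := x₀) (S := formOp n 0)
      (A' := fun k r => coef P V Q (s (f k)) (0 + r)) (h.coefTendsto hsl 0)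
      (hev.mono fun k hk => hk.1.1.shift 0) (hev.mono fun k hk => hk.1.2.shift le_rfl)
      (hlam.1.shift 0) (hlam.2.shift le_rfl)
      (Eventually.of_forall fun k => (h.mem_stab le_rfl).2 ⟨z (f k), hz _, hz2 _, rfl⟩) hfw
  obtain ⟨Z, hZ, hZ2, rfl⟩ := (h.mem_stab le_rfl).1 hwst
  have hZ0 : Z 0 ≠ 0 := by
    intro h0
    rw [h0, norm_zero] at hwn
    exact zero_ne_one hwn
  have hI := h.tendsto_integral_inner (hlt t ht) hsl (fun k => hz (f k)) (fun k => hz2 (f k))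
    (fun k => hz1 (f k)) hZ hZ2 hfw
  have hIpos := h.re_integral_inner_pos (hlt t ht) hZ hZ2 hZ0
  have hev1 := ((Complex.continuous_re.tendsto _).comp hI).eventually (eventually_gt_nhds hIpos)
  have hpl : Tendsto (fun k => Complex.exp ((τ (f k) / 2 : ℝ) * Complex.I) *
      inner ℂ (act (plusMat n) (Z 0)) (act (plusMat n) (z (f k) 0))) atTop (𝓝 1) := by
    have h1 : Tendsto (fun k => Complex.exp ((τ (f k) / 2 : ℝ) * Complex.I)) atTop (𝓝 1) := by
      have : Continuous fun r : ℝ => Complex.exp ((r / 2 : ℝ) * Complex.I) := by fun_prop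
      simpa [Function.comp_def] using (this.tendsto 0).comp hτl
    have h2 : Tendsto (fun k => inner ℂ (act (plusMat n) (Z 0)) (act (plusMat n) (z (f k) 0)))
        atTop (𝓝 1) := by
      have h3 := (tendsto_const_nhds (x := act (plusMat n) (Z 0))).inner (𝕜 := ℂ) hplus
      rw [hℓ.inner_plusMat hwℓ hwℓ, inner_self_eq_norm_sq_to_K, hwn] at h3
      simpa using h3
    simpa using h1.mul h2
  have hev2 := ((Complex.continuous_re.tendsto _).comp hpl).eventually
    (eventually_gt_nhds (show (0 : ℝ) < (1 : ℂ).re by simp))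
  have hev3 := hτl.abs.eventually (eventually_lt_nhds (show |(0 : ℝ)| < 1 by simp))
  obtain ⟨k, ⟨hk1, hk2⟩, hk3⟩ := ((hev1.and hev2).and hev3).exists
  -- Lagrange's identity for the limit solution at parameter `t` and the approximating one at `s (f
  -- k)`.
  have key := h.integral_inner_eq hZ (hz (f k)) hZ2 (hz2 (f k))
  rw [inner_J_eq_of_crossing (hℓ.2 _ (hy (f k)) _ hwℓ) (hm (f k)) (hp (f k))] at key
  have key' := congrArg Complex.re key
  rw [Complex.re_ofReal_mul, Complex.neg_re, Complex.re_ofReal_mul] at key'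
  have hk1' : 0 < (∫ r in Ioi (0 : ℝ),
    inner ℂ (up (Z r)) (act (Q r) (up (z (f k) r)))).re := hk1
  have hk2' : 0 < (Complex.exp ((τ (f k) / 2 : ℝ) * Complex.I) *
      inner ℂ (act (plusMat n) (Z 0)) (act (plusMat n) (z (f k) 0))).re := hk2
  set I := (∫ r in Ioi (0 : ℝ), inner ℂ (up (Z r)) (act (Q r) (up (z (f k) r)))).re
  set p := (Complex.exp ((τ (f k) / 2 : ℝ) * Complex.I) *
      inner ℂ (act (plusMat n) (Z 0)) (act (plusMat n) (z (f k) 0))).re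
  have hab := abs_lt.1 hk3
  have hsg := hsgn (f k)
  have hpi := Real.pi_gt_three
  rcases lt_or_gt_of_ne (hne (f k)) with hlt' | hgt
  · have h1 : τ (f k) ≤ 0 := by nlinarith
    have h2 : Real.sin (τ (f k) / 2) ≤ 0 :=
      Real.sin_nonpos_of_nonpos_of_neg_pi_le (by linarith) (by linarith)
    nlinarith [mul_neg_of_neg_of_pos (sub_neg.2 hlt') hk1',
      mul_nonpos_of_nonpos_of_nonneg h2 hk2'.le]
  · have h1 : 0 ≤ τ (f k) := by nlinarith
    have h2 : 0 ≤ Real.sin (τ (f k) / 2) :=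
      Real.sin_nonneg_of_nonneg_of_le_pi (by linarith) (by linarith)
    nlinarith [mul_pos (sub_pos.2 hgt) hk1', mul_nonneg h2 hk2'.le]

end Clockwise

/-! ### Eigenfunctions -/

section SquareIntegrable

variable {n : ℕ} {P V Q : ℝ → Matrix (Fin n) (Fin n) ℂ} {Pp Vp Qp : Matrix (Fin n) (Fin n) ℂ}
  {θ C η lam : ℝ} {y : ℝ → C2n n}

namespace Regular

variable (h : Regular P V Q Pp Vp Qp θ C η)
include h

lemma norm_low_coef_le (lam x : ℝ) (v : C2n n) :
    ‖low (coef P V Q lam x v)‖ ≤ (‖Vp‖ + C + |lam| * (‖Qp‖ + C)) * ‖up v‖ := by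
  rw [coef, low_offDiag]
  refine (norm_act_le _ _).trans ?_
  gcongr
  refine (norm_sub_le _ _).trans (add_le_add (h.norm_V_le x) ?_)
  rw [norm_smul, Complex.norm_real, Real.norm_eq_abs]
  gcongr
  exact h.norm_Q_le x

/-- The derivative of the second component is bounded by a multiple of the first, so square
integrability of the first allows growth of order `√x` at most. -/
lemma exists_norm_low_le (hy : IsSol (coef P V Q lam) y)
    (hi : IntegrableOn (fun x => ‖up (y x)‖ ^ 2) (Ioi 0)) {x₁ : ℝ} (hx₁ : 0 ≤ x₁) :
    ∃ D, 0 ≤ D ∧ ∀ x, x₁ ≤ x → 1 ≤ x → ‖low (y x)‖ ≤ D * √x := by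
  obtain ⟨M, hA⟩ := h.bddCoef lam
  set B := ‖Vp‖ + C + |lam| * (‖Qp‖ + C) with hB
  have hB0 : 0 ≤ B := by have := h.C_nonneg; positivity
  set N := ∫ x in Ioi (0 : ℝ), ‖up (y x)‖ ^ 2 with hN
  have hN0 : 0 ≤ N := integral_nonneg fun x => sq_nonneg _
  refine ⟨‖low (y x₁)‖ + B * ((1 + N) / 2), by positivity, fun x hx hx1 => ?_⟩
  have hx0 := hx₁.trans hx
  have hcont : ContinuousOn (fun s => ‖up (y s)‖) (uIcc x₁ x) :=
    (up.continuous.comp_continuousOn (hy.cont.mono (uIcc_subset_Ici hx₁ hx0))).norm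
  have hcont2 : ContinuousOn (fun s => ‖up (y s)‖ ^ 2) (uIcc x₁ x) := hcont.pow 2
  have h1 : low (y x) = low (y x₁) + ∫ s in x₁..x, low (coef P V Q lam s (y s)) := by
    rw [hy.eq_add hA hx₁ hx0, map_add,
      ContinuousLinearMap.intervalIntegral_comp_comm _ (hA.intervalIntegrable_apply hy.cont hx₁ hx0)]
  have h2 : ‖∫ s in x₁..x, low (coef P V Q lam s (y s))‖ ≤ ∫ s in x₁..x, B * ‖up (y s)‖ :=
    intervalIntegral.norm_integral_le_of_norm_le hx
      (Eventually.of_forall fun s _ => h.norm_low_coef_le lam s (y s))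
      (hcont.intervalIntegrable.const_mul B)
  have hs : 0 < √x := Real.sqrt_pos.2 (by linarith)
  have hs1 : 1 ≤ √x := Real.one_le_sqrt.2 hx1
  have hss : √x * √x = x := Real.mul_self_sqrt (by linarith)
  -- The bound `2√x |φ| ≤ 1 + x |φ|²` takes the place of the Cauchy–Schwarz inequality for
  -- integrals.
  have h3 : ∫ s in x₁..x, ‖up (y s)‖ ≤ ∫ s in x₁..x, (2 * √x)⁻¹ * (1 + x * ‖up (y s)‖ ^ 2) := by
    refine intervalIntegral.integral_mono_on hx hcont.intervalIntegrable
      ((continuousOn_const.mul (continuousOn_const.add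
        (continuousOn_const.mul hcont2))).intervalIntegrable) fun s _ => ?_
    rw [inv_mul_eq_div, le_div_iff₀ (by positivity)]
    nlinarith [sq_nonneg (1 - √x * ‖up (y s)‖)]
  have h4 : ∫ s in x₁..x, ‖up (y s)‖ ^ 2 ≤ N := by
    rw [intervalIntegral.integral_of_le hx]
    exact setIntegral_mono_set hi (Eventually.of_forall fun _ => sq_nonneg _)
      (LE.le.eventuallyLE (show Ioc x₁ x ≤ Ioi 0 from fun s hs => hx₁.trans_lt hs.1))
  have h5 : ∫ s in x₁..x, (2 * √x)⁻¹ * (1 + x * ‖up (y s)‖ ^ 2) =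
      (2 * √x)⁻¹ * ((x - x₁) + x * ∫ s in x₁..x, ‖up (y s)‖ ^ 2) := by
    rw [intervalIntegral.integral_const_mul, intervalIntegral.integral_add
      intervalIntegrable_const (hcont2.intervalIntegrable.const_mul x),
      intervalIntegral.integral_const_mul, intervalIntegral.integral_const]
    simp
  have h6 : (2 * √x)⁻¹ * ((x - x₁) + x * ∫ s in x₁..x, ‖up (y s)‖ ^ 2) ≤ (1 + N) / 2 * √x := by
    rw [inv_mul_eq_div, div_le_iff₀ (by positivity)]
    have : x * ∫ s in x₁..x, ‖up (y s)‖ ^ 2 ≤ x * N := by gcongr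
    calc _ ≤ x + x * N := by linarith
      _ = (1 + N) * (√x * √x) := by rw [hss]; ring
      _ = _ := by ring
  rw [intervalIntegral.integral_const_mul] at h2
  have h7 : B * ∫ s in x₁..x, ‖up (y s)‖ ≤ B * ((1 + N) / 2 * √x) :=
    mul_le_mul_of_nonneg_left ((h3.trans h5.le).trans h6) hB0
  rw [h1]
  refine (norm_add_le _ _).trans ?_
  nlinarith [norm_nonneg (low (y x₁))]

/-- The operator domain controls only `φ`. If the form reached a value `q > 0`, it would stay at
least `q`; as `ψ` grows at most like `√x`, this forces `|φ|² ≥ q² / (4D²x)`, which is not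
integrable. -/
lemma isL2_of_up (hl : lam < kappa Vp Qp) (hy : IsSol (coef P V Q lam) y)
    (hi : IntegrableOn (fun x => ‖up (y x)‖ ^ 2) (Ioi 0)) : IsL2 y := by
  obtain ⟨M, hA⟩ := h.bddCoef lam
  obtain ⟨c, x₀, -, hD'⟩ := h.exists_dichotomy_of_lt_kappa hl
  have hD := hD' lam le_rfl
  refine isL2_of_form_nonpos hD hA hy ?_
  by_contra! hcon
  obtain ⟨x₁, hx₁, hq⟩ := hcon
  have hx₁0 := hD.nonneg.trans hx₁
  set q := (inner ℂ (y x₁) (formOp n 0 (y x₁))).re with hqdef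
  obtain ⟨D, hD0, hDle⟩ := h.exists_norm_low_le hy hi hx₁0
  refine not_integrableOn_Ioi_inv (a := max x₁ 1) ?_
  have hsub : Ioi (max x₁ 1) ⊆ Ioi (0 : ℝ) := Ioi_subset_Ioi (by positivity)
  refine Integrable.mono' ((hi.mono_set hsub).const_mul (4 * D ^ 2 / q ^ 2))
    measurable_inv.aestronglyMeasurable ?_
  rw [ae_restrict_iff' measurableSet_Ioi]
  refine Eventually.of_forall fun x hx => ?_
  have hx1 : x₁ ≤ x := (le_max_left _ _).trans (le_of_lt hx)
  have hx2 : 1 ≤ x := (le_max_right _ _).trans (le_of_lt hx)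
  have hx0 : 0 < x := by linarith
  have h1 := hD.form_mono hA hy hx₁ hx1
  rw [← hqdef, re_inner_formOp, zero_mul, zero_add] at h1
  have h2 : (inner ℂ (up (y x)) (low (y x))).re ≤ ‖up (y x)‖ * (D * √x) :=
    (Complex.re_le_norm _).trans ((norm_inner_le_norm _ _).trans
      (by gcongr; exact hDle x hx1 hx2))
  have h3 : q ≤ 2 * D * √x * ‖up (y x)‖ := by linarith
  have h4 : q ^ 2 ≤ (2 * D * √x * ‖up (y x)‖) ^ 2 := by gcongr
  rw [mul_pow, mul_pow, Real.sq_sqrt hx0.le] at h4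
  rw [norm_inv, Real.norm_of_nonneg hx0.le, div_mul_eq_mul_div, le_div_iff₀ (by positivity),
    inv_mul_le_iff₀ hx0]
  nlinarith

end Regular

end SquareIntegrable

/-! ### Eigenfunctions as square integrable solutions satisfying the boundary condition -/

section Eigenfunctions

lemma ACLoc.of_dist_le {X Y Z : Type*} [PseudoMetricSpace X] [PseudoMetricSpace Y]
    [PseudoMetricSpace Z] {f : ℝ → X} {g : ℝ → Y} {h : ℝ → Z} (hf : ACLoc f) (hg : ACLoc g)
    (hC : ∀ R, 0 ≤ R → ∃ C, ∀ x ∈ Icc 0 R, ∀ y ∈ Icc 0 R,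
      dist (h x) (h y) ≤ C * (dist (f x) (f y) + dist (g x) (g y))) : ACLoc h := by
  intro R hR
  obtain ⟨C, hC⟩ := hC R hR
  refine AbsolutelyContinuousOnInterval.of_dist_le (hf R hR) (hg R hR) (C := C) ?_
  rwa [uIcc_of_le hR]

lemma ACLoc.congr {X : Type*} [PseudoMetricSpace X] {f g : ℝ → X} (hf : ACLoc f)
    (h : ∀ x, 0 ≤ x → f x = g x) : ACLoc g :=
  hf.of_dist_le hf fun _ _ => ⟨1, fun x hx y hy => by
    rw [← h x hx.1, ← h y hy.1, one_mul]
    exact le_add_of_nonneg_right dist_nonneg⟩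

variable {n : ℕ} {P V Q P' V' Q' : ℝ → Matrix (Fin n) (Fin n) ℂ}
  {Pp Vp Qp : Matrix (Fin n) (Fin n) ℂ} {α₁ α₂ : Matrix (Fin n) (Fin n) ℂ}
  {θ C η lam : ℝ} {y : ℝ → C2n n} {φ : ℝ → Cn n}

lemma ACLoc.act {F : ℝ → Matrix (Fin n) (Fin n) ℂ} (hF : ACLoc F) (hφ : ACLoc φ) :
    ACLoc fun x => act (F x) (φ x) := by
  refine hF.of_dist_le hφ fun R _ => ?_
  obtain ⟨a, ha⟩ := isCompact_Icc.exists_bound_of_continuousOn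
    (hF.continuousOn.mono (Icc_subset_Ici_self : Icc 0 R ⊆ Ici 0))
  obtain ⟨b, hb⟩ := isCompact_Icc.exists_bound_of_continuousOn
    (hφ.continuousOn.mono (Icc_subset_Ici_self : Icc 0 R ⊆ Ici 0))
  refine ⟨max a b, fun x hx y hy => ?_⟩
  have h1 : SturmLiouville.act (F x) (φ x) - SturmLiouville.act (F y) (φ y) =
      SturmLiouville.act (F x) (φ x - φ y) + SturmLiouville.act (F x - F y) (φ y) := by
    rw [act_apply_sub, act_sub]; abel
  rw [dist_eq_norm, h1]
  refine (norm_add_le _ _).trans ?_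
  have h2 : ‖SturmLiouville.act (F x) (φ x - φ y)‖ ≤ max a b * ‖φ x - φ y‖ :=
    (norm_act_le _ _).trans (by gcongr; exact (ha x hx).trans (le_max_left _ _))
  have h3 : ‖SturmLiouville.act (F x - F y) (φ y)‖ ≤ ‖F x - F y‖ * max a b :=
    (norm_act_le _ _).trans (by gcongr; exact (hb y hy).trans (le_max_right _ _))
  rw [dist_eq_norm, dist_eq_norm]
  linarith

lemma hasDerivAt_clm (T : C2n n →L[ℂ] Cn n) {w : C2n n} {x : ℝ} (h : HasDerivAt y w x) :
    HasDerivAt (fun s => T (y s)) (T w) x :=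
  (T.restrictScalars ℝ).hasFDerivAt.comp_hasDerivAt x h

namespace Regular

variable (h : Regular P V Q Pp Vp Qp θ C η)
include h

lemma acLoc_inv (hP : ACLoc P) : ACLoc fun x => (P x)⁻¹ :=
  hP.of_dist_le hP fun _ _ => ⟨θ⁻¹ ^ 2, fun x _ y _ => by
    rw [dist_eq_norm, dist_eq_norm]
    refine ((h.coerciveP x).norm_inv_sub_inv_le (h.coerciveP y) h.θ_pos).trans ?_
    gcongr
    exact le_add_of_nonneg_right (norm_nonneg _)⟩

/-- The right side `P⁻¹ψ` is continuous, so the first component is differentiable at every point of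
the half-line, as membership in the domain demands. -/
lemma hasDerivWithinAt_up (hy : IsSol (coef P V Q lam) y) {x : ℝ} (hx : 0 ≤ x) :
    HasDerivWithinAt (fun s => up (y s)) (act (P x)⁻¹ (low (y x))) (Ici 0) x := by
  obtain ⟨M, hA⟩ := h.bddCoef lam
  set g : ℝ → Cn n := fun s => act (P s)⁻¹ (low (y (max s 0))) with hg
  have hgc : Continuous g := by
    have h1 : Continuous fun A : Matrix (Fin n) (Fin n) ℂ => Matrix.toEuclideanCLM (𝕜 := ℂ) A :=
      ((Matrix.toEuclideanCLM (n := Fin n)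
        (𝕜 := ℂ)).toAlgEquiv.toLinearMap).continuous_of_finiteDimensional
    have h2 : Continuous fun s : ℝ => y (max s 0) :=
      hy.cont.comp_continuous (continuous_id.max continuous_const)
        fun s => mem_Ici.2 (le_max_right s 0)
    exact (h1.comp h.continuous_inv).clm_apply (low.continuous.comp h2)
  have h1 : ∀ s ∈ Ici (0 : ℝ), up (y s) = up (y 0) + ∫ r in (0 : ℝ)..s, g r := by
    intro s hs
    have hs0 : 0 ≤ s := hs
    rw [hy.eq s hs0, map_add, ← ContinuousLinearMap.intervalIntegral_comp_comm _
      (hA.intervalIntegrable_apply hy.cont le_rfl hs0)]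
    congr 1
    refine intervalIntegral.integral_congr fun r hr => ?_
    rw [uIcc_of_le hs0] at hr
    simp only [hg, max_eq_left hr.1]
    exact up_offDiag _ _
  have h2 : HasDerivAt (fun s => up (y 0) + ∫ r in (0 : ℝ)..s, g r) (g x) x :=
    ((hgc.integral_hasStrictDerivAt 0 x).hasDerivAt).const_add _
  have h3 : g x = act (P x)⁻¹ (low (y x)) := by simp only [hg, max_eq_left hx]
  rw [← h3]
  exact h2.hasDerivWithinAt.congr h1 (h1 x hx)

lemma D_up (hy : IsSol (coef P V Q lam) y) {x : ℝ} (hx : 0 ≤ x) :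
    D (fun s => up (y s)) x = act (P x)⁻¹ (low (y x)) :=
  (h.hasDerivWithinAt_up hy hx).derivWithin (uniqueDiffOn_Ici 0 x hx)

lemma act_D_up (hy : IsSol (coef P V Q lam) y) {x : ℝ} (hx : 0 ≤ x) :
    act (P x) (D (fun s => up (y s)) x) = low (y x) := by
  rw [h.D_up hy hx, (h.coerciveP x).act_act_inv h.θ_pos]

variable (hP : ∀ x, 0 ≤ x → P x = P' x)
  (hVQ : ∀ᵐ x ∂(volume.restrict (Ioi (0 : ℝ))), V x = V' x ∧ Q x = Q' x) (hac : ACLoc P')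
include hP hVQ

lemma sturmOp_up (hy : IsSol (coef P V Q lam) y) :
    ∀ᵐ x ∂(volume.restrict (Ioi (0 : ℝ))),
      sturmOp P' V' Q' (fun s => up (y s)) x = (lam : ℂ) • up (y x) := by
  obtain ⟨M, hA⟩ := h.bddCoef lam
  rw [ae_restrict_iff' measurableSet_Ioi] at hVQ ⊢
  filter_upwards [hVQ, hy.ae_hasDerivAt hA] with x hx hd hx0
  have hx0' : 0 ≤ x := le_of_lt hx0
  obtain ⟨hV, hQ⟩ := hx hx0
  have h1 : D (fun s => act (P' s) (D (fun s => up (y s)) s)) x = low (coef P V Q lam x (y x)) := by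
    have h2 : HasDerivWithinAt (fun s => low (y s)) (low (coef P V Q lam x (y x))) (Ici 0) x :=
      (hasDerivAt_clm low (hd hx0)).hasDerivWithinAt
    have h3 : ∀ s ∈ Ici (0 : ℝ), act (P' s) (D (fun s => up (y s)) s) = low (y s) := fun s hs => by
      rw [← hP s hs, h.act_D_up hy hs]
    exact (h2.congr h3 (h3 x hx0')).derivWithin (uniqueDiffOn_Ici 0 x hx0')
  unfold sturmOp
  rw [h1, ← hV, ← hQ, coef, low_offDiag, act_sub, act_smul, neg_sub, sub_add_cancel,
    act_apply_smul, (h.coerciveQ x).act_inv_act h.θ_pos]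

include hac in
lemma inDomain_up (hα : AssumptionA3 α₁ α₂) (hy : IsSol (coef P V Q lam) y) (hy2 : IsL2 y)
    (h0 : y 0 ∈ ellOne α₁ α₂) : InDomain P' V' Q' α₁ α₂ fun s => up (y s) := by
  obtain ⟨M, hA⟩ := h.bddCoef lam
  have hyac := hy.acLoc hA
  have hcomp : ∀ T : C2n n →L[ℂ] Cn n, ACLoc fun s => T (y s) := fun T =>
    hyac.of_dist_le hyac fun _ _ => ⟨‖T‖, fun s _ t _ => by
      rw [dist_eq_norm, ← map_sub, dist_eq_norm]
      refine (T.le_opNorm _).trans ?_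
      gcongr
      exact le_add_of_nonneg_right (norm_nonneg _)⟩
  have hL2 : MemLp (fun s => up (y s)) 2 (volume.restrict (Ioi (0 : ℝ))) := up.comp_memLp' hy2
  have hPac : ACLoc P := hac.congr fun x hx => (hP x hx).symm
  refine ⟨hL2, fun x hx => (h.hasDerivWithinAt_up hy hx).differentiableWithinAt, hcomp up,
    ((h.acLoc_inv hPac).act (hcomp low)).congr fun x hx => (h.D_up hy hx).symm, ?_, ?_⟩
  · exact (hL2.const_smul (lam : ℂ)).ae_eq
      ((h.sturmOp_up hP hVQ hy).mono fun x hx => hx.symm)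
  · rw [← hP 0 le_rfl, h.act_D_up hy le_rfl]
    exact hα.mem_ellOne_iff.1 h0

include hac in
lemma exists_isSol_of_inDomain (hl : lam < kappa Vp Qp) (hα : AssumptionA3 α₁ α₂)
    (hφ : InDomain P' V' Q' α₁ α₂ φ)
    (he : ∀ᵐ x ∂(volume.restrict (Ioi (0 : ℝ))), sturmOp P' V' Q' φ x = (lam : ℂ) • φ x) :
    ∃ y, IsSol (coef P V Q lam) y ∧ IsL2 y ∧ y 0 ∈ ellOne α₁ α₂ ∧ ∀ x, up (y x) = φ x := by
  obtain ⟨M, hA⟩ := h.bddCoef lam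
  set ψ : ℝ → Cn n := fun x => act (P' x) (D φ x) with hψ
  have hψac : ACLoc ψ := hac.act hφ.ac_deriv
  have hyac : ACLoc fun x => pair (φ x) (ψ x) := hφ.ac.of_dist_le hψac fun _ _ =>
    ⟨1, fun s _ t _ => by
      rw [one_mul, dist_eq_norm, dist_eq_norm, dist_eq_norm]
      refine le_of_sq_le_sq ?_ (by positivity)
      rw [norm_sq_eq_up_low, map_sub, map_sub, up_pair, up_pair, low_pair, low_pair]
      nlinarith [norm_nonneg (φ s - φ t), norm_nonneg (ψ s - ψ t)]⟩
  have hy : IsSol (coef P V Q lam) fun x => pair (φ x) (ψ x) := by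
    refine IsSol.of_ac hA hyac ?_
    rw [ae_restrict_iff' measurableSet_Ioi] at hVQ he
    filter_upwards [hVQ, he, hyac.ae_differentiableAt] with x hx hex hd hx0
    have hx0' : 0 ≤ x := le_of_lt hx0
    obtain ⟨hV, hQ⟩ := hx hx0
    have hn : Ici (0 : ℝ) ∈ 𝓝 x := Ici_mem_nhds hx0
    have hd' := (hd hx0).hasDerivAt
    set w := deriv (fun x => pair (φ x) (ψ x)) x
    have hup : HasDerivAt φ (up w) x := hasDerivAt_clm up hd'
    have hlow : HasDerivAt ψ (low w) x := hasDerivAt_clm low hd'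
    have e1 : D φ x = up w := by
      unfold D; rw [derivWithin_of_mem_nhds hn, hup.deriv]
    have e2 : D ψ x = low w := by
      unfold D; rw [derivWithin_of_mem_nhds hn, hlow.deriv]
    have h3 := hex hx0
    unfold sturmOp at h3
    rw [← hψ, e2, ← hV, ← hQ] at h3
    have h4 := congrArg (act (Q x)) h3
    rw [(h.coerciveQ x).act_act_inv h.θ_pos, act_apply_smul] at h4
    have h5 : w = coef P V Q lam x (pair (φ x) (ψ x)) := by
      refine ext_up_low ?_ ?_
      · rw [coef, up_offDiag, low_pair, ← e1]
        change D φ x = act (P x)⁻¹ (act (P' x) (D φ x))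
        rw [← hP x hx0', (h.coerciveP x).act_inv_act h.θ_pos]
      · rw [coef, low_offDiag, up_pair, act_sub, act_smul, ← h4]
        abel
    rw [← h5]
    exact hd'
  refine ⟨_, hy, h.isL2_of_up hl hy ?_, hα.mem_ellOne_iff.2 hφ.bc, fun x => rfl⟩
  have := (memLp_two_iff_integrable_sq_norm hφ.memLp.1).1 hφ.memLp
  exact this

-- Sending `v` to the first component of the solution starting at `v` maps `ℓ₁ ⊓ stab P V Q 0 λ`
-- isomorphically onto the eigenspace.
include hac in
theorem rank_eigenspace (hl : lam < kappa Vp Qp) (hα : AssumptionA3 α₁ α₂) :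
    Cardinal.toENat (Module.rank ℂ (eigenspace P' V' Q' α₁ α₂ lam)) =
      Module.finrank ℂ (ellOne α₁ α₂ ⊓ stab P V Q 0 lam : Submodule ℂ (C2n n)) := by
  obtain ⟨M, hA⟩ := h.bddCoef lam
  obtain ⟨Φ, hΦ, hΦ0⟩ := exists_flow hA
  set S : Submodule ℂ (C2n n) := ellOne α₁ α₂ ⊓ stab P V Q 0 lam with hS
  have hSol : ∀ v : S, IsL2 fun x => Φ x (v : C2n n) := by
    rintro ⟨v, hv1, hv2⟩
    obtain ⟨y, hy, hy2, rfl⟩ := (h.mem_stab le_rfl).1 hv2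
    have hey : ∀ x ∈ Ioi (0 : ℝ), y x = Φ x (y 0) := fun x hx =>
      IsSol.eq_of_eq hA hy (hΦ (y 0)) le_rfl (le_of_lt hx) (hΦ0 (y 0)).symm
    exact hy2.ae_eq ((ae_restrict_mem measurableSet_Ioi).mono hey)
  have hL : ∀ v : S, MemLp (fun x => up (Φ x (v : C2n n))) 2 (volume.restrict (Ioi (0 : ℝ))) :=
    fun v => up.comp_memLp' (hSol v)
  let T : S →ₗ[ℂ] Lp (Cn n) 2 (volume.restrict (Ioi (0 : ℝ))) :=
    { toFun := fun v => (hL v).toLp _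
      map_add' := fun v w => by
        rw [← MemLp.toLp_add]
        congr 1
        funext x
        simp
      map_smul' := fun c v => by
        rw [RingHom.id_apply, ← MemLp.toLp_const_smul]
        congr 1
        funext x
        simp }
  -- A first component vanishing almost everywhere vanishes everywhere by continuity, contrary to
  -- `up_ne_zero`.
  have hT : Function.Injective T := by
    rw [← LinearMap.ker_eq_bot, LinearMap.ker_eq_bot']
    intro v hv
    have h1 : (fun x => up (Φ x (v : C2n n))) =ᵐ[volume.restrict (Ioi (0 : ℝ))] 0 :=
      (hL v).coeFn_toLp.symm.trans (by
        rw [show (hL v).toLp _ = 0 from hv]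
        exact Lp.coeFn_zero _ _ _)
    by_contra hne
    obtain ⟨x, hx, hx'⟩ := h.up_ne_zero hl (hΦ (v : C2n n)) (hSol v)
      (by rw [hΦ0]; exact fun h0 => hne (Subtype.ext h0))
    exact hx' (mem_of_continuousOn_of_ae isClosed_singleton
      (up.continuous.comp_continuousOn (hΦ (v : C2n n)).cont) h1 hx)
  have hrange : eigenspace P' V' Q' α₁ α₂ lam = LinearMap.range T := by
    refine le_antisymm (Submodule.span_le.2 ?_) ?_
    · rintro f ⟨φ, hφ, hf, he⟩
      obtain ⟨y, hy, hy2, hy0, hup⟩ := h.exists_isSol_of_inDomain hP hVQ hac hl hα hφ he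
      set v : S := ⟨y 0, hy0, (h.mem_stab le_rfl).2 ⟨y, hy, hy2, rfl⟩⟩
      refine ⟨v, Lp.ext ((hL v).coeFn_toLp.trans ?_)⟩
      filter_upwards [hf, ae_restrict_mem measurableSet_Ioi] with x hfx hx
      rw [hfx, ← hup, IsSol.eq_of_eq hA hy (hΦ (y 0)) le_rfl (le_of_lt hx) (hΦ0 (y 0)).symm]
    · rintro _ ⟨v, rfl⟩
      refine Submodule.subset_span ⟨fun x => up (Φ x (v : C2n n)), ?_, (hL v).coeFn_toLp, ?_⟩
      · exact h.inDomain_up hP hVQ hac hα (hΦ _) (hSol v) (by rw [hΦ0]; exact v.2.1)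
      · exact h.sturmOp_up hP hVQ (hΦ _)
  rw [hrange, rank_range_of_injective _ hT, ← Module.finrank_eq_rank, Cardinal.toENat_nat]

end Regular

end Eigenfunctions

/-! ### The Morse index formula -/

section Main

variable {n : ℕ}

lemma maslov_eq_winding_sub {ℓ₁ ℓ₂ : ℝ → Submodule ℂ (C2n n)} {a b : ℝ} {Θ : ℝ → ℝ} (hab : a ≤ b)
    (hV : ContinuousOn (fun t => Wtilde (ℓ₁ t) (ℓ₂ t)) (Icc a b))
    (hU : ∀ x ∈ Icc a b, Wtilde (ℓ₁ x) (ℓ₂ x) ∈ Matrix.unitaryGroup (Fin n) ℂ)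
    (hΘ : ContinuousOn Θ (Icc a b))
    (hdet : ∀ x ∈ Icc a b, Complex.exp (Θ x * Complex.I) = (Wtilde (ℓ₁ x) (ℓ₂ x)).det) :
    (maslov ℓ₁ ℓ₂ a b : ℝ) =
      winding (Θ b) (Wtilde (ℓ₁ b) (ℓ₂ b)) - winding (Θ a) (Wtilde (ℓ₁ a) (ℓ₂ a)) := by
  have hex := exists_isSpectralFlow hab hV
  unfold maslov
  rw [dif_pos hex]
  exact (isSpectralFlow_iff hab hV hU hΘ hdet).1 hex.choose_spec

lemma IsSpectralFlow.congr {V W : ℝ → Matrix (Fin n) (Fin n) ℂ} {a b : ℝ} {m : ℤ}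
    (hV : IsSpectralFlow V a b m) (h : ∀ t ∈ Icc a b, V t = W t) : IsSpectralFlow W a b m := by
  obtain ⟨N, t, ε, ht, ht0, htN, hε, hm⟩ := hV
  have hmem : ∀ j ≤ N, t j ∈ Icc a b := fun j hj => ⟨ht0 ▸ ht j.zero_le, htN ▸ ht hj⟩
  refine ⟨N, t, ε, ht, ht0, htN, fun j hj => ⟨(hε j hj).1, fun s hs => ?_⟩, hm.trans ?_⟩
  · rw [← h s ⟨(hmem j hj.le).1.trans hs.1, hs.2.trans (hmem (j + 1) hj).2⟩]
    exact (hε j hj).2 s hs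
  · refine Finset.sum_congr rfl fun j hj => ?_
    have hj' := Finset.mem_range.1 hj
    rw [h _ (hmem j hj'.le), h _ (hmem (j + 1) hj')]

lemma maslov_congr {ℓ₁ ℓ₂ ℓ₁' ℓ₂' : ℝ → Submodule ℂ (C2n n)} {a b : ℝ}
    (h₁ : ∀ t ∈ Icc a b, ℓ₁ t = ℓ₁' t) (h₂ : ∀ t ∈ Icc a b, ℓ₂ t = ℓ₂' t) :
    maslov ℓ₁ ℓ₂ a b = maslov ℓ₁' ℓ₂' a b := by
  have h : ∀ t ∈ Icc a b, Wtilde (ℓ₁ t) (ℓ₂ t) = Wtilde (ℓ₁' t) (ℓ₂' t) := fun t ht => by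
    rw [h₁ t ht, h₂ t ht]
  have hiff : IsSpectralFlow (fun t => Wtilde (ℓ₁ t) (ℓ₂ t)) a b =
      IsSpectralFlow (fun t => Wtilde (ℓ₁' t) (ℓ₂' t)) a b := funext fun m => propext
    ⟨fun hm => hm.congr h, fun hm => hm.congr fun t ht => (h t ht).symm⟩
  unfold maslov
  rw [hiff]

lemma compactify_const (ℓ : Submodule ℂ (C2n n)) (t : ℝ) : compactify (fun _ => ℓ) t = ℓ := by
  unfold compactify
  split_ifs
  · rfl
  · exact PathTendsto.limSpace_eq tendsto_const_nhds

variable {P V Q P' V' Q' : ℝ → Matrix (Fin n) (Fin n) ℂ}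
  {Pp Vp Qp : Matrix (Fin n) (Fin n) ℂ} {α₁ α₂ : Matrix (Fin n) (Fin n) ℂ} {θ C η lam : ℝ}
  {ℓ : Submodule ℂ (C2n n)}

lemma compStab_zero (lam : ℝ) : compStab P V Q Pp Vp Qp 0 lam = stab P V Q 0 lam := by
  unfold compStab
  rw [if_pos one_pos, zero_div]

lemma compStab_one (lam : ℝ) : compStab P V Q Pp Vp Qp 1 lam = stabPlus Pp Vp Qp lam := by
  unfold compStab
  rw [if_neg (lt_irrefl _)]

namespace Regular

variable (h : Regular P V Q Pp Vp Qp θ C η)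
include h

lemma continuousOn_Wtilde (hℓ : IsLagrangian ℓ) :
    ContinuousOn (fun p : ℝ × ℝ => Wtilde ℓ (compStab P V Q Pp Vp Qp p.1 p.2))
      (Icc 0 1 ×ˢ Iio (kappa Vp Qp)) := by
  intro p hp
  refine tendsto_Wtilde (L := fun _ => ℓ) (Eventually.of_forall fun _ => hℓ) ?_ hℓ
    (h.isLagrangian_compStab hp.2 hp.1) tendsto_const_nhds (h.continuousOn_compStab p hp)
  filter_upwards [eventually_mem_nhdsWithin] with q hq
  exact h.isLagrangian_compStab hq.2 hq.1

/-- One logarithm of the determinant serves the whole rectangle, so the winding numbers at the four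
corners are consistent and the contributions of the sides cancel; no separate homotopy argument is
required. -/
theorem exists_finset_crossings (hℓ : IsLagrangian ℓ) {a b : ℝ} (hab : a ≤ b)
    (hb : b < kappa Vp Qp)
    (hleft : ∀ t ∈ Icc (0 : ℝ) 1, ℓ ⊓ compStab P V Q Pp Vp Qp t a = ⊥) :
    ∃ F : Finset ℝ, (∀ t, t ∈ F ↔ t ∈ Ico a b ∧
        Module.finrank ℂ (ℓ ⊓ stab P V Q 0 t : Submodule ℂ (C2n n)) ≠ 0) ∧
      ((∑ t ∈ F, Module.finrank ℂ (ℓ ⊓ stab P V Q 0 t : Submodule ℂ (C2n n)) : ℕ) : ℤ) =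
        maslov (fun _ => ℓ) (fun t => compStab P V Q Pp Vp Qp t b) 0 1 -
          maslov (fun _ => ℓ) (fun lam => stabPlus Pp Vp Qp lam) a b := by
  set W : ℝ × ℝ → Matrix (Fin n) (Fin n) ℂ :=
    fun p => Wtilde ℓ (compStab P V Q Pp Vp Qp p.1 p.2) with hW
  have hlt : ∀ lam ∈ Icc a b, lam < kappa Vp Qp := fun lam hl => hl.2.trans_lt hb
  have hWc : ContinuousOn W (Icc 0 1 ×ˢ Icc a b) :=
    (h.continuousOn_Wtilde hℓ).mono (prod_mono_right fun lam hl => hlt lam hl)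
  have hWU : ∀ p ∈ Icc (0 : ℝ) 1 ×ˢ Icc a b, W p ∈ Matrix.unitaryGroup (Fin n) ℂ := fun p hp =>
    Wtilde_mem_unitaryGroup hℓ (h.isLagrangian_compStab (hlt _ hp.2) hp.1)
  obtain ⟨Θ, hΘ, hdet⟩ := exists_log_det zero_le_one hab hWc hWU
  have hrow : ∀ lam ∈ Icc a b, ContinuousOn (fun t => W (t, lam)) (Icc 0 1) := fun lam hl =>
    hWc.comp (by fun_prop) fun t ht => ⟨ht, hl⟩
  have hcol : ∀ t ∈ Icc (0 : ℝ) 1, ContinuousOn (fun lam => W (t, lam)) (Icc a b) := fun t ht =>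
    hWc.comp (by fun_prop) fun lam hl => ⟨ht, hl⟩
  have ha' : a ∈ Icc a b := left_mem_Icc.2 hab
  have hb' : b ∈ Icc a b := right_mem_Icc.2 hab
  have h0' : (0 : ℝ) ∈ Icc (0 : ℝ) 1 := by simp
  have h1' : (1 : ℝ) ∈ Icc (0 : ℝ) 1 := by simp
  -- the four sides of the rectangle
  have hright := maslov_eq_winding_sub (ℓ₁ := fun _ => ℓ)
    (ℓ₂ := fun t => compStab P V Q Pp Vp Qp t b) (Θ := fun t => Θ (t, b)) zero_le_one (hrow b hb')
    (fun t ht => hWU (t, b) ⟨ht, hb'⟩) (by fun_prop) (fun t ht => hdet (t, b) ⟨ht, hb'⟩)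
  have htop := maslov_eq_winding_sub (ℓ₁ := fun _ => ℓ)
    (ℓ₂ := fun lam => compStab P V Q Pp Vp Qp 1 lam) (Θ := fun lam => Θ (1, lam)) hab (hcol 1 h1')
    (fun lam hl => hWU (1, lam) ⟨h1', hl⟩) (by fun_prop) (fun lam hl => hdet (1, lam) ⟨h1', hl⟩)
  have hzero : ∀ t ∈ Icc (0 : ℝ) 1, crossingDim (W (t, a)) = 0 := fun t ht => by
    rw [hW, crossingDim_Wtilde hℓ (h.isLagrangian_compStab (hlt a ha') ht), hleft t ht,
      finrank_bot]
  obtain ⟨F₀, hF₀, hleft'⟩ := winding_sub_winding_eq_sum (V := fun t => W (t, a))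
    (Θ := fun t => Θ (t, a)) zero_le_one (hrow a ha') (fun t ht => hWU (t, a) ⟨ht, ha'⟩)
    (by fun_prop) (fun t ht => hdet (t, a) ⟨ht, ha'⟩) fun t ht =>
      clockwiseAt_of_notMem (hrow a ha') ht ((crossingDim_eq_zero_iff _).1 (hzero t ht))
  have hF₀e : F₀ = ∅ := Finset.eq_empty_of_forall_notMem fun t ht =>
    ((hF₀ t).1 ht).2 (hzero t (Ico_subset_Icc_self ((hF₀ t).1 ht).1))
  rw [hF₀e, Finset.sum_empty, Nat.cast_zero] at hleft'
  have hW0 : ∀ lam, W (0, lam) = Wtilde ℓ (stab P V Q 0 lam) := fun lam => by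
    simp only [hW, compStab_zero]
  have hcross : ∀ lam ∈ Icc a b, crossingDim (W (0, lam)) =
      Module.finrank ℂ (ℓ ⊓ stab P V Q 0 lam : Submodule ℂ (C2n n)) := fun lam hl => by
    rw [hW0, crossingDim_Wtilde hℓ (h.isLagrangian_stab (hlt lam hl) le_rfl)]
  obtain ⟨F, hF, hbot⟩ := winding_sub_winding_eq_sum (V := fun lam => W (0, lam))
    (Θ := fun lam => Θ (0, lam)) hab (hcol 0 h0') (fun lam hl => hWU (0, lam) ⟨h0', hl⟩)
    (by fun_prop) (fun lam hl => hdet (0, lam) ⟨h0', hl⟩) fun t ht => by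
      simp only [hW0]
      exact h.clockwiseAt hℓ hb ht
  refine ⟨F, fun t => ?_, ?_⟩
  · rw [hF]
    exact and_congr_right fun ht => by rw [hcross t (Ico_subset_Icc_self ht)]
  · have hsum : ∑ t ∈ F, Module.finrank ℂ (ℓ ⊓ stab P V Q 0 t : Submodule ℂ (C2n n)) =
        ∑ t ∈ F, crossingDim (W (0, t)) := Finset.sum_congr rfl fun t ht =>
      (hcross t (Ico_subset_Icc_self ((hF t).1 ht).1)).symm
    simp only [compStab_one] at htop
    rw [hsum, ← Int.cast_inj (α := ℝ)]
    rw [Int.cast_sub, Int.cast_natCast, ← hbot, hright, htop]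
    have e1 : Wtilde ℓ (stabPlus Pp Vp Qp a) = W (1, a) := by simp only [hW, compStab_one]
    have e2 : Wtilde ℓ (stabPlus Pp Vp Qp b) = W (1, b) := by simp only [hW, compStab_one]
    rw [e1, e2]
    simp only [hW] at hleft' ⊢
    -- With `w(t, λ)` for the winding number, the indices on `λ = b` and `t = 1` differ by `w(1, a)
    -- - w(0, b)`; the side `λ = a` gives `w(1, a) = w(0, a)`.
    linarith

end Regular

end Main

end SturmLiouville

open SturmLiouville

theorem theorem1p2 {n : ℕ} (hn : 0 < n)
    (P V Q : ℝ → Matrix (Fin n) (Fin n) ℂ)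
    (Pplus Vplus Qplus : Matrix (Fin n) (Fin n) ℂ)
    (α₁ α₂ : Matrix (Fin n) (Fin n) ℂ)
    (h1 : SturmLiouville.AssumptionA1 P V Q)
    (h2 : SturmLiouville.AssumptionA2 P V Q Pplus Vplus Qplus)
    (h3 : SturmLiouville.AssumptionA3 α₁ α₂) :
    -- the spaces are Lagrangian, the limits exist and the paths are continuous
    (SturmLiouville.IsLagrangian (SturmLiouville.ellOne α₁ α₂) ∧
      (∀ lam : ℝ, lam < SturmLiouville.kappa Vplus Qplus →
        (∀ x : ℝ, 0 ≤ x → SturmLiouville.IsLagrangian (SturmLiouville.ellTwo P V Q x lam)) ∧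
        SturmLiouville.PathContinuousOn
          (fun x => SturmLiouville.ellTwo P V Q x lam) (Set.Ici 0) ∧
        SturmLiouville.PathTendsto
          (fun x => SturmLiouville.ellTwo P V Q x lam) (SturmLiouville.ellTwoPlus P V Q lam) ∧
        SturmLiouville.IsLagrangian (SturmLiouville.ellTwoPlus P V Q lam)) ∧
      SturmLiouville.PathContinuousOn
        (fun lam => SturmLiouville.ellTwoPlus P V Q lam)
        (Set.Iio (SturmLiouville.kappa Vplus Qplus))) ∧
    -- the Morse index formula
    ∀ lam₀ : ℝ, lam₀ < SturmLiouville.kappa Vplus Qplus →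
      ∃ LamInf : ℝ, ∀ lamInf : ℝ, LamInf < lamInf →
        SturmLiouville.BoundaryInconjugate P V Q α₁ α₂ lamInf →
        ∃ m : ℕ, SturmLiouville.morse P V Q α₁ α₂ lam₀ = (m : ℕ∞) ∧
          (m : ℤ) =
            SturmLiouville.maslovHalfLine
              (fun _ => SturmLiouville.ellOne α₁ α₂)
              (fun x => SturmLiouville.ellTwo P V Q x lam₀) -
            SturmLiouville.maslov
              (fun _ => SturmLiouville.ellOne α₁ α₂)
              (fun lam => SturmLiouville.ellTwoPlus P V Q lam) (-lamInf) lam₀ := by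
  obtain ⟨P', V', Q', θ, C, η, h, hP, hVQ⟩ := exists_regular h1 h2
  have hE : ∀ {lam x : ℝ}, 0 ≤ x → ellTwo P V Q x lam = stab P' V' Q' x lam := fun hx =>
    h.ellTwo_eq_stab hP hVQ hx
  have hlim : ∀ lam, lam < kappa Vplus Qplus →
      PathTendsto (fun x => ellTwo P V Q x lam) (stabPlus Pplus Vplus Qplus lam) := by
    intro lam hl
    refine (h.tendsto_proj_stabPlus hl tendsto_const_nhds tendsto_id).congr' ?_
    filter_upwards [eventually_ge_atTop 0] with x hx
    rw [hE hx, id]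
  have hplus : ∀ lam, lam < kappa Vplus Qplus →
      ellTwoPlus P V Q lam = stabPlus Pplus Vplus Qplus lam := fun lam hl =>
    (hlim lam hl).limSpace_eq
  have hℓ := h3.isLagrangian_ellOne
  refine ⟨⟨hℓ, fun lam hl => ⟨fun x hx => ?_, fun x hx => ?_, ?_, ?_⟩, fun lam hl => ?_⟩, ?_⟩
  · rw [hE hx]
    exact h.isLagrangian_stab hl hx
  · have hx0 : 0 ≤ x := hx
    have hc := h.tendsto_proj_stab (l := 𝓝[Ici 0] x) (x := id) hl tendsto_const_nhds hx0
      (tendsto_id.mono_left inf_le_left) eventually_mem_nhdsWithin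
    rw [← hE hx0] at hc
    refine hc.congr' ?_
    filter_upwards [eventually_mem_nhdsWithin] with z hz
    rw [id, ← hE hz]
  · rw [hplus lam hl]
    exact hlim lam hl
  · rw [hplus lam hl]
    exact h.const.isLagrangian_stab hl le_rfl
  · have hl' : lam < kappa Vplus Qplus := hl
    -- The asymptotic space is the stable space of the constant system at `x = 0`, so its continuity
    -- in `λ` is a case of the general continuity.
    have hc := h.const.tendsto_proj_stab (l := 𝓝[Iio (kappa Vplus Qplus)] lam) (mu := id)
      (x := fun _ => 0) hl' (tendsto_id.mono_left inf_le_left) le_rfl tendsto_const_nhds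
      (Eventually.of_forall fun _ => le_rfl)
    change Tendsto (fun mu => proj (stabPlus Pplus Vplus Qplus mu)) _
      (𝓝 (proj (stabPlus Pplus Vplus Qplus lam))) at hc
    rw [← hplus lam hl'] at hc
    refine hc.congr' ?_
    filter_upwards [eventually_mem_nhdsWithin] with z hz
    rw [← hplus z hz]
  · intro lam₀ hl₀
    obtain ⟨Λ, hΛ⟩ := h.exists_inf_compStab_eq_bot hℓ
    -- The first bound excludes crossings at and below `-λ∞`; the second ensures `-λ∞ ≤ λ₀`.
    refine ⟨max (-Λ) (-lam₀), fun lamInf hlamInf _ => ?_⟩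
    have ha : -lamInf ≤ Λ := by linarith [(le_max_left (-Λ) (-lam₀)).trans_lt hlamInf]
    have hab : -lamInf ≤ lam₀ := by linarith [(le_max_right (-Λ) (-lam₀)).trans_lt hlamInf]
    obtain ⟨F, hF, hsum⟩ := h.exists_finset_crossings hℓ hab hl₀ (hΛ _ ha)
    refine ⟨_, ?_, hsum.trans ?_⟩
    · unfold morse
      rw [tsum_subtype (Iio lam₀) fun lam =>
        Cardinal.toENat (Module.rank ℂ (eigenspace P V Q α₁ α₂ lam)), tsum_eq_sum (s := F)]
      · rw [Nat.cast_sum]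
        refine Finset.sum_congr rfl fun lam hlam => ?_
        have hl := ((hF lam).1 hlam).1.2
        rw [indicator_of_mem (mem_Iio.2 hl), h.rank_eigenspace hP hVQ h1.acP (hl.trans hl₀) h3]
      · intro lam hlam
        by_cases hl : lam < lam₀
        · rw [indicator_of_mem (mem_Iio.2 hl), h.rank_eigenspace hP hVQ h1.acP (hl.trans hl₀) h3]
          rcases le_or_gt (-lamInf) lam with hge | hlt
          · have := (not_congr (hF lam)).1 hlam
            push Not at this
            rw [this ⟨hge, hl⟩, Nat.cast_zero]
          -- Below `-λ∞` there are no eigenvalues, by absence of crossings at `t = 0`.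
          · rw [← compStab_zero (Pp := Pplus) (Vp := Vplus) (Qp := Qplus),
              hΛ lam (hlt.le.trans ha) 0 (by simp), finrank_bot, Nat.cast_zero]
        · rw [indicator_of_notMem (by simpa using hl)]
    · have e1 : maslov (fun _ => ellOne α₁ α₂)
          (fun t => compStab P' V' Q' Pplus Vplus Qplus t lam₀) 0 1 =
          maslovHalfLine (fun _ => ellOne α₁ α₂) (fun x => ellTwo P V Q x lam₀) := by
        unfold maslovHalfLine
        refine maslov_congr (fun t _ => (compactify_const _ t).symm) fun t ht => ?_
        unfold compactify compStab
        split_ifs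
        · exact (hE (div_nonneg ht.1 (sub_nonneg.2 ht.2))).symm
        · exact (hplus lam₀ hl₀).symm
      have e2 : maslov (fun _ => ellOne α₁ α₂)
          (fun lam => stabPlus Pplus Vplus Qplus lam) (-lamInf) lam₀ =
          maslov (fun _ => ellOne α₁ α₂) (fun lam => ellTwoPlus P V Q lam) (-lamInf) lam₀ :=
        maslov_congr (fun _ _ => rfl) fun t ht => (hplus t (ht.2.trans_lt hl₀)).symm
      rw [e1, e2]
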